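/- **Setup.** Let $p$ be a prime, $\kappa$ a perfect field of characteristic $p$, $O_F = W(\kappa)$ and $d \geq 0$ an integer. Let $O_{L^{\square}}$ be the $p$-adic completion of the localization of $O_F[X_1^{\pm 1}, \ldots, X_d^{\pm 1}]$ at the prime ideal $(p)$, let $O_L$ be a finite étale $O_{L^{\square}}$-algebra that is a domain, and $L = \mathrm{Frac}(O_L)$ with algebraic closure $\overline{L}$. Let $L_\infty \subset \overline{L}$ be generated over $L$ by all $p$-power roots of unity and all $p$-power roots of $X_1, \ldots, X_d$, and let $\Gamma_L = \mathrm{Gal}(L_\infty/L)$ with the Krull topology. Fix in $L_\infty$ a compatible system $\varepsilon = (\varepsilon_n)_{n \geq 0}$ of primitive $p^n$-th roots of unity ($\varepsilon_0 = 1 \neq \varepsilon_1$, $\varepsilon_{n+1}^p = \varepsilon_n$) and compatible systems $X_i^\flat = (X_i, X_i^{1/p}, X_i^{1/p^2}, \ldots)$ of $p$-power roots of the $X_i$. For $\gamma \in \Gamma_L$ let $\chi(\gamma), c_i(\gamma) \in \mathbb{Z}_p$ be given by $\gamma(\varepsilon_n) = \varepsilon_n^{\chi(\gamma)}$ and $\gamma(X_i^{1/p^n})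 = \varepsilon_n^{c_i(\gamma)} X_i^{1/p^n}$ for all $n$. **Rings.** Let $\mathbf{A}_L^+ = O_L[[\mu]]$ (with $\mu = [\varepsilon]-1$, $X_i = [X_i^\flat]$), with the $(p,\mu)$-adic topology. Its Frobenius $\varphi$ is the unique ring endomorphism that is the Witt vector Frobenius on $O_F$, satisfies $\varphi(X_i) = X_i^p$ and $\varphi(\mu) = (1+\mu)^p - 1$, and lifts the $p$-power map $O_L \to \mathbf{A}_L^+/(p,\mu)$, $y \mapsto y^p$. Each $\gamma\in\Gamma_L$ acts by the unique ring endomorphism that is the identity on $O_F$, satisfies $\gamma(X_i) = (1+\mu)^{c_i(\gamma)} X_i$ and $\gamma(\mu) = (1+\mu)^{\chi(\gamma)} - 1$, and for which $\gamma(y) \equiv y \bmod (p,\mu)$ for all $y \in O_L$. Let $\mathbf{A}_L$ be the $p$-adic completion of $\mathbf{A}_L^+[1/\mu]$ with the induced $\varphi$ and $\Gamma_L$-action and with the weak topology (a basis of neighbourhoods of $0$ is given by $\mu^n \mathbf{A}_L^+ + p^n \mathbf{A}_L$). Put $\mathbf{B}_L^+ = \mathbf{A}_L^+[1/p]$, $\mathbf{B}_L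 = \mathbf{A}_L[1/p]$ and $[p]_q = \varphi(\mu)/\mu$. For a ring $A$ with an endomorphism $\varphi$ and an $A$-module $M$ write $\varphi^*M = A \otimes_{\varphi, A} M$. **Wach modules.** A Wach module over $\mathbf{A}_L^+$ is a finite free $\mathbf{A}_L^+$-module $N$ with a continuous semilinear action of $\Gamma_L$ that is trivial on $N/\mu N$, and a $\varphi$-semilinear operator $\varphi : N[1/\mu] \to N[1/\varphi(\mu)]$ commuting with $\Gamma_L$, for which there are integers $a \leq b$ such that $\varphi(\mu^b N) \subseteq \mu^b N$, the induced map $1 \otimes \varphi : \varphi^*(\mu^b N) \to \mu^b N$ is injective, and its cokernel is killed by $[p]_q^{b-a}$. A Wach module over $\mathbf{B}_L^+$ is a finitely generated $\mathbf{B}_L^+$-module $M$ with a semilinear action of $\Gamma_L$ and a $\varphi$-semilinear operator $M[1/\mu] \to M[1/\varphi(\mu)]$ commuting with $\Gamma_L$ such that there is a $\Gamma_L$-stable and (after inverting $\mu$) $\varphi$-stable $\mathbf{A}_L^+$-submodule $N \subseteq M$ that is a Wach module over $\mathbf{A}_L^+$ for the induced structures and satisfies $N[1/p] = M$. In both cases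 morphisms are the linear maps that commute with $\Gamma_L$ and (after inverting $\mu$) with $\varphi$. **Étale $(\varphi,\Gamma_L)$-modules.** An étale $(\varphi, \Gamma_L)$-module over $\mathbf{A}_L$ is a finite free $\mathbf{A}_L$-module $D$ with a continuous semilinear action of $\Gamma_L$ and a commuting $\varphi$-semilinear endomorphism $\varphi$ such that $1 \otimes \varphi : \varphi^* D \to D$ is an isomorphism. An étale $(\varphi, \Gamma_L)$-module over $\mathbf{B}_L$ is a finitely generated $\mathbf{B}_L$-module $V$ with a semilinear action of $\Gamma_L$ and a commuting $\varphi$-semilinear endomorphism such that there is a $\varphi$- and $\Gamma_L$-stable $\mathbf{A}_L$-submodule $D \subseteq V$ that is an étale $(\varphi,\Gamma_L)$-module over $\mathbf{A}_L$ for the induced structures and satisfies $D[1/p] = V$. In both cases morphisms are the linear maps that commute with $\varphi$ and $\Gamma_L$. **Statement.** 1. $N \mapsto \mathbf{A}_L \otimes_{\mathbf{A}_L^+} N$, with the induced $\varphi$ and $\Gamma_L$-action, is a well-defined and fully faithful functor from Wach modules over $\mathbf{A}_L^+$ to étale $(\varphi, \Gamma_L)$-modules over $\mathbf{A}_L$.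 2. $M \mapsto \mathbf{B}_L \otimes_{\mathbf{B}_L^+} M$, with the induced $\varphi$ and $\Gamma_L$-action, is a well-defined and fully faithful functor from Wach modules over $\mathbf{B}_L^+$ to étale $(\varphi, \Gamma_L)$-modules over $\mathbf{B}_L$. -/

import Mathlib

open scoped TensorProduct

universe u v

namespace Wach

noncomputable section

/-! ### Complete rings -/

section Complete

variable {R S : Type*} [CommRing R] [CommRing S]

theorem eq_of_forall_sub_mem (J : Ideal S) [IsHausdorff J S] {x y : S}
    (h : ∀ n : ℕ, x - y ∈ J ^ n) : x = y := by
  rw [IsHausdorff.eq_iff_smodEq (I := J)]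
  intro n
  rw [SModEq.sub_mem]
  simpa using h n

theorem exists_limit (J : Ideal S) [IsPrecomplete J S] (f : ℕ → S)
    (h : ∀ m n, m ≤ n → f m - f n ∈ J ^ m) : ∃ L, ∀ n, f n - L ∈ J ^ n := by
  obtain ⟨L, hL⟩ := IsPrecomplete.prec (I := J) (M := S) inferInstance (f := f) (by
    intro m n hmn
    rw [SModEq.sub_mem]
    simpa using h m n hmn)
  refine ⟨L, fun n => ?_⟩
  have := hL n
  rw [SModEq.sub_mem] at this
  simpa using this

theorem isUnit_of_sub_mem (J : Ideal S) [IsAdicComplete J S] {x y : S} (hx : IsUnit x)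
    (h : y - x ∈ J) : IsUnit y := by
  obtain ⟨u, rfl⟩ := hx
  have h1 := (Ideal.mem_jacobson_bot.mp (IsAdicComplete.le_jacobson_bot J h)) (↑u⁻¹ : S)
  have h2 : y = ((y - u) * (↑u⁻¹ : S) + 1) * u := by
    rw [add_mul, mul_assoc, Units.inv_mul]; ring
  rw [h2]
  exact h1.mul u.isUnit

theorem pow_le_comap (I : Ideal R) (J : Ideal S) (f : R →+* S) (h : I.map f ≤ J) (n : ℕ) :
    I ^ n ≤ (J ^ n).comap f := by
  rw [← Ideal.map_le_iff_le_comap, Ideal.map_pow]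
  exact Ideal.pow_right_mono h n

theorem completionLift_compat (I : Ideal R) (J : Ideal S) (f : R →+* S)
    (h : I.map f ≤ J) {m n : ℕ} (hmn : m ≤ n) :
    (Ideal.Quotient.factorPow J hmn).comp ((Ideal.quotientMap (J ^ n) f
      (pow_le_comap I J f h n)).comp (AdicCompletion.evalₐ I n).toRingHom) =
    (Ideal.quotientMap (J ^ m) f (pow_le_comap I J f h m)).comp
      (AdicCompletion.evalₐ I m).toRingHom := by
  ext x
  induction x using AdicCompletion.induction_on with
  | _ x =>
    have h1 := AdicCompletion.Ideal.mk_eq_mk I hmn x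
    have h2 : f (x.val n) - f (x.val m) ∈ J ^ m := by
      rw [← map_sub]
      exact pow_le_comap I J f h m (Ideal.Quotient.eq.mp h1)
    simpa [Ideal.Quotient.eq] using h2

/-- The ring homomorphism out of an adic completion that extends `f`. -/
def completionLift (I : Ideal R) (J : Ideal S) [IsAdicComplete J S] (f : R →+* S)
    (h : I.map f ≤ J) : AdicCompletion I R →+* S :=
  IsAdicComplete.liftRingHom J
    (fun n => (Ideal.quotientMap (J ^ n) f (pow_le_comap I J f h n)).comp
      (AdicCompletion.evalₐ I n).toRingHom)
    (completionLift_compat I J f h)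

theorem completionLift_of (I : Ideal R) (J : Ideal S) [IsAdicComplete J S] (f : R →+* S)
    (h : I.map f ≤ J) (x : R) :
    completionLift I J f h (algebraMap R (AdicCompletion I R) x) = f x := by
  refine eq_of_forall_sub_mem J fun n => ?_
  rw [← Ideal.Quotient.eq, completionLift,
    IsAdicComplete.mk_liftRingHom J _ (completionLift_compat I J f h)]
  simp [AdicCompletion.algebraMap_apply]

/-- Two ring homomorphisms out of an adic completion into a separated ring agree if they agree
on the original ring. -/
theorem completion_hom_ext (I : Ideal R) (hI : I.FG) (J : Ideal S) [IsHausdorff J S]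
    (f g : AdicCompletion I R →+* S)
    (hf : ∀ x ∈ I, f (algebraMap R (AdicCompletion I R) x) ∈ J)
    (h : ∀ x, f (algebraMap R (AdicCompletion I R) x) =
      g (algebraMap R (AdicCompletion I R) x)) : f = g := by
  have key : ∀ (k : AdicCompletion I R →+* S),
      (∀ x ∈ I, k (algebraMap R (AdicCompletion I R) x) ∈ J) → ∀ n,
      ∀ y ∈ (I ^ n • ⊤ : Submodule R (AdicCompletion I R)), k y ∈ J ^ n := by
    intro k hk n y hy
    refine Submodule.smul_induction_on hy ?_ ?_
    · intro r hr z _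
      rw [Algebra.smul_def, map_mul]
      refine Ideal.mul_mem_right _ _ ?_
      have h1 : I.map (k.comp (algebraMap R (AdicCompletion I R))) ≤ J :=
        Ideal.map_le_iff_le_comap.mpr fun x hx => hk x hx
      refine (Ideal.pow_right_mono h1 n) ?_
      rw [← Ideal.map_pow]
      exact Ideal.mem_map_of_mem (k.comp (algebraMap R (AdicCompletion I R))) hr
    · intro a b ha hb
      rw [map_add]
      exact add_mem ha hb
  ext x
  refine eq_of_forall_sub_mem J fun n => ?_
  obtain ⟨r, hr⟩ := Ideal.Quotient.mk_surjective (AdicCompletion.evalₐ I n x)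
  have hmem : x - algebraMap R (AdicCompletion I R) r ∈
      (I ^ n • ⊤ : Submodule R (AdicCompletion I R)) := by
    rw [AdicCompletion.pow_smul_top_eq_ker_eval hI, LinearMap.mem_ker]
    have h0 : AdicCompletion.evalₐ I n (x - algebraMap R (AdicCompletion I R) r) = 0 := by
      rw [map_sub, ← hr, AdicCompletion.algebraMap_apply]
      simp
    have h2 : (I ^ n • ⊤ : Ideal R) = I ^ n := by simp
    exact (Ideal.quotientEquivAlgOfEq R h2).injective (by rw [map_zero]; exact h0)
  have h1 := key f hf n _ hmem
  have h2 := key g (fun x hx => h x ▸ hf x hx) n _ hmem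
  rw [map_sub] at h1 h2
  have h3 := sub_mem h1 h2
  rw [h r] at h3
  simpa using h3

instance completion_isAdicComplete (x : R) :
    IsAdicComplete (Ideal.span {algebraMap R (AdicCompletion (Ideal.span {x}) R) x})
      (AdicCompletion (Ideal.span {x}) R) := by
  have h := AdicCompletion.isAdicComplete (I := Ideal.span {x}) (M := R)
    (Submodule.fg_span_singleton x)
  rw [← IsAdicComplete.map_algebraMap_iff (S := AdicCompletion (Ideal.span {x}) R),
    Ideal.map_span, Set.image_singleton] at h
  exact h

/-- A finite projective module over a complete ring is complete. -/
theorem isAdicComplete_of_projective (I : Ideal R) [IsAdicComplete I R] (M : Type*)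
    [AddCommGroup M] [Module R M] [Module.Finite R M] [Module.Projective R M] :
    IsAdicComplete I M := by
  obtain ⟨n, f, hf⟩ := Module.Finite.exists_fin' R M
  obtain ⟨g, hg⟩ := Module.projective_lifting_property f LinearMap.id hf
  have hgf : ∀ x, f (g x) = x := fun x => LinearMap.congr_fun hg x
  have hM : ∀ (k : ℕ) (l : M →ₗ[R] R) (v : M), v ∈ (I ^ k • ⊤ : Submodule R M) →
      l v ∈ I ^ k := by
    intro k l v hv
    have := Submodule.smul_top_le_comap_smul_top (I ^ k) l hv
    simpa using this
  have hpi' : ∀ (k : ℕ) (v : Fin n → R), (∀ i, v i ∈ I ^ k) → f v ∈ (I ^ k • ⊤ : Submodule R M) := by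
    intro k v hv
    rw [pi_eq_sum_univ v, map_sum]
    refine Submodule.sum_mem _ fun i _ => ?_
    rw [map_smul]
    exact Submodule.smul_mem_smul (hv i) trivial
  have H : IsHausdorff I M := ⟨fun x hx => by
    rw [← hgf x]
    have : g x = 0 := by
      funext i
      refine eq_of_forall_sub_mem I fun k => ?_
      have h1 := hx k
      rw [SModEq.zero] at h1
      simpa using hM k ((LinearMap.proj i).comp g) x h1
    rw [this, map_zero]⟩
  have P : IsPrecomplete I M := ⟨fun u hu => by
    have h1 : ∀ i : Fin n, ∃ L, ∀ k, g (u k) i - L ∈ I ^ k := fun i => by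
      refine exists_limit I (fun k => g (u k) i) fun a b hab => ?_
      have h2 := hu hab
      rw [SModEq.sub_mem] at h2
      simpa using hM a ((LinearMap.proj i).comp g) _ h2
    choose L hL using h1
    refine ⟨f L, fun k => ?_⟩
    rw [SModEq.sub_mem]
    have := hpi' k (g (u k) - L) fun i => hL i k
    rwa [map_sub, hgf] at this⟩
  exact { }

end Complete

/-! ### Power series over a complete ring -/

section PowerSeries

open PowerSeries

variable {R S : Type*} [CommRing R] [CommRing S]

/-- The ideal `(ϖ, X)` of `R⟦X⟧`. -/
def idealCX (ϖ : R) : Ideal R⟦X⟧ := Ideal.span {C ϖ, X}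

theorem coeff_mem_of_mem_pow (ϖ : R) (n : ℕ) (f : R⟦X⟧) (hf : f ∈ idealCX ϖ ^ n) (i : ℕ) :
    ϖ ^ (n - i) ∣ coeff i f := by
  induction n generalizing f i with
  | zero => simp
  | succ n ih =>
    rw [pow_succ] at hf
    refine Submodule.mul_induction_on hf ?_ ?_
    · intro a ha b hb
      obtain ⟨c, d, rfl⟩ := Ideal.mem_span_pair.mp hb
      have h : a * (c * C ϖ + d * X) = C ϖ * (a * c) + X * (a * d) := by ring
      rw [h, map_add, coeff_C_mul]
      refine dvd_add ?_ ?_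
      · refine (pow_dvd_pow ϖ (by omega : n + 1 - i ≤ (n - i) + 1)).trans ?_
        rw [pow_succ']
        exact mul_dvd_mul_left _ (ih _ (Ideal.mul_mem_right _ _ ha) i)
      · cases i with
        | zero => simp
        | succ i =>
          rw [mul_comm X, coeff_succ_mul_X]
          have := ih _ (Ideal.mul_mem_right d _ ha) i
          rwa [show n + 1 - (i + 1) = n - i by omega]
    · intro a b ha hb
      rw [map_add]
      exact dvd_add ha hb

theorem mem_pow_of_coeff (ϖ : R) (n : ℕ) (f : R⟦X⟧) (hf : ∀ i, ϖ ^ (n - i) ∣ coeff i f) :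
    f ∈ idealCX ϖ ^ n := by
  have hX : (X : R⟦X⟧) ∈ idealCX ϖ := Ideal.subset_span (by simp)
  have hC : C ϖ ∈ idealCX ϖ := Ideal.subset_span (by simp)
  have h1 : (X : R⟦X⟧) ^ n ∣ f - (trunc n f : Polynomial R) := by
    rw [X_pow_dvd_iff]
    intro m hm
    simp [coeff_trunc, hm]
  obtain ⟨g, hg⟩ := h1
  rw [sub_eq_iff_eq_add] at hg
  rw [hg]
  refine add_mem (Ideal.mul_mem_right _ _ (Ideal.pow_mem_pow hX n)) ?_
  rw [(trunc n f).as_sum_range_C_mul_X_pow, ← Polynomial.coeToPowerSeries.ringHom_apply, map_sum]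
  refine sum_mem fun i _ => ?_
  rw [map_mul, map_pow, Polynomial.coeToPowerSeries.ringHom_apply,
    Polynomial.coeToPowerSeries.ringHom_apply, Polynomial.coe_C, Polynomial.coe_X, coeff_trunc]
  split_ifs with hi
  · obtain ⟨c, hc⟩ := hf i
    rw [hc, map_mul, map_pow, mul_right_comm]
    refine Ideal.mul_mem_right _ _ ?_
    have := Ideal.mul_mem_mul (Ideal.pow_mem_pow hC (n - i)) (Ideal.pow_mem_pow hX i)
    rwa [← pow_add, Nat.sub_add_cancel hi.le] at this
  · simp

theorem powerSeries_isAdicComplete (ϖ : R) [IsAdicComplete (Ideal.span {ϖ}) R] :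
    IsAdicComplete (idealCX ϖ) R⟦X⟧ := by
  have e : ∀ (n : ℕ) (x : R), ϖ ^ n ∣ x ↔ x ∈ Ideal.span {ϖ} ^ n := fun n x => by
    rw [Ideal.span_singleton_pow, Ideal.mem_span_singleton]
  have H : IsHausdorff (idealCX ϖ) R⟦X⟧ := ⟨fun f hf => by
    ext i
    refine eq_of_forall_sub_mem (Ideal.span {ϖ}) fun n => ?_
    have h := hf (n + i)
    rw [SModEq.zero] at h
    have := coeff_mem_of_mem_pow ϖ (n + i) f (by simpa using h) i
    rw [← e]
    simpa using this⟩
  have P : IsPrecomplete (idealCX ϖ) R⟦X⟧ := ⟨fun u hu => by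
    have h1 : ∀ i : ℕ, ∃ L, ∀ n, coeff i (u (n + i)) - L ∈ Ideal.span {ϖ} ^ n := fun i => by
      refine exists_limit _ (fun n => coeff i (u (n + i))) fun a b hab => ?_
      have h2 := hu (Nat.add_le_add_right hab i)
      rw [SModEq.sub_mem] at h2
      have := coeff_mem_of_mem_pow ϖ (a + i) _ (by simpa using h2) i
      rw [← e, ← map_sub]
      simpa using this
    choose L hL using h1
    refine ⟨mk L, fun n => ?_⟩
    rw [SModEq.sub_mem]
    have : u n - mk L ∈ idealCX ϖ ^ n := by
      refine mem_pow_of_coeff ϖ n _ fun i => ?_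
      by_cases hi : i ≤ n
      · have := hL i (n - i)
        rw [Nat.sub_add_cancel hi, ← e] at this
        simpa using this
      · rw [Nat.sub_eq_zero_of_le (by omega)]
        simp
    simpa using this⟩
  exact { }

/-- Substitution of `s` for the variable, and `f` on the coefficients, modulo `J ^ n`. -/
def evalMod (J : Ideal S) (f : R →+* S) (s : S) (hs : s ∈ J) (n : ℕ) : R⟦X⟧ →+* S ⧸ J ^ n :=
  have key : ∀ P : Polynomial R, Ideal.Quotient.mk (J ^ n) ((trunc n (P : R⟦X⟧)).eval₂ f s) =
      Ideal.Quotient.mk (J ^ n) (P.eval₂ f s) := by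
    intro P
    have h1 : (Polynomial.X : Polynomial R) ^ n ∣ P - trunc n (P : R⟦X⟧) := by
      rw [Polynomial.X_pow_dvd_iff]
      intro d hd
      simp [coeff_trunc, hd]
    obtain ⟨Q, hQ⟩ := h1
    rw [eq_comm, Ideal.Quotient.eq, ← Polynomial.eval₂_sub, hQ, Polynomial.eval₂_mul,
      Polynomial.eval₂_X_pow]
    exact Ideal.mul_mem_right _ _ (Ideal.pow_mem_pow hs n)
  { toFun := fun a => Ideal.Quotient.mk (J ^ n) ((trunc n a).eval₂ f s)
    map_one' := by
      have := key 1
      simpa using this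
    map_zero' := by simp
    map_add' := fun a b => by simp [Polynomial.eval₂_add]
    map_mul' := fun a b => by
      rw [← trunc_trunc_mul_trunc, ← Polynomial.coe_mul, key, Polynomial.eval₂_mul, map_mul] }

theorem evalMod_compat (J : Ideal S) (f : R →+* S) (s : S) (hs : s ∈ J) {m n : ℕ} (hmn : m ≤ n) :
    (Ideal.Quotient.factorPow J hmn).comp (evalMod J f s hs n) = evalMod J f s hs m := by
  ext a
  have h1 : (Polynomial.X : Polynomial R) ^ m ∣ trunc n a - trunc m a := by
    rw [Polynomial.X_pow_dvd_iff]
    intro d hd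
    simp [coeff_trunc, hd, hd.trans_le hmn]
  obtain ⟨Q, hQ⟩ := h1
  have : Ideal.Quotient.mk (J ^ m) ((trunc n a).eval₂ f s) =
      Ideal.Quotient.mk (J ^ m) ((trunc m a).eval₂ f s) := by
    rw [Ideal.Quotient.eq, ← Polynomial.eval₂_sub, hQ, Polynomial.eval₂_mul,
      Polynomial.eval₂_X_pow]
    exact Ideal.mul_mem_right _ _ (Ideal.pow_mem_pow hs m)
  simpa [evalMod] using this

/-- The ring homomorphism `∑ aₙ Xⁿ ↦ ∑ f(aₙ) sⁿ`, for `s` in an ideal `J` for which the target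
is complete. -/
def psEval (J : Ideal S) [IsAdicComplete J S] (f : R →+* S) (s : S) (hs : s ∈ J) : R⟦X⟧ →+* S :=
  IsAdicComplete.liftRingHom J (evalMod J f s hs) (evalMod_compat J f s hs)

theorem psEval_coe (J : Ideal S) [IsAdicComplete J S] (f : R →+* S) (s : S) (hs : s ∈ J)
    (P : Polynomial R) : psEval J f s hs P = P.eval₂ f s := by
  refine eq_of_forall_sub_mem J fun n => ?_
  rw [← Ideal.Quotient.eq, psEval, IsAdicComplete.mk_liftRingHom J _ (evalMod_compat J f s hs)]
  have h1 : (Polynomial.X : Polynomial R) ^ n ∣ trunc n (P : R⟦X⟧) - P := by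
    rw [Polynomial.X_pow_dvd_iff]
    intro d hd
    simp [coeff_trunc, hd]
  obtain ⟨Q, hQ⟩ := h1
  change Ideal.Quotient.mk (J ^ n) _ = _
  rw [Ideal.Quotient.eq, ← Polynomial.eval₂_sub, hQ, Polynomial.eval₂_mul,
      Polynomial.eval₂_X_pow]
  exact Ideal.mul_mem_right _ _ (Ideal.pow_mem_pow hs n)

theorem psEval_C (J : Ideal S) [IsAdicComplete J S] (f : R →+* S) (s : S) (hs : s ∈ J) (r : R) :
    psEval J f s hs (C r) = f r := by
  simpa using psEval_coe J f s hs (Polynomial.C r)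

theorem psEval_X (J : Ideal S) [IsAdicComplete J S] (f : R →+* S) (s : S) (hs : s ∈ J) :
    psEval J f s hs X = s := by
  simpa using psEval_coe J f s hs Polynomial.X

theorem ps_hom_ext (J : Ideal S) [IsHausdorff J S] (f g : R⟦X⟧ →+* S) (hX : f X ∈ J)
    (h : f X = g X) (hC : ∀ r, f (C r) = g (C r)) : f = g := by
  ext a
  refine eq_of_forall_sub_mem J fun n => ?_
  have h1 : (X : R⟦X⟧) ^ n ∣ a - (trunc n a : Polynomial R) := by
    rw [X_pow_dvd_iff]
    intro m hm
    simp [coeff_trunc, hm]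
  obtain ⟨b, hb⟩ := h1
  have h2 : f (trunc n a : Polynomial R) = g (trunc n a : Polynomial R) := by
    have : (f.comp Polynomial.coeToPowerSeries.ringHom) =
        (g.comp Polynomial.coeToPowerSeries.ringHom) := by
      ext r
      · simp [hC]
      · simp [h]
    exact congr($this (trunc n a))
  rw [sub_eq_iff_eq_add] at hb
  rw [hb, map_add, map_add, h2, map_mul, map_mul, map_pow, map_pow, ← h]
  have : f X ^ n * f b + g (trunc n a : Polynomial R) - (f X ^ n * g b + g (trunc n a : Polynomial R))
    = f X ^ n * (f b - g b) := by ring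
  rw [this]
  exact Ideal.mul_mem_right _ _ (Ideal.pow_mem_pow hX n)

end PowerSeries

/-! ### The discrete valuation ring `O_{L^□}` and its finite étale extension `O_L` -/

section Base

variable (p : ℕ) [Fact p.Prime] (κ : Type u) [Field κ] [CharP κ p] [PerfectRing κ p] (d : ℕ)

/-- The ideal `(p)` of `W(κ)[X₁, …, X_d]`. -/
def pIdeal : Ideal (MvPolynomial (Fin d) (WittVector p κ)) := 
  Ideal.span {(p : MvPolynomial (Fin d) (WittVector p κ))}

instance pIdeal_isPrime : (pIdeal p κ d).IsPrime := by
  have h : Prime (p : WittVector p κ) := (WittVector.irreducible p).prime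
  have h2 : Prime (p : MvPolynomial (Fin d) (WittVector p κ)) := by
    have := (MvPolynomial.prime_C_iff (Fin d)).mpr h
    simpa using this
  exact (Ideal.span_singleton_prime h2.ne_zero).mpr h2

/-- The localisation of `O_F[X₁^{±1}, …, X_d^{±1}]` at the prime ideal `(p)`, where `O_F = W(κ)`.
The variables do not lie in `(p)`, so it is the localisation of `O_F[X₁, …, X_d]` at `(p)`. -/
abbrev OLsqLoc : Type u := Localization.AtPrime (pIdeal p κ d)

/-- The ring `O_{L^□}`: the `p`-adic completion of the localisation of
`O_F[X₁^{±1}, …, X_d^{±1}]` at `(p)`. -/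
abbrev OLsq : Type u := AdicCompletion (Ideal.span {(p : OLsqLoc p κ d)}) (OLsqLoc p κ d)

variable (OL : Type v) [CommRing OL] [Algebra (OLsq p κ d) OL]

/-- The natural map `O_F[X₁, …, X_d] → O_L`. -/
def polyMap : MvPolynomial (Fin d) (WittVector p κ) →+* OL :=
  ((algebraMap (OLsq p κ d) OL).comp (algebraMap (OLsqLoc p κ d) (OLsq p κ d))).comp
    (algebraMap (MvPolynomial (Fin d) (WittVector p κ)) (OLsqLoc p κ d))

/-- The natural map `O_F = W(κ) → O_L`. -/
def ofWitt : WittVector p κ →+* OL := (polyMap p κ d OL).comp MvPolynomial.C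

/-- The element `X_i` of `O_L`. -/
def xOL (i : Fin d) : OL := polyMap p κ d OL (MvPolynomial.X i)

instance OLsq_isAdicComplete : IsAdicComplete (Ideal.span {(p : OLsq p κ d)}) (OLsq p κ d) := by
  have := completion_isAdicComplete (p : OLsqLoc p κ d)
  rwa [map_natCast] at this

variable [Algebra.Etale (OLsq p κ d) OL]

theorem OL_isAdicComplete [Module.Finite (OLsq p κ d) OL] :
    IsAdicComplete (Ideal.span {(p : OL)}) OL := by
  have : Module.FinitePresentation (OLsq p κ d) OL :=
    Module.FinitePresentation.of_finite_of_finitePresentation _ _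
  have : Module.Flat (OLsq p κ d) OL := inferInstance
  have : Module.Projective (OLsq p κ d) OL := Module.Flat.projective_of_finitePresentation
  have h := isAdicComplete_of_projective (Ideal.span {(p : OLsq p κ d)}) OL
  rw [← IsAdicComplete.map_algebraMap_iff (S := OL), Ideal.map_span, Set.image_singleton,
    map_natCast] at h
  exact h

variable {S : Type*} [CommRing S]

/-- Ring homomorphisms from `O_L` into a ring `S` complete for an ideal `J ∋ p` are obtained from
the images of `W(κ)` and of the `X_i`, together with the reduction `O_L → S/J`. -/
theorem exists_OL_lift (J : Ideal S) [IsAdicComplete J S] (hp : (p : S) ∈ J)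
    (a : WittVector p κ →+* S) (x : Fin d → S) (β : OL →+* S ⧸ J)
    (ha : ∀ w, Ideal.Quotient.mk J (a w) = β (ofWitt p κ d OL w))
    (hx : ∀ i, Ideal.Quotient.mk J (x i) = β (xOL p κ d OL i)) :
    ∃ g : OL →+* S, (∀ w, g (ofWitt p κ d OL w) = a w) ∧ (∀ i, g (xOL p κ d OL i) = x i) ∧
      ∀ y, Ideal.Quotient.mk J (g y) = β y := by
  let f₀ : MvPolynomial (Fin d) (WittVector p κ) →+* S := MvPolynomial.eval₂Hom a x
  have h₀ : (Ideal.Quotient.mk J).comp f₀ = β.comp (polyMap p κ d OL) := by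
    ext i
    · simpa [f₀, ofWitt] using ha _
    · simpa [f₀, xOL] using hx i
  have hu : ∀ f : (pIdeal p κ d).primeCompl, IsUnit (f₀ f) := by
    intro f
    have h1 : IsUnit (β (polyMap p κ d OL f)) := by
      have : IsUnit (algebraMap (MvPolynomial (Fin d) (WittVector p κ)) (OLsqLoc p κ d) f) :=
        IsLocalization.map_units _ f
      exact (((this.map (algebraMap (OLsqLoc p κ d) (OLsq p κ d))).map
        (algebraMap (OLsq p κ d) OL))).map β
    have h2 : Ideal.Quotient.mk J (f₀ f) = β (polyMap p κ d OL f) := congr($h₀ f)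
    rw [← h2] at h1
    obtain ⟨v, hv⟩ := h1.exists_right_inv
    obtain ⟨v, rfl⟩ := Ideal.Quotient.mk_surjective v
    rw [← map_mul, ← map_one (Ideal.Quotient.mk J), Ideal.Quotient.eq] at hv
    exact isUnit_of_mul_isUnit_left (isUnit_of_sub_mem J isUnit_one hv)
  let f₁ : OLsqLoc p κ d →+* S := IsLocalization.lift (M := (pIdeal p κ d).primeCompl) hu
  have f₁_of : ∀ f, f₁ (algebraMap _ _ f) = f₀ f := fun f => IsLocalization.lift_eq hu f
  have hI : (Ideal.span {(p : OLsqLoc p κ d)}).map f₁ ≤ J := by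
    rw [Ideal.map_span, Set.image_singleton, map_natCast, Ideal.span_singleton_le_iff_mem]
    exact hp
  let f₂ : OLsq p κ d →+* S := completionLift _ J f₁ hI
  have f₂_of : ∀ f, f₂ (algebraMap _ _ f) = f₁ f := fun f => completionLift_of _ J f₁ hI f
  have h₁ : (Ideal.Quotient.mk J).comp f₁ = β.comp ((algebraMap (OLsq p κ d) OL).comp
      (algebraMap (OLsqLoc p κ d) (OLsq p κ d))) := by
    refine IsLocalization.ringHom_ext (pIdeal p κ d).primeCompl ?_
    refine RingHom.ext fun f => ?_
    rw [RingHom.comp_apply, RingHom.comp_apply, f₁_of]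
    exact congr($h₀ f)
  have h₂ : (Ideal.Quotient.mk J).comp f₂ = β.comp (algebraMap (OLsq p κ d) OL) := by
    refine completion_hom_ext _ (Submodule.fg_span_singleton _) (⊥ : Ideal (S ⧸ J)) _ _ ?_ ?_
    · intro y hy
      rw [RingHom.comp_apply, f₂_of, Ideal.mem_bot, Ideal.Quotient.eq_zero_iff_mem]
      exact hI (Ideal.mem_map_of_mem _ hy)
    · intro y
      rw [RingHom.comp_apply, f₂_of]
      exact congr($h₁ y)
  let _ : Algebra (OLsq p κ d) S := f₂.toAlgebra
  let β' : OL →ₐ[OLsq p κ d] S ⧸ J :=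
    { β with commutes' := fun r => (congr($h₂ r)).symm }
  obtain ⟨g, hg⟩ := Algebra.FormallySmooth.exists_mkₐ_comp_eq_of_isAdicComplete β'
  have hg' : ∀ f, g (polyMap p κ d OL f) = f₀ f := by
    intro f
    rw [← f₁_of, ← f₂_of]
    exact g.commutes _
  refine ⟨g, fun w => ?_, fun i => ?_, fun y => congr($hg y)⟩
  · exact (hg' _).trans (by simp [f₀])
  · exact (hg' _).trans (by simp [f₀])

theorem OL_hom_ext (J : Ideal S) [IsHausdorff J S] (hp : (p : S) ∈ J) (g h : OL →+* S)
    (ha : ∀ w, g (ofWitt p κ d OL w) = h (ofWitt p κ d OL w))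
    (hx : ∀ i, g (xOL p κ d OL i) = h (xOL p κ d OL i))
    (hβ : ∀ y, Ideal.Quotient.mk J (g y) = Ideal.Quotient.mk J (h y)) : g = h := by
  have h₀ : g.comp (polyMap p κ d OL) = h.comp (polyMap p κ d OL) := by
    ext i
    · exact ha i
    · exact hx i
  have h₁ : (g.comp (algebraMap (OLsq p κ d) OL)).comp (algebraMap (OLsqLoc p κ d) (OLsq p κ d)) =
      (h.comp (algebraMap (OLsq p κ d) OL)).comp (algebraMap (OLsqLoc p κ d) (OLsq p κ d)) :=
    IsLocalization.ringHom_ext (pIdeal p κ d).primeCompl h₀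
  have h₂ : g.comp (algebraMap (OLsq p κ d) OL) = h.comp (algebraMap (OLsq p κ d) OL) := by
    refine completion_hom_ext _ (Submodule.fg_span_singleton _) J _ _ ?_ fun x => congr($h₁ x)
    intro y hy
    obtain ⟨z, rfl⟩ := Ideal.mem_span_singleton'.mp hy
    rw [map_mul, map_mul, map_natCast, map_natCast]
    exact Ideal.mul_mem_left _ _ hp
  let _ : Algebra (OLsq p κ d) S := (g.comp (algebraMap (OLsq p κ d) OL)).toAlgebra
  let g' : OL →ₐ[OLsq p κ d] S := { g with commutes' := fun r => rfl }
  let h' : OL →ₐ[OLsq p κ d] S := { h with commutes' := fun r => (congr($h₂ r)).symm }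
  have hJ : ⨅ i, J ^ i = ⊥ := by
    rw [eq_bot_iff]
    intro x hx
    rw [Ideal.mem_bot]
    exact eq_of_forall_sub_mem J fun n => by simpa using (Ideal.mem_iInf.mp hx) n
  have := Algebra.FormallyUnramified.ext_of_iInf (R := OLsq p κ d) (A := OL) J hJ
    (g₁ := g') (g₂ := h') hβ
  ext y
  exact congr($this y)

end Base

/-! ### Powers with `p`-adic exponents -/

section PadicPow

theorem pow_p_pow_sub_one_mem {p : ℕ} {S : Type*} [CommRing S] (J : Ideal S) (hp : (p : S) ∈ J) {q : S}
    (hq : q - 1 ∈ J) (n : ℕ) :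
    q ^ p ^ n - 1 ∈ J ^ n := by
  suffices h : q ^ p ^ n - 1 ∈ J ^ (n + 1) from Ideal.pow_le_pow_right n.le_succ h
  induction n with
  | zero => simpa using hq
  | succ n ih =>
    have hr := ih
    set r := q ^ p ^ n with hrdef
    have h1 : q ^ p ^ (n + 1) - 1 = (r - 1) * ∑ i ∈ Finset.range p, r ^ i := by
      rw [mul_comm, geom_sum_mul, hrdef, ← pow_mul, ← pow_succ]
    rw [h1, pow_succ]
    refine Ideal.mul_mem_mul hr ?_
    have hr1 : r - 1 ∈ J := Ideal.pow_le_self (Nat.succ_ne_zero n) hr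
    have h2 : ∑ i ∈ Finset.range p, r ^ i = ∑ i ∈ Finset.range p, (r ^ i - 1) + p := by
      simp
    rw [h2]
    refine add_mem (sum_mem fun i _ => ?_) hp
    obtain ⟨c, hc⟩ := sub_dvd_pow_sub_pow r 1 i
    rw [one_pow] at hc
    rw [hc]
    exact Ideal.mul_mem_right _ _ hr1

variable {p : ℕ} [Fact p.Prime]

theorem exists_nat_approx (a : ℤ_[p]) (n : ℕ) : ∃ m : ℕ, (p : ℤ_[p]) ^ n ∣ a - m :=
  ⟨a.appr n, by
    rw [← Ideal.mem_span_singleton]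
    exact PadicInt.appr_spec n a⟩

theorem pow_dvd_of_padic {n k l : ℕ} (hkl : k ≤ l) (h : (p : ℤ_[p]) ^ n ∣ (l : ℤ_[p]) - k) :
    p ^ n ∣ l - k := by
  rw [← Nat.cast_sub hkl] at h
  have : (p : ℤ_[p]) ^ n ∣ (((l - k : ℕ) : ℤ) : ℤ_[p]) := by simpa using h
  rw [PadicInt.pow_p_dvd_int_iff] at this
  exact_mod_cast this

variable {S S' : Type*} [CommRing S] [CommRing S']

theorem pow_sub_pow_mem (J : Ideal S) (hp : (p : S) ∈ J) {q : S} (hq : q - 1 ∈ J) {n k l : ℕ}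
    (h : (p : ℤ_[p]) ^ n ∣ (l : ℤ_[p]) - k) : q ^ l - q ^ k ∈ J ^ n := by
  wlog hkl : k ≤ l generalizing k l
  · rw [← neg_sub]
    refine neg_mem (this ?_ (by omega))
    rw [← neg_sub]
    exact (dvd_neg).mpr h
  obtain ⟨c, hc⟩ := pow_dvd_of_padic hkl h
  obtain ⟨e, he⟩ := sub_dvd_pow_sub_pow (q ^ p ^ n) 1 c
  have h1 : q ^ l - q ^ k = q ^ k * ((q ^ p ^ n) ^ c - 1 ^ c) := by
    rw [← pow_mul, ← hc, one_pow, mul_sub, ← pow_add, Nat.add_sub_cancel' hkl, mul_one]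
  rw [h1, he]
  exact Ideal.mul_mem_left _ _ (Ideal.mul_mem_right _ _ (pow_p_pow_sub_one_mem J hp hq n))

theorem exists_padicPow (J : Ideal S) [IsAdicComplete J S] (hp : (p : S) ∈ J) {q : S}
    (hq : q - 1 ∈ J) (a : ℤ_[p]) :
    ∃ y : S, ∀ n m : ℕ, (p : ℤ_[p]) ^ n ∣ a - m → y - q ^ m ∈ J ^ n := by
  choose k hk using exists_nat_approx a
  have hd : ∀ m n l : ℕ, m ≤ n → (p : ℤ_[p]) ^ m ∣ a - l → q ^ k n - q ^ l ∈ J ^ m := by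
    intro m n l hmn hl
    refine pow_sub_pow_mem J hp hq ?_
    have h1 := (pow_dvd_pow (p : ℤ_[p]) hmn).trans (hk n)
    have h2 : ((k n : ℕ) : ℤ_[p]) - l = (a - l) - (a - k n) := by ring
    rw [h2]
    exact dvd_sub hl h1
  obtain ⟨L, hL⟩ := exists_limit J (fun n => q ^ k n) (fun m n hmn => by
    rw [← neg_sub]
    exact neg_mem (hd m n (k m) hmn (hk m)))
  refine ⟨L, fun n m hm => ?_⟩
  have h1 := hd n n m le_rfl hm
  have h2 := sub_mem h1 (hL n)
  simpa using h2

/-- The power `q ^ a`, for a `p`-adic integer `a`, in a ring complete for an ideal `J` that contains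
`p` and `q - 1`: the element congruent to `q ^ m` modulo `J ^ n` whenever `m` is a natural number
congruent to `a` modulo `p ^ n`. -/
def padicPow (J : Ideal S) [IsAdicComplete J S] (hp : (p : S) ∈ J) {q : S}
    (hq : q - 1 ∈ J) (a : ℤ_[p]) : S :=
  (exists_padicPow J hp hq a).choose

theorem padicPow_spec (J : Ideal S) [IsAdicComplete J S] (hp : (p : S) ∈ J) {q : S}
    (hq : q - 1 ∈ J) (a : ℤ_[p]) {n m : ℕ} (h : (p : ℤ_[p]) ^ n ∣ a - m) :
    padicPow J hp hq a - q ^ m ∈ J ^ n :=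
  (exists_padicPow J hp hq a).choose_spec n m h

theorem padicPow_unique (J : Ideal S) [IsAdicComplete J S] (hp : (p : S) ∈ J) {q : S}
    (hq : q - 1 ∈ J) (a : ℤ_[p]) (y : S)
    (h : ∀ n : ℕ, ∃ m : ℕ, (p : ℤ_[p]) ^ n ∣ a - m ∧ y - q ^ m ∈ J ^ n) :
    y = padicPow J hp hq a := by
  refine eq_of_forall_sub_mem J fun n => ?_
  obtain ⟨m, hm, hy⟩ := h n
  have := sub_mem hy (padicPow_spec J hp hq a hm)
  simpa using this

theorem padicPow_sub_one_mem (J : Ideal S) [IsAdicComplete J S] (hp : (p : S) ∈ J) {q : S}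
    (hq : q - 1 ∈ J) (a : ℤ_[p]) : padicPow J hp hq a - 1 ∈ J := by
  obtain ⟨m, hm⟩ := exists_nat_approx a 1
  have h1 := padicPow_spec J hp hq a hm
  rw [pow_one] at h1
  obtain ⟨c, hc⟩ := sub_dvd_pow_sub_pow q 1 m
  rw [one_pow] at hc
  have h2 : q ^ m - 1 ∈ J := hc ▸ Ideal.mul_mem_right _ _ hq
  simpa using add_mem h1 h2

theorem padicPow_natCast (J : Ideal S) [IsAdicComplete J S] (hp : (p : S) ∈ J) {q : S}
    (hq : q - 1 ∈ J) (m : ℕ) : padicPow J hp hq (m : ℤ_[p]) = q ^ m :=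
  (padicPow_unique J hp hq _ _ fun n => ⟨m, by simp, by simp⟩).symm

theorem padicPow_add (J : Ideal S) [IsAdicComplete J S] (hp : (p : S) ∈ J) {q : S}
    (hq : q - 1 ∈ J) (a b : ℤ_[p]) :
    padicPow J hp hq (a + b) = padicPow J hp hq a * padicPow J hp hq b := by
  refine (padicPow_unique J hp hq _ _ fun n => ?_).symm
  obtain ⟨m, hm⟩ := exists_nat_approx a n
  obtain ⟨l, hl⟩ := exists_nat_approx b n
  refine ⟨m + l, ?_, ?_⟩
  · have : a + b - ((m + l : ℕ) : ℤ_[p]) = (a - m) + (b - l) := by push_cast; ring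
    rw [this]
    exact dvd_add hm hl
  · have h1 := padicPow_spec J hp hq a hm
    have h2 := padicPow_spec J hp hq b hl
    have : padicPow J hp hq a * padicPow J hp hq b - q ^ (m + l) =
        (padicPow J hp hq a - q ^ m) * padicPow J hp hq b + q ^ m *
          (padicPow J hp hq b - q ^ l) := by ring
    rw [this]
    exact add_mem (Ideal.mul_mem_right _ _ h1) (Ideal.mul_mem_left _ _ h2)

theorem padicPow_mul (J : Ideal S) [IsAdicComplete J S] (hp : (p : S) ∈ J) {q : S}
    (hq : q - 1 ∈ J) (a b : ℤ_[p]) :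
    padicPow J hp hq (a * b) = padicPow J hp (padicPow_sub_one_mem J hp hq a) b := by
  refine (padicPow_unique J hp hq _ _ fun n => ?_).symm
  obtain ⟨m, hm⟩ := exists_nat_approx a n
  obtain ⟨l, hl⟩ := exists_nat_approx b n
  refine ⟨m * l, ?_, ?_⟩
  · have : a * b - ((m * l : ℕ) : ℤ_[p]) = (a - m) * b + m * (b - l) := by push_cast; ring
    rw [this]
    exact dvd_add (hm.mul_right _) (hl.mul_left _)
  · have h1 := padicPow_spec J hp hq a hm
    have h2 := padicPow_spec J hp (padicPow_sub_one_mem J hp hq a) b hl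
    obtain ⟨c, hc⟩ := sub_dvd_pow_sub_pow (padicPow J hp hq a) (q ^ m) l
    have h3 := add_mem h2 (hc ▸ Ideal.mul_mem_right c _ h1)
    rw [pow_mul]
    simpa using h3

theorem map_padicPow (J : Ideal S) [IsAdicComplete J S] (hp : (p : S) ∈ J) {q : S}
    (hq : q - 1 ∈ J) (J' : Ideal S') [IsAdicComplete J' S'] (hp' : (p : S') ∈ J')
    (f : S →+* S') (hf : J.map f ≤ J') (hq' : f q - 1 ∈ J') (a : ℤ_[p]) :
    f (padicPow J hp hq a) = padicPow J' hp' hq' a := by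
  refine padicPow_unique J' hp' hq' _ _ fun n => ?_
  obtain ⟨m, hm⟩ := exists_nat_approx a n
  refine ⟨m, hm, ?_⟩
  rw [← map_pow, ← map_sub]
  exact pow_le_comap J J' f hf n (padicPow_spec J hp hq a hm)

end PadicPow

/-! ### The group `Γ_L` and its two cocycles -/

section Roots

variable {p : ℕ} [Fact p.Prime] {K : Type*} [Field K]

/-- A compatible system `(1, ζ_p, ζ_{p²}, …)` of primitive `p`-power roots of unity. -/
structure IsRootOfUnitySystem (p : ℕ) (ε : ℕ → K) : Prop where
  zero : ε 0 = 1
  one : ε 1 ≠ 1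
  succ : ∀ n, ε (n + 1) ^ p = ε n

theorem IsRootOfUnitySystem.isPrimitiveRoot {ε : ℕ → K} (h : IsRootOfUnitySystem p ε) (n : ℕ) :
    IsPrimitiveRoot (ε n) (p ^ n) := by
  cases n with
  | zero => simp [h.zero]
  | succ n =>
    have key : ∀ k n, ε (n + k) ^ p ^ k = ε n := by
      intro k
      induction k with
      | zero => simp
      | succ k ih =>
        intro n
        rw [pow_succ', pow_mul, ← add_assoc, h.succ, ih]
    have h1 := key n 1
    have h2 := key (n + 1) 0
    rw [zero_add, h.zero] at h2
    rw [add_comm 1 n] at h1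
    rw [← orderOf_eq_prime_pow (x := ε (n + 1)) (p := p) (n := n) (by rw [h1]; exact h.one) h2]
    exact IsPrimitiveRoot.orderOf _

theorem IsRootOfUnitySystem.pow_eq_of_dvd {ε : ℕ → K} (h : IsRootOfUnitySystem p ε) {n k l : ℕ}
    (hd : (p : ℤ_[p]) ^ n ∣ (l : ℤ_[p]) - k) : ε n ^ l = ε n ^ k := by
  wlog hkl : k ≤ l generalizing k l
  · refine (this ?_ (by omega)).symm
    rw [← neg_sub]
    exact (dvd_neg).mpr hd
  obtain ⟨c, hc⟩ := pow_dvd_of_padic hkl hd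
  obtain ⟨e, rfl⟩ := Nat.exists_eq_add_of_le hkl
  rw [Nat.add_sub_cancel_left] at hc
  rw [pow_add, hc, pow_mul, (h.isPrimitiveRoot n).pow_eq_one, one_pow, mul_one]

theorem IsRootOfUnitySystem.dvd_of_pow_eq {ε : ℕ → K} (h : IsRootOfUnitySystem p ε) {n k l : ℕ}
    (hd : ε n ^ l = ε n ^ k) : (p : ℤ_[p]) ^ n ∣ (l : ℤ_[p]) - k := by
  wlog hkl : k ≤ l generalizing k l
  · rw [← neg_sub]
    exact (dvd_neg).mpr (this hd.symm (by omega))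
  obtain ⟨e, rfl⟩ := Nat.exists_eq_add_of_le hkl
  have h0 : ε n ≠ 0 := (h.isPrimitiveRoot n).ne_zero (pow_ne_zero n (Fact.out : p.Prime).ne_zero)
  rw [pow_add] at hd
  have h1 : ε n ^ e = 1 := by
    have := pow_ne_zero k h0
    exact mul_left_cancel₀ this (by rw [hd, mul_one])
  obtain ⟨c, rfl⟩ := (h.isPrimitiveRoot n).dvd_of_pow_eq_one _ h1
  exact ⟨c, by push_cast; ring⟩

theorem IsRootOfUnitySystem.exists_exponent {ε : ℕ → K} (h : IsRootOfUnitySystem p ε)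
    (r : ℕ → K) (h0 : r 0 = 1) (hs : ∀ n, r (n + 1) ^ p = r n) :
    ∃! a : ℤ_[p], ∀ n m : ℕ, (p : ℤ_[p]) ^ n ∣ a - m → r n = ε n ^ m := by
  have hp : p.Prime := Fact.out
  have h1 : ∀ n, r n ^ p ^ n = 1 := by
    intro n
    induction n with
    | zero => simpa using h0
    | succ n ih => rw [pow_succ', pow_mul, hs, ih]
  have h2 : ∀ n, ∃ k, ε n ^ k = r n := fun n => by
    have : NeZero (p ^ n) := ⟨pow_ne_zero n hp.ne_zero⟩
    obtain ⟨k, -, hk⟩ := (h.isPrimitiveRoot n).eq_pow_of_pow_eq_one (h1 n)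
    exact ⟨k, hk⟩
  choose k hk using h2
  have h3 : ∀ n, (p : ℤ_[p]) ^ n ∣ (k n : ℤ_[p]) - k (n + 1) := fun n => by
    refine h.dvd_of_pow_eq ?_
    rw [hk, ← hs n, ← hk (n + 1), ← pow_mul, mul_comm, pow_mul, h.succ]
  have h4 : ∀ m n, m ≤ n → (p : ℤ_[p]) ^ m ∣ (k m : ℤ_[p]) - k n := by
    intro m n hmn
    induction n, hmn using Nat.le_induction with
    | base => simp
    | succ n hmn ih =>
      have : (k m : ℤ_[p]) - k (n + 1) = (k m - k n) + (k n - k (n + 1)) := by ring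
      rw [this]
      exact dvd_add ih ((pow_dvd_pow _ hmn).trans (h3 n))
  have : IsAdicComplete (Ideal.span {(p : ℤ_[p])}) ℤ_[p] := by
    rw [← PadicInt.maximalIdeal_eq_span_p]
    infer_instance
  have e : ∀ (n : ℕ) (x : ℤ_[p]), (p : ℤ_[p]) ^ n ∣ x ↔ x ∈ Ideal.span {(p : ℤ_[p])} ^ n :=
    fun n x => by rw [Ideal.span_singleton_pow, Ideal.mem_span_singleton]
  obtain ⟨a, ha⟩ := exists_limit (Ideal.span {(p : ℤ_[p])}) (fun n => (k n : ℤ_[p]))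
    fun m n hmn => (e _ _).mp (h4 m n hmn)
  refine ⟨a, fun n m hm => ?_, fun b hb => ?_⟩
  · rw [← hk n]
    refine h.pow_eq_of_dvd ?_
    have h5 := dvd_add ((e _ _).mpr (ha n)) hm
    simpa using h5
  · refine eq_of_forall_sub_mem (Ideal.span {(p : ℤ_[p])}) fun n => ?_
    rw [← e]
    obtain ⟨m, hm⟩ := exists_nat_approx b n
    have h6 := hb n m hm
    rw [← hk n] at h6
    have h7 := dvd_add (dvd_sub hm (h.dvd_of_pow_eq h6)) ((e _ _).mpr (ha n))
    have : b - m - (k n - m) + (k n - a) = b - a := by ring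
    rwa [this] at h7

/-- The `p`-adic integer `a` with `r n = (ε n) ^ a` for all `n`. -/
def IsRootOfUnitySystem.exponent {ε : ℕ → K} (h : IsRootOfUnitySystem p ε)
    (r : ℕ → K) (h0 : r 0 = 1) (hs : ∀ n, r (n + 1) ^ p = r n) : ℤ_[p] :=
  (h.exists_exponent r h0 hs).choose

theorem IsRootOfUnitySystem.exponent_spec {ε : ℕ → K} (h : IsRootOfUnitySystem p ε)
    (r : ℕ → K) (h0 : r 0 = 1) (hs : ∀ n, r (n + 1) ^ p = r n) {n m : ℕ}
    (hm : (p : ℤ_[p]) ^ n ∣ h.exponent r h0 hs - m) : r n = ε n ^ m :=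
  (h.exists_exponent r h0 hs).choose_spec.1 n m hm

theorem IsRootOfUnitySystem.exponent_eq {ε : ℕ → K} (h : IsRootOfUnitySystem p ε)
    (r : ℕ → K) (h0 : r 0 = 1) (hs : ∀ n, r (n + 1) ^ p = r n) (a : ℤ_[p])
    (ha : ∀ n : ℕ, ∃ m : ℕ, (p : ℤ_[p]) ^ n ∣ a - m ∧ r n = ε n ^ m) :
    h.exponent r h0 hs = a := by
  refine ((h.exists_exponent r h0 hs).choose_spec.2 a fun n m hm => ?_).symm
  obtain ⟨l, hl, hr⟩ := ha n
  rw [hr]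
  refine h.pow_eq_of_dvd ?_
  have := dvd_sub hm hl
  simpa using this

end Roots

section Galois

variable (p : ℕ) [Fact p.Prime] (κ : Type u) [Field κ] [CharP κ p] [PerfectRing κ p] (d : ℕ)
variable (OL : Type v) [CommRing OL] [Algebra (OLsq p κ d) OL]

theorem isUnit_xOL (i : Fin d) : IsUnit (xOL p κ d OL i) := by
  have h : (MvPolynomial.X i : MvPolynomial (Fin d) (WittVector p κ)) ∈
      (pIdeal p κ d).primeCompl := by
    intro hX
    obtain ⟨f, hf⟩ := Ideal.mem_span_singleton'.mp hX
    have h1 := congr(MvPolynomial.coeff (Finsupp.single i 1) $hf)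
    rw [MvPolynomial.coeff_X, if_pos rfl, mul_comm, ← map_natCast MvPolynomial.C,
      MvPolynomial.coeff_C_mul] at h1
    exact (WittVector.irreducible (k := κ) p).not_isUnit (IsUnit.of_mul_eq_one _ h1)
  have : IsUnit (algebraMap (MvPolynomial (Fin d) (WittVector p κ)) (OLsqLoc p κ d)
      (MvPolynomial.X i)) := IsLocalization.map_units _ (⟨_, h⟩ : (pIdeal p κ d).primeCompl)
  exact (this.map (algebraMap (OLsqLoc p κ d) (OLsq p κ d))).map (algebraMap (OLsq p κ d) OL)

variable [IsDomain OL]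

/-- The extension `L_∞` of `L = Frac O_L` generated by all `p`-power roots of unity and all
`p`-power roots of the `X_i`. -/
def Linfty : IntermediateField (FractionRing OL) (AlgebraicClosure (FractionRing OL)) :=
  IntermediateField.adjoin (FractionRing OL)
    {z | ∃ n : ℕ, z ^ p ^ n = 1 ∨ ∃ i : Fin d, z ^ p ^ n = algebraMap (FractionRing OL)
      (AlgebraicClosure (FractionRing OL)) (algebraMap OL (FractionRing OL) (xOL p κ d OL i))}

/-- The group `Γ_L = Gal(L_∞/L)`. -/
abbrev GammaL : Type v := Linfty p κ d OL ≃ₐ[FractionRing OL] Linfty p κ d OL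

/-- The choices made in the theory: a compatible system `ε = (1, ζ_p, ζ_{p²}, …)` of primitive
`p`-power roots of unity, and for each `i` a compatible system
`X_i^♭ = (X_i, X_i^{1/p}, X_i^{1/p²}, …)` of `p`-power roots of `X_i`, all in `L_∞`. -/
structure RootData where
  ε : ℕ → Linfty p κ d OL
  isRootSystem : IsRootOfUnitySystem p ε
  xroot : Fin d → ℕ → Linfty p κ d OL
  xroot_zero : ∀ i, xroot i 0 =
    algebraMap (FractionRing OL) (Linfty p κ d OL) (algebraMap OL (FractionRing OL) (xOL p κ d OL i))
  xroot_succ : ∀ i n, xroot i (n + 1) ^ p = xroot i n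

namespace RootData

variable {p κ d OL} (D : RootData p κ d OL)

/-- The `p`-adic cyclotomic character: `γ(ε_n) = ε_n ^ χ(γ)` for all `n`. -/
def chi (γ : GammaL p κ d OL) : ℤ_[p] :=
  D.isRootSystem.exponent (fun n => γ (D.ε n))
    (by simp [D.isRootSystem.zero])
    (fun n => by rw [← map_pow, D.isRootSystem.succ])

theorem xroot_ne_zero (i : Fin d) (n : ℕ) : D.xroot i n ≠ 0 := by
  induction n with
  | zero =>
    rw [D.xroot_zero]
    exact (((isUnit_xOL p κ d OL i).map (algebraMap OL (FractionRing OL))).map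
      (algebraMap (FractionRing OL) (Linfty p κ d OL))).ne_zero
  | succ n ih =>
    intro h
    rw [← D.xroot_succ, h, zero_pow (Fact.out : p.Prime).ne_zero] at ih
    exact ih rfl

/-- The cocycle `c_i : Γ_L → ℤ_p(1)` of `X_i^♭`: `γ(X_i^{1/pⁿ}) = ε_n ^ c_i(γ) * X_i^{1/pⁿ}`
for all `n`. -/
def cocycle (i : Fin d) (γ : GammaL p κ d OL) : ℤ_[p] :=
  D.isRootSystem.exponent (fun n => γ (D.xroot i n) / D.xroot i n)
    (by
      have h := D.xroot_ne_zero i 0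
      have : γ (D.xroot i 0) = D.xroot i 0 := by rw [D.xroot_zero, AlgEquiv.commutes]
      rw [this, div_self h])
    (fun n => by rw [div_pow, ← map_pow, D.xroot_succ])

theorem chi_spec (γ : GammaL p κ d OL) {n m : ℕ} (h : (p : ℤ_[p]) ^ n ∣ D.chi γ - m) :
    γ (D.ε n) = D.ε n ^ m :=
  D.isRootSystem.exponent_spec _ _ _ h

theorem cocycle_spec (i : Fin d) (γ : GammaL p κ d OL) {n m : ℕ}
    (h : (p : ℤ_[p]) ^ n ∣ D.cocycle i γ - m) : γ (D.xroot i n) = D.ε n ^ m * D.xroot i n := by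
  rw [← div_eq_iff (D.xroot_ne_zero i n)]
  exact D.isRootSystem.exponent_spec _ _ _ h

theorem chi_one : D.chi 1 = 1 :=
  D.isRootSystem.exponent_eq _ _ _ _ fun n => ⟨1, by simp, by simp⟩

theorem cocycle_one (i : Fin d) : D.cocycle i 1 = 0 :=
  D.isRootSystem.exponent_eq _ _ _ _ fun n => ⟨0, by simp, by
    simp [D.xroot_ne_zero i n]⟩

theorem chi_mul (γ δ : GammaL p κ d OL) : D.chi (γ * δ) = D.chi γ * D.chi δ := by
  refine D.isRootSystem.exponent_eq _ _ _ _ fun n => ?_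
  obtain ⟨m, hm⟩ := exists_nat_approx (D.chi γ) n
  obtain ⟨l, hl⟩ := exists_nat_approx (D.chi δ) n
  refine ⟨m * l, ?_, ?_⟩
  · have : D.chi γ * D.chi δ - ((m * l : ℕ) : ℤ_[p]) =
        (D.chi γ - m) * D.chi δ + m * (D.chi δ - l) := by push_cast; ring
    rw [this]
    exact dvd_add (hm.mul_right _) (hl.mul_left _)
  · rw [AlgEquiv.mul_apply, D.chi_spec δ hl, map_pow, D.chi_spec γ hm, pow_mul]

theorem cocycle_mul (i : Fin d) (γ δ : GammaL p κ d OL) :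
    D.cocycle i (γ * δ) = D.cocycle i γ + D.chi γ * D.cocycle i δ := by
  refine D.isRootSystem.exponent_eq _ _ _ _ fun n => ?_
  obtain ⟨m, hm⟩ := exists_nat_approx (D.chi γ) n
  obtain ⟨l, hl⟩ := exists_nat_approx (D.cocycle i δ) n
  obtain ⟨k, hk⟩ := exists_nat_approx (D.cocycle i γ) n
  refine ⟨k + m * l, ?_, ?_⟩
  · have : D.cocycle i γ + D.chi γ * D.cocycle i δ - ((k + m * l : ℕ) : ℤ_[p]) =
        (D.cocycle i γ - k) + ((D.chi γ - m) * D.cocycle i δ + m * (D.cocycle i δ - l)) := by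
      push_cast; ring
    rw [this]
    exact dvd_add hk (dvd_add (hm.mul_right _) (hl.mul_left _))
  · rw [div_eq_iff (D.xroot_ne_zero i n), AlgEquiv.mul_apply, D.cocycle_spec i δ hl, map_mul,
      map_pow, D.chi_spec γ hm, D.cocycle_spec i γ hk, pow_add, pow_mul]
    ring

end RootData

end Galois

/-! ### The ring `A_L⁺ = O_L⟦μ⟧` with its Frobenius and its action of `Γ_L` -/

section ALplus

open PowerSeries

/-- The ring `A_L⁺`, identified with `O_L⟦μ⟧` via `[X_i^♭] ↦ X_i`; the variable is
`μ = [ε] - 1 = q - 1`. -/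
abbrev ALplus (OL : Type v) [CommRing OL] : Type v := PowerSeries OL

/-- The ideal `(p, μ)` of `A_L⁺`. -/
def pmuIdeal (p : ℕ) (OL : Type v) [CommRing OL] : Ideal (ALplus OL) := Ideal.span {(p : ALplus OL), X}

theorem p_mem_pmuIdeal (p : ℕ) (OL : Type v) [CommRing OL] : (p : ALplus OL) ∈ pmuIdeal p OL :=
  Ideal.subset_span (by simp)

theorem X_mem_pmuIdeal (p : ℕ) (OL : Type v) [CommRing OL] : (X : ALplus OL) ∈ pmuIdeal p OL :=
  Ideal.subset_span (by simp)


theorem ALplus_isAdicComplete (p : ℕ) [Fact p.Prime] (κ : Type u) [Field κ] [CharP κ p] [PerfectRing κ p]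
    (d : ℕ) (OL : Type v) [CommRing OL] [Algebra (OLsq p κ d) OL] [Algebra.Etale (OLsq p κ d) OL]
    [Module.Finite (OLsq p κ d) OL] : IsAdicComplete (pmuIdeal p OL) (ALplus OL) := by
  have := OL_isAdicComplete p κ d OL
  have h := powerSeries_isAdicComplete (p : OL)
  rwa [idealCX, map_natCast] at h

theorem p_mem_nonunits (p : ℕ) [Fact p.Prime] (κ : Type u) [Field κ] [CharP κ p] [PerfectRing κ p]
    (d : ℕ) (OL : Type v) [CommRing OL] [Algebra (OLsq p κ d) OL] [Algebra.Etale (OLsq p κ d) OL]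
    [Module.Finite (OLsq p κ d) OL] [Nontrivial OL] : (p : OL) ∈ nonunits OL := by
  have := OL_isAdicComplete p κ d OL
  intro h
  have h1 := Ideal.mem_jacobson_bot.mp (IsAdicComplete.le_jacobson_bot (Ideal.span {(p : OL)})
    (Ideal.mem_span_singleton_self _))
  obtain ⟨u, hu⟩ := h
  have h2 := h1 (-(↑u⁻¹ : OL))
  rw [← hu] at h2
  simp at h2

theorem charP_quotient_pmuIdeal (p : ℕ) [Fact p.Prime] (κ : Type u) [Field κ] [CharP κ p] [PerfectRing κ p]
    (d : ℕ) (OL : Type v) [CommRing OL] [Algebra (OLsq p κ d) OL] [Algebra.Etale (OLsq p κ d) OL]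
    [Module.Finite (OLsq p κ d) OL]
    [Nontrivial OL] : CharP (ALplus OL ⧸ pmuIdeal p OL) p := by
  have hne : pmuIdeal p OL ≠ ⊤ := by
    intro h
    have h1 : (1 : ALplus OL) ∈ pmuIdeal p OL := h ▸ trivial
    obtain ⟨a, b, hab⟩ := Ideal.mem_span_pair.mp h1
    have h2 := congr(constantCoeff $hab)
    simp only [map_add, map_mul, map_natCast, map_one, constantCoeff_X, mul_zero, add_zero] at h2
    exact p_mem_nonunits p κ d OL (IsUnit.of_mul_eq_one _ (by rwa [mul_comm] at h2))
  have : Nontrivial (ALplus OL ⧸ pmuIdeal p OL) := Ideal.Quotient.nontrivial_iff.mpr hne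
  have h0 : ((p : ℕ) : ALplus OL ⧸ pmuIdeal p OL) = 0 := by
    rw [← map_natCast (Ideal.Quotient.mk (pmuIdeal p OL)), Ideal.Quotient.eq_zero_iff_mem]
    exact p_mem_pmuIdeal p OL
  exact (CharP.charP_iff_prime_eq_zero Fact.out).mpr h0

theorem q_sub_one_mem (p : ℕ) (OL : Type v) [CommRing OL] : (1 + X : ALplus OL) - 1 ∈ pmuIdeal p OL := by
  simpa using X_mem_pmuIdeal p OL

variable (p : ℕ) [Fact p.Prime] (κ : Type u) [Field κ] [CharP κ p] [PerfectRing κ p] (d : ℕ)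
variable (OL : Type v) [CommRing OL] [Algebra (OLsq p κ d) OL]
  [Algebra.Etale (OLsq p κ d) OL]

theorem ALplus_hom_ext {S : Type*} [CommRing S] (J : Ideal S) [IsHausdorff J S] (hp : (p : S) ∈ J) (g h : ALplus OL →+* S)
    (ha : ∀ w, g (C (ofWitt p κ d OL w)) = h (C (ofWitt p κ d OL w)))
    (hx : ∀ i, g (C (xOL p κ d OL i)) = h (C (xOL p κ d OL i)))
    (hX : g X = h X) (hXJ : g X ∈ J)
    (hβ : ∀ y, Ideal.Quotient.mk J (g (C y)) = Ideal.Quotient.mk J (h (C y))) : g = h := by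
  refine ps_hom_ext J g h hXJ hX fun r => ?_
  have := OL_hom_ext p κ d OL J hp (g.comp C) (h.comp C) ha hx hβ
  exact congr($this r)

variable [Module.Finite (OLsq p κ d) OL]

theorem exists_endo (a : WittVector p κ →+* ALplus OL) (x : Fin d → ALplus OL)
    (s : ALplus OL) (β : OL →+* ALplus OL ⧸ pmuIdeal p OL)
    (ha : ∀ w, Ideal.Quotient.mk (pmuIdeal p OL) (a w) = β (ofWitt p κ d OL w))
    (hx : ∀ i, Ideal.Quotient.mk (pmuIdeal p OL) (x i) = β (xOL p κ d OL i))
    (hs : s ∈ pmuIdeal p OL) :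
    ∃ σ : ALplus OL →+* ALplus OL, (∀ w, σ (C (ofWitt p κ d OL w)) = a w) ∧
      (∀ i, σ (C (xOL p κ d OL i)) = x i) ∧ σ X = s ∧
      ∀ y, Ideal.Quotient.mk (pmuIdeal p OL) (σ (C y)) = β y := by
  have := ALplus_isAdicComplete p κ d OL
  obtain ⟨g, h1, h2, h3⟩ := exists_OL_lift p κ d OL (pmuIdeal p OL) (p_mem_pmuIdeal p OL) a x β ha hx
  refine ⟨psEval _ g s hs, fun w => ?_, fun i => ?_, psEval_X _ _ _ _, fun y => ?_⟩
  · rw [psEval_C, h1]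
  · rw [psEval_C, h2]
  · rw [psEval_C, h3]

/-! #### The Frobenius -/

theorem frobenius_sub_pow_mem (w : WittVector p κ) :
    (p : WittVector p κ) ∣ WittVector.frobenius w - w ^ p := by
  rw [← Ideal.mem_span_singleton, ← WittVector.ker_constantCoeff, RingHom.mem_ker, map_sub, map_pow]
  have : WittVector.constantCoeff (WittVector.frobenius w) = w.coeff 0 ^ p :=
    WittVector.coeff_frobenius_charP p w 0
  rw [this]
  exact sub_self _

/-- The conditions that characterise the Frobenius of `A_L⁺`. -/
structure IsFrobenius (σ : ALplus OL →+* ALplus OL) : Prop where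
  witt : ∀ w, σ (C (ofWitt p κ d OL w)) = C (ofWitt p κ d OL (WittVector.frobenius w))
  x : ∀ i, σ (C (xOL p κ d OL i)) = C (xOL p κ d OL i) ^ p
  mu : σ X = (1 + X) ^ p - 1
  lift : ∀ y : OL, σ (C y) - C y ^ p ∈ pmuIdeal p OL

theorem exists_isFrobenius [Nontrivial OL] : ∃ σ, IsFrobenius p κ d OL σ := by
  have := charP_quotient_pmuIdeal p κ d OL
  obtain ⟨σ, h1, h2, h3, h4⟩ := exists_endo p κ d OL
    ((C (R := OL)).comp ((ofWitt p κ d OL).comp WittVector.frobenius))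
    (fun i => C (xOL p κ d OL i) ^ p) ((1 + X) ^ p - 1)
    ((_root_.frobenius (ALplus OL ⧸ pmuIdeal p OL) p).comp ((Ideal.Quotient.mk (pmuIdeal p OL)).comp C))
    (by
      intro w
      obtain ⟨v, hv⟩ := frobenius_sub_pow_mem p κ w
      have h1 : Ideal.Quotient.mk (pmuIdeal p OL) (C (ofWitt p κ d OL (WittVector.frobenius w))) =
          Ideal.Quotient.mk (pmuIdeal p OL) (C (ofWitt p κ d OL w)) ^ p := by
        rw [← map_pow, Ideal.Quotient.eq, ← map_pow, ← map_sub, ← map_pow, ← map_sub, hv, map_mul,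
          map_mul, map_natCast, map_natCast]
        exact Ideal.mul_mem_right _ _ (p_mem_pmuIdeal p OL)
      exact h1)
    (by intro i; simp [frobenius_def])
    (by
      obtain ⟨c, hc⟩ := sub_dvd_pow_sub_pow (1 + X : ALplus OL) 1 p
      rw [one_pow, add_sub_cancel_left] at hc
      rw [hc]
      exact Ideal.mul_mem_right _ _ (X_mem_pmuIdeal p OL))
  refine ⟨σ, h1, h2, h3, fun y => ?_⟩
  rw [← Ideal.Quotient.eq, h4, map_pow]
  rfl

/-- The Frobenius `φ` of `A_L⁺`: the unique lift of the `p`-power map of `O_L/p` that extends the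
Witt vector Frobenius of `O_F` and satisfies `φ(X_i) = X_i ^ p` and `φ(μ) = (1 + μ) ^ p - 1`. -/
def frobALplus [Nontrivial OL] : ALplus OL →+* ALplus OL :=
  (exists_isFrobenius p κ d OL).choose

theorem frobALplus_spec [Nontrivial OL] : IsFrobenius p κ d OL (frobALplus p κ d OL) :=
  (exists_isFrobenius p κ d OL).choose_spec

/-! #### The action of `Γ_L` -/

/-- The element `q ^ a = (1 + μ) ^ a` of `A_L⁺`, for a `p`-adic integer `a`. -/
def qPow (a : ℤ_[p]) : ALplus OL :=
  have := ALplus_isAdicComplete p κ d OL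
  padicPow (pmuIdeal p OL) (p_mem_pmuIdeal p OL) (q_sub_one_mem p OL) a

theorem qPow_sub_one_mem (a : ℤ_[p]) : qPow p κ d OL a - 1 ∈ pmuIdeal p OL :=
  have := ALplus_isAdicComplete p κ d OL
  padicPow_sub_one_mem _ (p_mem_pmuIdeal p OL) (q_sub_one_mem p OL) a

theorem X_dvd_qPow_sub_one (a : ℤ_[p]) : (X : ALplus OL) ∣ qPow p κ d OL a - 1 := by
  have := ALplus_isAdicComplete p κ d OL
  have := OL_isAdicComplete p κ d OL
  rw [X_dvd_iff]
  refine eq_of_forall_sub_mem (Ideal.span {(p : OL)}) fun n => ?_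
  obtain ⟨m, hm⟩ := exists_nat_approx a n
  have h1 : qPow p κ d OL a - (1 + X) ^ m ∈ pmuIdeal p OL ^ n :=
    padicPow_spec _ (p_mem_pmuIdeal p OL) (q_sub_one_mem p OL) a hm
  have h2 := Ideal.mem_map_of_mem (constantCoeff (R := OL)) h1
  rw [Ideal.map_pow] at h2
  have h3 : (pmuIdeal p OL).map (constantCoeff (R := OL)) ≤ Ideal.span {(p : OL)} := by
    rw [pmuIdeal, Ideal.map_span, Ideal.span_le]
    rintro _ ⟨y, hy | hy, rfl⟩
    · rw [hy, map_natCast]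
      exact Ideal.mem_span_singleton_self _
    · rw [hy]
      simp
  have h4 := Ideal.pow_right_mono h3 n h2
  simpa using h4

variable [IsDomain OL] {p κ d OL}

namespace RootData

variable (D : RootData p κ d OL)

/-- The conditions that characterise the action of `γ ∈ Γ_L` on `A_L⁺`. -/
structure IsAction (γ : GammaL p κ d OL) (σ : ALplus OL →+* ALplus OL) : Prop where
  witt : ∀ w, σ (C (ofWitt p κ d OL w)) = C (ofWitt p κ d OL w)
  x : ∀ i, σ (C (xOL p κ d OL i)) = qPow p κ d OL (D.cocycle i γ) * C (xOL p κ d OL i)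
  mu : σ X = qPow p κ d OL (D.chi γ) - 1
  lift : ∀ y : OL, σ (C y) - C y ∈ pmuIdeal p OL

theorem exists_isAction (γ : GammaL p κ d OL) : ∃ σ, D.IsAction γ σ := by
  obtain ⟨σ, h1, h2, h3, h4⟩ := exists_endo p κ d OL
    ((C (R := OL)).comp (ofWitt p κ d OL))
    (fun i => qPow p κ d OL (D.cocycle i γ) * C (xOL p κ d OL i)) (qPow p κ d OL (D.chi γ) - 1)
    ((Ideal.Quotient.mk (pmuIdeal p OL)).comp C)
    (fun w => rfl)
    (by
      intro i
      rw [RingHom.comp_apply, Ideal.Quotient.eq]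
      have := Ideal.mul_mem_right (C (xOL p κ d OL i)) _
        (qPow_sub_one_mem p κ d OL (D.cocycle i γ))
      rwa [sub_mul, one_mul] at this)
    (qPow_sub_one_mem p κ d OL _)
  refine ⟨σ, h1, h2, h3, fun y => ?_⟩
  rw [← Ideal.Quotient.eq, h4]
  rfl

variable {D}

theorem IsAction.map_le {γ : GammaL p κ d OL} {σ : ALplus OL →+* ALplus OL}
    (h : D.IsAction γ σ) : (pmuIdeal p OL).map σ ≤ pmuIdeal p OL := by
  rw [pmuIdeal, Ideal.map_span, Ideal.span_le]
  rintro _ ⟨y, hy | hy, rfl⟩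
  · rw [hy, map_natCast]
    exact p_mem_pmuIdeal p OL
  · rw [hy, h.mu]
    exact qPow_sub_one_mem p κ d OL _

theorem IsAction.unique {γ : GammaL p κ d OL} {σ τ : ALplus OL →+* ALplus OL}
    (h : D.IsAction γ σ) (h' : D.IsAction γ τ) : σ = τ := by
  have := ALplus_isAdicComplete p κ d OL
  refine ALplus_hom_ext p κ d OL (pmuIdeal p OL) (p_mem_pmuIdeal p OL) σ τ ?_ ?_ ?_ ?_ ?_
  · intro w; rw [h.witt, h'.witt]
  · intro i; rw [h.x, h'.x]
  · rw [h.mu, h'.mu]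
  · rw [h.mu]; exact qPow_sub_one_mem p κ d OL _
  · intro y
    rw [Ideal.Quotient.eq]
    have := sub_mem (h.lift y) (h'.lift y)
    simpa using this

theorem IsAction.map_qPow {γ : GammaL p κ d OL} {σ : ALplus OL →+* ALplus OL}
    (h : D.IsAction γ σ) (a : ℤ_[p]) : σ (qPow p κ d OL a) = qPow p κ d OL (D.chi γ * a) := by
  have := ALplus_isAdicComplete p κ d OL
  have h1 : σ (1 + X) = qPow p κ d OL (D.chi γ) := by rw [map_add, map_one, h.mu]; ring
  have h2 := map_padicPow (pmuIdeal p OL) (p_mem_pmuIdeal p OL) (q_sub_one_mem p OL)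
    (pmuIdeal p OL) (p_mem_pmuIdeal p OL) σ h.map_le (by
      rw [h1]; exact qPow_sub_one_mem p κ d OL _) a
  refine h2.trans ?_
  unfold qPow
  rw [padicPow_mul]
  congr 1

theorem IsAction.one : D.IsAction 1 (RingHom.id _) := by
  have := ALplus_isAdicComplete p κ d OL
  have h0 : qPow p κ d OL 0 = 1 := by
    have := padicPow_natCast (pmuIdeal p OL) (p_mem_pmuIdeal p OL) (q_sub_one_mem p OL) 0
    simpa [qPow] using this
  have h1 : qPow p κ d OL 1 = 1 + X := by
    have := padicPow_natCast (pmuIdeal p OL) (p_mem_pmuIdeal p OL) (q_sub_one_mem p OL) 1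
    simpa [qPow] using this
  refine ⟨fun w => rfl, fun i => ?_, ?_, fun y => ?_⟩
  · rw [D.cocycle_one, h0, one_mul]; rfl
  · rw [D.chi_one, h1]; simp
  · simp

theorem IsAction.comp {γ δ : GammaL p κ d OL} {σ τ : ALplus OL →+* ALplus OL}
    (h : D.IsAction γ σ) (h' : D.IsAction δ τ) : D.IsAction (γ * δ) (σ.comp τ) := by
  have := ALplus_isAdicComplete p κ d OL
  have hadd : ∀ a b, qPow p κ d OL (a + b) = qPow p κ d OL a * qPow p κ d OL b := fun a b =>
    padicPow_add _ (p_mem_pmuIdeal p OL) (q_sub_one_mem p OL) a b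
  refine ⟨fun w => ?_, fun i => ?_, ?_, fun y => ?_⟩
  · rw [RingHom.comp_apply, h'.witt, h.witt]
  · rw [RingHom.comp_apply, h'.x, map_mul, h.map_qPow, h.x, D.cocycle_mul, hadd]
    ring
  · rw [RingHom.comp_apply, h'.mu, map_sub, map_one, h.map_qPow, D.chi_mul]
  · have h1 := h.map_le (Ideal.mem_map_of_mem σ (h'.lift y))
    rw [map_sub] at h1
    have h2 := add_mem h1 (h.lift y)
    simpa using h2

variable (D)

/-- The action of `Γ_L` on `A_L⁺`: the element `γ` acts by the unique ring endomorphism that is the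
identity on `O_F`, sends `X_i` to `(1 + μ) ^ c_i(γ) X_i` and `μ` to `(1 + μ) ^ χ(γ) - 1`, and induces
the identity on `O_L/p`. -/
def galALplus : GammaL p κ d OL →* (ALplus OL →+* ALplus OL) where
  toFun γ := (D.exists_isAction γ).choose
  map_one' := (D.exists_isAction 1).choose_spec.unique IsAction.one
  map_mul' γ δ := (D.exists_isAction (γ * δ)).choose_spec.unique
    ((D.exists_isAction γ).choose_spec.comp (D.exists_isAction δ).choose_spec)

theorem galALplus_spec (γ : GammaL p κ d OL) : D.IsAction γ (D.galALplus γ) :=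
  (D.exists_isAction γ).choose_spec

end RootData

end ALplus

/-! ### The ring `A_L` -/

section AL

open PowerSeries

/-- The ring `A_L`: the `p`-adic completion of `A_L⁺[1/μ]`. -/
abbrev AL (p : ℕ) (OL : Type v) [CommRing OL] : Type v :=
  AdicCompletion (Ideal.span {(p : Localization.Away (X : ALplus OL))})
    (Localization.Away (X : ALplus OL))

instance AL_isAdicComplete (p : ℕ) (OL : Type v) [CommRing OL] :
    IsAdicComplete (Ideal.span {(p : AL p OL)}) (AL p OL) := by
  have := completion_isAdicComplete (p : Localization.Away (X : ALplus OL))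
  rwa [map_natCast] at this

theorem algebraMap_AL_apply (p : ℕ) (OL : Type v) [CommRing OL] (x : ALplus OL) :
    algebraMap (ALplus OL) (AL p OL) x = algebraMap (Localization.Away (X : ALplus OL)) (AL p OL)
      (algebraMap (ALplus OL) (Localization.Away (X : ALplus OL)) x) := rfl

theorem isUnit_X_AL (p : ℕ) (OL : Type v) [CommRing OL] :
    IsUnit (algebraMap (ALplus OL) (AL p OL) X) := by
  rw [algebraMap_AL_apply]
  exact (IsLocalization.Away.algebraMap_isUnit (X : ALplus OL)).map _

theorem AL_hom_ext {S : Type*} [CommRing S] (p : ℕ) (OL : Type v) [CommRing OL]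
    (J : Ideal S) [IsHausdorff J S] (hp : (p : S) ∈ J)
    (f g : AL p OL →+* S)
    (h : ∀ x, f (algebraMap (ALplus OL) (AL p OL) x) = g (algebraMap (ALplus OL) (AL p OL) x)) :
    f = g := by
  have h1 : f.comp (algebraMap (Localization.Away (X : ALplus OL)) (AL p OL)) =
      g.comp (algebraMap (Localization.Away (X : ALplus OL)) (AL p OL)) :=
    IsLocalization.ringHom_ext (Submonoid.powers (X : ALplus OL)) (RingHom.ext h)
  refine completion_hom_ext _ (Submodule.fg_span_singleton _) J f g ?_ fun x => congr($h1 x)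
  intro y hy
  obtain ⟨z, rfl⟩ := Ideal.mem_span_singleton'.mp hy
  rw [map_mul, map_mul, map_natCast, map_natCast]
  exact Ideal.mul_mem_left _ _ hp

theorem exists_extend {R T S : Type*} [CommRing R] [CommRing T] [CommRing S] [Algebra R T] (x : R)
    [IsLocalization.Away x T] (y : T) (J : Ideal S) [IsAdicComplete J S] (g : R →+* S)
    (hg : IsUnit (g x)) (hy : ∀ f : T →+* S, f y ∈ J) :
    ∃ τ : AdicCompletion (Ideal.span {y}) T →+* S,
      ∀ r, τ (algebraMap T (AdicCompletion (Ideal.span {y}) T) (algebraMap R T r)) = g r := by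
  have hI : (Ideal.span {y}).map (IsLocalization.Away.lift (S := T) x hg) ≤ J := by
    rw [Ideal.map_span, Set.image_singleton, Ideal.span_singleton_le_iff_mem]
    exact hy _
  exact ⟨completionLift _ _ _ hI, fun r => by
    rw [completionLift_of, IsLocalization.Away.lift_eq]⟩

theorem exists_extendAL (p : ℕ) (OL : Type v) [CommRing OL] (σ : ALplus OL →+* ALplus OL)
    (h : IsUnit (algebraMap (ALplus OL) (AL p OL) (σ X))) :
    ∃ τ : AL p OL →+* AL p OL, ∀ x,
      τ (algebraMap (ALplus OL) (AL p OL) x) = algebraMap (ALplus OL) (AL p OL) (σ x) :=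
  exists_extend (X : ALplus OL) (p : Localization.Away (X : ALplus OL))
    (Ideal.span {(p : AL p OL)}) ((algebraMap (ALplus OL) (AL p OL)).comp σ) h fun f => by
      rw [map_natCast]
      exact Ideal.mem_span_singleton_self _

/-- The endomorphism of `A_L` induced by an endomorphism `σ` of `A_L⁺` for which `σ(μ)` is
invertible in `A_L`. -/
def extendAL (p : ℕ) (OL : Type v) [CommRing OL] (σ : ALplus OL →+* ALplus OL)
    (h : IsUnit (algebraMap (ALplus OL) (AL p OL) (σ X))) : AL p OL →+* AL p OL :=
  (exists_extendAL p OL σ h).choose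

theorem extendAL_algebraMap (p : ℕ) (OL : Type v) [CommRing OL] (σ : ALplus OL →+* ALplus OL)
    (h : IsUnit (algebraMap (ALplus OL) (AL p OL) (σ X))) (x : ALplus OL) :
    extendAL p OL σ h (algebraMap (ALplus OL) (AL p OL) x) =
      algebraMap (ALplus OL) (AL p OL) (σ x) :=
  (exists_extendAL p OL σ h).choose_spec x

variable (p : ℕ) [Fact p.Prime] (κ : Type u) [Field κ] [CharP κ p] [PerfectRing κ p] (d : ℕ)
variable (OL : Type v) [CommRing OL] [Algebra (OLsq p κ d) OL]
  [Algebra.Etale (OLsq p κ d) OL] [Module.Finite (OLsq p κ d) OL] [IsDomain OL]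

theorem isUnit_frob_X : IsUnit (algebraMap (ALplus OL) (AL p OL) (frobALplus p κ d OL X)) := by
  rw [(frobALplus_spec p κ d OL).mu]
  refine isUnit_of_sub_mem (Ideal.span {(p : AL p OL)}) ((isUnit_X_AL p OL).pow p) ?_
  rw [← map_pow, ← map_sub]
  obtain ⟨r, hr⟩ := exists_add_pow_prime_eq (R := ALplus OL) (Fact.out : p.Prime) 1 X
  have : (1 + X : ALplus OL) ^ p - 1 - X ^ p = (p : ALplus OL) * (1 * X * r) := by rw [hr]; ring
  rw [this, map_mul, map_natCast]
  exact Ideal.mul_mem_right _ _ (Ideal.mem_span_singleton_self _)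

/-- The Frobenius `φ` of `A_L`. -/
def frobAL : AL p OL →+* AL p OL :=
  extendAL p OL (frobALplus p κ d OL) (isUnit_frob_X p κ d OL)

variable {p κ d OL}

namespace RootData

variable (D : RootData p κ d OL)

theorem isUnit_gal_X (γ : GammaL p κ d OL) :
    IsUnit (algebraMap (ALplus OL) (AL p OL) (D.galALplus γ X)) := by
  have h1 : (X : ALplus OL) ∣ D.galALplus γ⁻¹ X := by
    rw [(D.galALplus_spec γ⁻¹).mu]
    exact X_dvd_qPow_sub_one p κ d OL _
  have h2 := map_dvd (D.galALplus γ) h1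
  have h3 : D.galALplus γ (D.galALplus γ⁻¹ X) = X := by
    have : D.galALplus γ * D.galALplus γ⁻¹ = 1 := by rw [← map_mul, mul_inv_cancel, map_one]
    exact congr($this X)
  rw [h3] at h2
  exact isUnit_of_dvd_unit (map_dvd _ h2) (isUnit_X_AL p OL)

/-- The action of `Γ_L` on `A_L`. -/
def galAL : GammaL p κ d OL →* (AL p OL →+* AL p OL) where
  toFun γ := extendAL p OL (D.galALplus γ) (D.isUnit_gal_X γ)
  map_one' := by
    refine AL_hom_ext p OL (Ideal.span {(p : AL p OL)}) (Ideal.mem_span_singleton_self _) _ _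
      fun x => ?_
    rw [extendAL_algebraMap, map_one]
    rfl
  map_mul' γ δ := by
    refine AL_hom_ext p OL (Ideal.span {(p : AL p OL)}) (Ideal.mem_span_singleton_self _) _ _
      fun x => ?_
    rw [extendAL_algebraMap, map_mul, RingHom.mul_def, RingHom.mul_def, RingHom.comp_apply,
      RingHom.comp_apply, extendAL_algebraMap, extendAL_algebraMap]

end RootData

end AL

/-! ### Semilinear algebra and topologies -/

section Semilinear

variable {R : Type*} [CommRing R]

/-- The ring `R`, regarded as an `R`-algebra through the endomorphism `φ`. -/
def FrobTwist (_φ : R →+* R) : Type _ := R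

instance (φ : R →+* R) : CommRing (FrobTwist φ) := inferInstanceAs (CommRing R)

instance (φ : R →+* R) : Algebra R (FrobTwist φ) := RingHom.toAlgebra (S := R) φ

/-- The `φ`-pullback `φ^*(M) = R ⊗_{φ, R} M`. -/
abbrev FrobPullback (φ : R →+* R) (M : Type*) [AddCommGroup M] [Module R M] : Type _ :=
  FrobTwist φ ⊗[R] M

/-- The linearisation `1 ⊗ f : φ^*(M) → M'`, `a ⊗ x ↦ a • f x`, of a `φ`-semilinear map. -/
def linearization {φ : R →+* R} {M M' : Type*} [AddCommGroup M] [Module R M] [AddCommGroup M']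
    [Module R M'] (f : M →ₛₗ[φ] M') : FrobPullback φ M →+ M' :=
  TensorProduct.liftAddHom
    (AddMonoidHom.mk' (fun a : FrobTwist φ => AddMonoidHom.mk' (fun x : M => (show R from a) • f x)
      (fun x y => by rw [map_add, smul_add])) (fun a b => by ext x; exact add_smul (M := M') _ _ _))
    (fun r a x => by
      change (φ r * (show R from a)) • f x = (show R from a) • f (r • x)
      rw [map_smulₛₗ, smul_smul, mul_comm])

theorem linearization_tmul {φ : R →+* R} {M M' : Type*} [AddCommGroup M] [Module R M]
    [AddCommGroup M'] [Module R M'] (f : M →ₛₗ[φ] M') (a : R) (x : M) :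
    linearization f ((show FrobTwist φ from a) ⊗ₜ[R] x) = a • f x := rfl

/-- The submodule `t ^ b N` of `N[1/s]`, for an integer `b` (here `t` divides `s`). -/
def powTwist (t s : R) (b : ℤ) (N : Type*) [AddCommGroup N] [Module R N] :
    Submodule R (LocalizedModule (Submonoid.powers s) N) where
  carrier := {y | ∃ x : N, t ^ (-b).toNat • y =
    t ^ b.toNat • LocalizedModule.mkLinearMap (Submonoid.powers s) N x}
  zero_mem' := ⟨0, by simp⟩
  add_mem' := by
    rintro y y' ⟨x, hx⟩ ⟨x', hx'⟩
    exact ⟨x + x', by rw [smul_add, hx, hx', map_add, smul_add]⟩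
  smul_mem' := by
    rintro c y ⟨x, hx⟩
    exact ⟨c • x, by rw [smul_comm, hx, map_smul, smul_comm]⟩

/-- Continuity of an action `ρ` of a topological group on a module over a topological ring, for the
module topology (the product topology with respect to a basis, if the module is finite free). -/
def IsContinuousAction [TopologicalSpace R] {G M : Type*} [Group G] [TopologicalSpace G]
    [AddCommGroup M] [Module R M] (ρ : G →* AddMonoid.End M) : Prop :=
  letI : TopologicalSpace M := moduleTopology R M
  Continuous fun x : G × M => ρ x.1 x.2

/-- The topology of an additive group with a decreasing sequence of subgroups as a basis of
neighbourhoods of `0`. -/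
abbrev subgroupTopology {G : Type*} [AddCommGroup G] (W : ℕ → AddSubgroup G) (hW : Antitone W) :
    TopologicalSpace G where
  IsOpen U := ∀ x ∈ U, ∃ n, ∀ w ∈ W n, x + w ∈ U
  isOpen_univ := fun _ _ => ⟨0, fun _ _ => trivial⟩
  isOpen_inter := by
    rintro U V hU hV x ⟨hxU, hxV⟩
    obtain ⟨n, hn⟩ := hU x hxU
    obtain ⟨m, hm⟩ := hV x hxV
    exact ⟨max n m, fun w hw => ⟨hn w (hW (le_max_left n m) hw), hm w (hW (le_max_right n m) hw)⟩⟩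
  isOpen_sUnion := by
    rintro T hT x ⟨U, hU, hx⟩
    obtain ⟨n, hn⟩ := hT U hU x hx
    exact ⟨n, fun w hw => ⟨U, hU, hn w hw⟩⟩

end Semilinear

section Topology

open PowerSeries

/-- The `(p, μ)`-adic topology of `A_L⁺`. -/
abbrev ALplusTopology (p : ℕ) (OL : Type v) [CommRing OL] : TopologicalSpace (ALplus OL) :=
  (pmuIdeal p OL).adicTopology

/-- The subgroup `μⁿ A_L⁺ + pⁿ A_L` of `A_L`. -/
def weakNhd (p : ℕ) (OL : Type v) [CommRing OL] (n : ℕ) : AddSubgroup (AL p OL) :=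
  (Submodule.toAddSubgroup (Ideal.span {(X : ALplus OL) ^ n})).map
    (algebraMap (ALplus OL) (AL p OL)).toAddMonoidHom ⊔
  Submodule.toAddSubgroup (Ideal.span {(p : AL p OL) ^ n})

theorem weakNhd_antitone (p : ℕ) (OL : Type v) [CommRing OL] : Antitone (weakNhd p OL) := by
  intro m n hmn
  refine sup_le_sup (AddSubgroup.map_mono ?_) ?_
  · exact (Ideal.span_singleton_le_span_singleton.mpr (pow_dvd_pow (X : ALplus OL) hmn) :)
  · exact (Ideal.span_singleton_le_span_singleton.mpr (pow_dvd_pow (p : AL p OL) hmn) :)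

/-- The weak topology of `A_L`, with the subgroups `μⁿ A_L⁺ + pⁿ A_L` as a basis of neighbourhoods
of `0`. -/
abbrev weakTopology (p : ℕ) (OL : Type v) [CommRing OL] : TopologicalSpace (AL p OL) :=
  subgroupTopology (weakNhd p OL) (weakNhd_antitone p OL)

/-- The ring `B_L⁺ = A_L⁺[1/p]`. -/
abbrev BLplus (p : ℕ) (OL : Type v) [CommRing OL] : Type v := Localization.Away (p : ALplus OL)

/-- The ring `B_L = A_L[1/p]`. -/
abbrev BL (p : ℕ) (OL : Type v) [CommRing OL] : Type v := Localization.Away (p : AL p OL)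

/-- The natural map `B_L⁺ → B_L`. -/
def BLplusToBL (p : ℕ) (OL : Type v) [CommRing OL] : BLplus p OL →+* BL p OL :=
  IsLocalization.Away.lift (p : ALplus OL)
    (g := (algebraMap (AL p OL) (BL p OL)).comp (algebraMap (ALplus OL) (AL p OL))) (by
      rw [map_natCast, ← map_natCast (algebraMap (AL p OL) (BL p OL))]
      exact IsLocalization.Away.algebraMap_isUnit _)

instance (p : ℕ) (OL : Type v) [CommRing OL] : Algebra (BLplus p OL) (BL p OL) :=
  (BLplusToBL p OL).toAlgebra

/-- The element `[p]_q = φ(μ)/μ = 1 + q + ⋯ + q ^ (p - 1)` of `A_L⁺`, where `q = 1 + μ`. -/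
def pq (p : ℕ) (OL : Type v) [CommRing OL] : ALplus OL := ∑ i ∈ Finset.range p, (1 + X) ^ i

theorem pq_mul_X (p : ℕ) [Fact p.Prime] (κ : Type u) [Field κ] [CharP κ p] [PerfectRing κ p]
    (d : ℕ) (OL : Type v) [CommRing OL] [Algebra (OLsq p κ d) OL] [Algebra.Etale (OLsq p κ d) OL]
    [Module.Finite (OLsq p κ d) OL] [Nontrivial OL] : pq p OL * X = frobALplus p κ d OL X := by
  rw [(frobALplus_spec p κ d OL).mu, pq, ← geom_sum_mul, add_sub_cancel_left]

/-- The map `N[1/s] → N'[1/s]` induced by a linear map `N → N'`. -/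
def locMap {OL : Type v} [CommRing OL] (s : ALplus OL) {N N' : Type v} [AddCommGroup N] [Module (ALplus OL) N]
    [AddCommGroup N'] [Module (ALplus OL) N'] (f : N →ₗ[ALplus OL] N') :
    LocalizedModule (Submonoid.powers s) N →ₗ[ALplus OL] LocalizedModule (Submonoid.powers s) N' :=
  IsLocalizedModule.map (Submonoid.powers s) (LocalizedModule.mkLinearMap _ N)
    (LocalizedModule.mkLinearMap _ N') f

theorem locMap_id {OL : Type v} [CommRing OL] (s : ALplus OL) (N : Type v) [AddCommGroup N] [Module (ALplus OL) N] :
    locMap s (LinearMap.id : N →ₗ[ALplus OL] N) = LinearMap.id := by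
  refine IsLocalizedModule.ext (Submonoid.powers s) (LocalizedModule.mkLinearMap _ N)
    (IsLocalizedModule.map_units (LocalizedModule.mkLinearMap _ N)) ?_
  rw [locMap, IsLocalizedModule.map_comp]
  rfl

theorem locMap_comp {OL : Type v} [CommRing OL] (s : ALplus OL) {N N' N'' : Type v} [AddCommGroup N] [Module (ALplus OL) N]
    [AddCommGroup N'] [Module (ALplus OL) N'] [AddCommGroup N''] [Module (ALplus OL) N'']
    (f : N →ₗ[ALplus OL] N') (g : N' →ₗ[ALplus OL] N'') :
    locMap s (g.comp f) = (locMap s g).comp (locMap s f) := by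
  refine IsLocalizedModule.ext (Submonoid.powers s) (LocalizedModule.mkLinearMap _ N)
    (IsLocalizedModule.map_units (LocalizedModule.mkLinearMap _ N'')) ?_
  rw [LinearMap.comp_assoc]
  unfold locMap
  rw [IsLocalizedModule.map_comp, IsLocalizedModule.map_comp, ← LinearMap.comp_assoc,
    ← LinearMap.comp_assoc, IsLocalizedModule.map_comp]

end Topology

/-! ### Wach modules and étale `(φ, Γ_L)`-modules -/

section Modules

open CategoryTheory PowerSeries

variable {p : ℕ} [Fact p.Prime] {κ : Type u} [Field κ] [CharP κ p] [PerfectRing κ p] {d : ℕ}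
  {OL : Type v} [CommRing OL] [IsDomain OL] [Algebra (OLsq p κ d) OL]
  [Algebra.Etale (OLsq p κ d) OL] [Module.Finite (OLsq p κ d) OL]

/-- An `A_L⁺`-module `N` with a semilinear action of `Γ_L` and a Frobenius-semilinear operator
`φ : N[1/μ] → N[1/φ(μ)]` that commutes with the action of `Γ_L`. -/
structure PhiGammaPlus (D : RootData p κ d OL) where
  carrier : Type v
  [addCommGroup : AddCommGroup carrier]
  [module : Module (ALplus OL) carrier]
  gal : GammaL p κ d OL →* AddMonoid.End carrier
  gal_smul : ∀ γ a x, gal γ (a • x) = D.galALplus γ a • gal γ x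
  phi : LocalizedModule (Submonoid.powers (X : ALplus OL)) carrier →ₛₗ[frobALplus p κ d OL]
    LocalizedModule (Submonoid.powers (frobALplus p κ d OL X)) carrier
  /-- `φ(γ x) = γ(φ(x))`: if `φ(x) = y / φ(μ) ^ k`, then `φ(γ x) = γ(y) / γ(φ(μ)) ^ k`, where
  `γ(φ(μ))` is a unit multiple of `φ(μ)`. -/
  phi_gal : ∀ γ x y (k : ℕ),
    frobALplus p κ d OL X ^ k • phi (LocalizedModule.mkLinearMap _ carrier x) =
      LocalizedModule.mkLinearMap _ carrier y →
    D.galALplus γ (frobALplus p κ d OL X) ^ k •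
        phi (LocalizedModule.mkLinearMap _ carrier (gal γ x)) =
      LocalizedModule.mkLinearMap _ carrier (gal γ y)

namespace PhiGammaPlus

variable {D : RootData p κ d OL}

instance : CoeSort (PhiGammaPlus D) (Type v) := ⟨carrier⟩

instance (N : PhiGammaPlus D) : AddCommGroup N := N.addCommGroup

instance (N : PhiGammaPlus D) : Module (ALplus OL) N := N.module

/-- A linear map is `(φ, Γ_L)`-equivariant if it commutes with the action of `Γ_L` and, after
inverting `μ`, with the Frobenius. -/
structure IsEquivariant {N N' : PhiGammaPlus D} (f : N →ₗ[ALplus OL] N') : Prop where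
  gal : ∀ γ x, f (N.gal γ x) = N'.gal γ (f x)
  phi : ∀ y, N'.phi (locMap _ f y) = locMap _ f (N.phi y)

theorem IsEquivariant.id (N : PhiGammaPlus D) :
    IsEquivariant (LinearMap.id : N →ₗ[ALplus OL] N) :=
  ⟨fun _ _ => rfl, fun y => by rw [locMap_id, locMap_id]; rfl⟩

theorem IsEquivariant.comp {N N' N'' : PhiGammaPlus D} {f : N →ₗ[ALplus OL] N'}
    {g : N' →ₗ[ALplus OL] N''} (hf : IsEquivariant f) (hg : IsEquivariant g) :
    IsEquivariant (g.comp f) :=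
  ⟨fun γ x => by rw [LinearMap.comp_apply, hf.gal, hg.gal]; rfl, fun y => by
    rw [locMap_comp, locMap_comp, LinearMap.comp_apply, hg.phi, hf.phi]; rfl⟩

/-- The condition that `φ(μ^b N) ⊆ μ^b N`, that the induced map `1 ⊗ φ : φ^*(μ^b N) → μ^b N` is
injective, and that its cokernel is killed by `[p]_q ^ (b - a)`. -/
def HasWeights (N : PhiGammaPlus D) (a b : ℤ) : Prop :=
  ∃ h : ∀ y ∈ powTwist X X b N, N.phi y ∈ powTwist X (frobALplus p κ d OL X) b N,
    Function.Injective (linearization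
      (LinearMap.codRestrict (powTwist X (frobALplus p κ d OL X) b N)
        (N.phi.domRestrict (powTwist X X b N)) fun y => h y y.2)) ∧
    ∀ z : powTwist X (frobALplus p κ d OL X) b N, pq p OL ^ (b - a).toNat • z ∈
      (linearization (LinearMap.codRestrict (powTwist X (frobALplus p κ d OL X) b N)
        (N.phi.domRestrict (powTwist X X b N)) fun y => h y y.2)).range

/-- The defining properties of Wach modules over `A_L⁺`. -/
structure IsWach (N : PhiGammaPlus D) : Prop where
  free : Module.Free (ALplus OL) N
  finite : Module.Finite (ALplus OL) N
  continuous : letI := ALplusTopology p OL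
    IsContinuousAction (R := ALplus OL) N.gal
  /-- The action of `Γ_L` on `N/μN` is trivial. -/
  trivial_mod_mu : ∀ γ x, ∃ y : N, N.gal γ x - x = (X : ALplus OL) • y
  weights : ∃ a b : ℤ, a ≤ b ∧ N.HasWeights a b

end PhiGammaPlus

open PhiGammaPlus in
/-- Wach modules over `A_L⁺`. -/
structure WachModule (D : RootData p κ d OL) extends PhiGammaPlus D where
  isWach : toPhiGammaPlus.IsWach

namespace WachModule

variable {D : RootData p κ d OL}

/-- Morphisms of Wach modules over `A_L⁺`. -/
@[ext]
structure Hom (N N' : WachModule D) where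
  map : N.toPhiGammaPlus →ₗ[ALplus OL] N'.toPhiGammaPlus
  equivariant : PhiGammaPlus.IsEquivariant map

instance : Category (WachModule D) where
  Hom := Hom
  id N := ⟨LinearMap.id, .id _⟩
  comp f g := ⟨g.map.comp f.map, f.equivariant.comp g.equivariant⟩

end WachModule

/-- Wach modules over `B_L⁺`: finitely generated `B_L⁺`-modules `M` with a semilinear action of
`Γ_L` and a Frobenius `M[1/μ] → M[1/φ(μ)]`, for which there is a stable `A_L⁺`-submodule `N` that is
a Wach module over `A_L⁺` and satisfies `N[1/p] = M`. -/
structure WachModuleB (D : RootData p κ d OL) extends PhiGammaPlus D where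
  [moduleB : Module (BLplus p OL) carrier]
  [isScalarTower : IsScalarTower (ALplus OL) (BLplus p OL) carrier]
  [finite : Module.Finite (BLplus p OL) carrier]
  exists_lattice : ∃ (N : WachModule D) (i : N.toPhiGammaPlus →ₗ[ALplus OL] toPhiGammaPlus),
    PhiGammaPlus.IsEquivariant i ∧ Function.Injective i ∧
      IsLocalizedModule (Submonoid.powers (p : ALplus OL)) i

namespace WachModuleB

variable {D : RootData p κ d OL}

instance (M : WachModuleB D) : Module (BLplus p OL) M.toPhiGammaPlus := M.moduleB

instance (M : WachModuleB D) : IsScalarTower (ALplus OL) (BLplus p OL) M.toPhiGammaPlus :=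
  M.isScalarTower

/-- Morphisms of Wach modules over `B_L⁺`. -/
@[ext]
structure Hom (M M' : WachModuleB D) where
  map : M.toPhiGammaPlus →ₗ[BLplus p OL] M'.toPhiGammaPlus
  equivariant : PhiGammaPlus.IsEquivariant (map.restrictScalars (ALplus OL))

instance : Category (WachModuleB D) where
  Hom := Hom
  id M := ⟨LinearMap.id, .id _⟩
  comp f g := ⟨g.map.comp f.map, f.equivariant.comp g.equivariant⟩

end WachModuleB

/-- An `A_L`-module with a semilinear action of `Γ_L` and a commuting Frobenius-semilinear
endomorphism `φ`. -/
structure PhiGamma (D : RootData p κ d OL) where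
  carrier : Type v
  [addCommGroup : AddCommGroup carrier]
  [module : Module (AL p OL) carrier]
  gal : GammaL p κ d OL →* AddMonoid.End carrier
  gal_smul : ∀ γ a x, gal γ (a • x) = D.galAL γ a • gal γ x
  phi : carrier →ₛₗ[frobAL p κ d OL] carrier
  phi_gal : ∀ γ x, phi (gal γ x) = gal γ (phi x)

namespace PhiGamma

variable {D : RootData p κ d OL}

instance : CoeSort (PhiGamma D) (Type v) := ⟨carrier⟩

instance (E : PhiGamma D) : AddCommGroup E := E.addCommGroup

instance (E : PhiGamma D) : Module (AL p OL) E := E.module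

/-- A linear map is `(φ, Γ_L)`-equivariant if it commutes with `Γ_L` and `φ`. -/
structure IsEquivariant {E E' : PhiGamma D} (f : E →ₗ[AL p OL] E') : Prop where
  gal : ∀ γ x, f (E.gal γ x) = E'.gal γ (f x)
  phi : ∀ x, f (E.phi x) = E'.phi (f x)

theorem IsEquivariant.id (E : PhiGamma D) : IsEquivariant (LinearMap.id : E →ₗ[AL p OL] E) :=
  ⟨fun _ _ => rfl, fun _ => rfl⟩

theorem IsEquivariant.comp {E E' E'' : PhiGamma D} {f : E →ₗ[AL p OL] E'}
    {g : E' →ₗ[AL p OL] E''} (hf : IsEquivariant f) (hg : IsEquivariant g) :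
    IsEquivariant (g.comp f) :=
  ⟨fun γ x => by rw [LinearMap.comp_apply, hf.gal, hg.gal]; rfl, fun x => by
    rw [LinearMap.comp_apply, hf.phi, hg.phi]; rfl⟩

/-- The defining properties of (finite free) étale `(φ, Γ_L)`-modules over `A_L`. -/
structure IsEtale (E : PhiGamma D) : Prop where
  free : Module.Free (AL p OL) E
  finite : Module.Finite (AL p OL) E
  continuous : letI := weakTopology p OL
    IsContinuousAction (R := AL p OL) E.gal
  bijective : Function.Bijective (linearization E.phi)

end PhiGamma

/-- Étale `(φ, Γ_L)`-modules over `A_L`. -/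
structure EtaleModule (D : RootData p κ d OL) extends PhiGamma D where
  isEtale : toPhiGamma.IsEtale

namespace EtaleModule

variable {D : RootData p κ d OL}

/-- Morphisms of étale `(φ, Γ_L)`-modules over `A_L`. -/
@[ext]
structure Hom (E E' : EtaleModule D) where
  map : E.toPhiGamma →ₗ[AL p OL] E'.toPhiGamma
  equivariant : PhiGamma.IsEquivariant map

instance : Category (EtaleModule D) where
  Hom := Hom
  id E := ⟨LinearMap.id, .id _⟩
  comp f g := ⟨g.map.comp f.map, f.equivariant.comp g.equivariant⟩

end EtaleModule

/-- Étale `(φ, Γ_L)`-modules over `B_L`: finite-dimensional `B_L`-vector spaces `V` with a semilinear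
action of `Γ_L` and a commuting Frobenius, for which there is a stable `A_L`-lattice that is an étale
`(φ, Γ_L)`-module over `A_L`. -/
structure EtaleModuleB (D : RootData p κ d OL) extends PhiGamma D where
  [moduleB : Module (BL p OL) carrier]
  [isScalarTower : IsScalarTower (AL p OL) (BL p OL) carrier]
  [finite : Module.Finite (BL p OL) carrier]
  exists_lattice : ∃ (E : EtaleModule D) (i : E.toPhiGamma →ₗ[AL p OL] toPhiGamma),
    PhiGamma.IsEquivariant i ∧ Function.Injective i ∧
      IsLocalizedModule (Submonoid.powers (p : AL p OL)) i

namespace EtaleModuleB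

variable {D : RootData p κ d OL}

instance (V : EtaleModuleB D) : Module (BL p OL) V.toPhiGamma := V.moduleB

instance (V : EtaleModuleB D) : IsScalarTower (AL p OL) (BL p OL) V.toPhiGamma := V.isScalarTower

/-- Morphisms of étale `(φ, Γ_L)`-modules over `B_L`. -/
@[ext]
structure Hom (V V' : EtaleModuleB D) where
  map : V.toPhiGamma →ₗ[BL p OL] V'.toPhiGamma
  equivariant : PhiGamma.IsEquivariant (map.restrictScalars (AL p OL))

instance : Category (EtaleModuleB D) where
  Hom := Hom
  id V := ⟨LinearMap.id, .id _⟩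
  comp f g := ⟨g.map.comp f.map, f.equivariant.comp g.equivariant⟩

end EtaleModuleB

/-! ### Extension of scalars -/

variable {D : RootData p κ d OL}

/-- A map `j : N → E` from a module over `A_L⁺` to a module over `A_L` is compatible with the
actions of `Γ_L` and with the Frobenius: `φ(j x) = φ(μ) ^ (-k) j y` if `φ(x) = y / φ(μ) ^ k`. -/
structure IsCompatible (N : PhiGammaPlus D) (E : PhiGamma D) (j : N → E) : Prop where
  gal : ∀ γ x, j (N.gal γ x) = E.gal γ (j x)
  phi : ∀ x y (k : ℕ),
    frobALplus p κ d OL X ^ k • N.phi (LocalizedModule.mkLinearMap _ N x) =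
      LocalizedModule.mkLinearMap _ N y →
    algebraMap (ALplus OL) (AL p OL) (frobALplus p κ d OL X) ^ k • E.phi (j x) = j y

/-- `F` is the functor `N ↦ A_L ⊗_{A_L⁺} N` of extension of scalars, with the induced action of
`Γ_L` and the induced Frobenius: there are isomorphisms `A_L ⊗_{A_L⁺} N ≅ F(N)`, compatible with the
actions of `Γ_L` and the Frobenius, under which `F(f)` is `id ⊗ f`. -/
def IsExtensionOfScalars (F : WachModule D ⥤ EtaleModule D) : Prop :=
  ∃ e : ∀ N : WachModule D,
      (AL p OL ⊗[ALplus OL] N.toPhiGammaPlus) ≃ₗ[AL p OL] (F.obj N).toPhiGamma,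
    (∀ N : WachModule D, IsCompatible N.toPhiGammaPlus (F.obj N).toPhiGamma
      fun x => e N (1 ⊗ₜ x)) ∧
    ∀ (N N' : WachModule D) (f : N ⟶ N') (a : AL p OL) (x : N.toPhiGammaPlus),
      (F.map f).map (e N (a ⊗ₜ x)) = e N' (a ⊗ₜ f.map x)

/-- `F` is the functor `M ↦ B_L ⊗_{B_L⁺} M` of extension of scalars, with the induced action of
`Γ_L` and the induced Frobenius. -/
def IsExtensionOfScalarsB (F : WachModuleB D ⥤ EtaleModuleB D) : Prop :=
  ∃ e : ∀ M : WachModuleB D,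
      (BL p OL ⊗[BLplus p OL] M.toPhiGammaPlus) ≃ₗ[BL p OL] (F.obj M).toPhiGamma,
    (∀ M : WachModuleB D, IsCompatible M.toPhiGammaPlus (F.obj M).toPhiGamma
      fun x => e M (1 ⊗ₜ x)) ∧
    ∀ (M M' : WachModuleB D) (f : M ⟶ M') (b : BL p OL) (x : M.toPhiGammaPlus),
      (F.map f).map (e M (b ⊗ₜ x)) = e M' (b ⊗ₜ f.map x)

end Modules

end

end Wach

namespace Wach

noncomputable section

/-! ### Principal adic completions -/

section PrincipalCompletion

variable {T : Type*} [CommRing T] (t : T)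

/-! Well-definedness. Since `φ(μ) = [p]_q μ` is congruent to `μ ^ p` modulo `p`, both `φ(μ)` and
`[p]_q` are units of `A_L`. So `φ` extends to `A_L ⊗ N`, and a cokernel killed by a power of `[p]_q`
disappears: the images under `φ` of a basis generate `A_L ⊗ N`, and a surjective endomorphism of a
finite module is bijective. Continuity is checked in coordinates and rests on the continuity of the
action of `Γ_L` on `A_L` for the weak topology. Faithfulness holds because `N` embeds in `A_L ⊗ N`.

Fullness amounts to this: an equivariant map `f : A_L ⊗ N → A_L ⊗ N'` carries `N` into `N'`. The two
operators play different roles.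

Frobenius bounds the denominators. In bases of `μ ^ b N` and `μ ^ b' N'` the matrix `F` of `f`
satisfies `[p]_q ^ k φ(F) = P F Q` with `P`, `Q` over `A_L⁺`, hence `G = μ ^ k F` satisfies `φ(G) =
P G Q`. A vector over `A_L` whose Frobenius is an `A_L⁺`-linear expression in it has entries in
`A_L⁺` (`exists_eq_algebraMap_of_frob`). Indeed, modulo `p`, if `μ ^ m` with `m > 0` is a common
denominator, the equation puts the Frobenius of each numerator into `(p, μ)`. On `A_L⁺/(p, μ) =
O_L/p`, a domain, Frobenius is the injective `p`-power map, so the numerators lie in `(p, μ)` and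
`m` drops. Successive approximation modulo powers of `p` finishes the argument. Thus `μ ^ k f(N) ⊆
N'` for some `k`.

`Γ_L` removes the remaining power of `μ` (`IsWach.exists_pow_smul_of_succ`). It acts trivially on
`N/μN` and `N'/μN'`, whereas `γ(μ) ≡ χ(γ) μ` modulo `μ ^ 2`. So `γ` acts on the image of `μ ^ (k +
1) f` modulo `μ` both trivially and by `χ(γ) ^ (k + 1)`. As `N'/μN'` is torsion-free over `O_L`, one
`γ` with `χ(γ) ^ (k + 1) ≠ 1` forces that image to vanish. Such `γ` exist because `O_L` is a
discrete valuation ring with uniformiser `p`, over which the `p`-power cyclotomic polynomials remain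
Eisenstein after translation.

After inverting `p`, `B_L ⊗ M` is the same module as `A_L ⊗ M`, and a multiple `p ^ k f` maps one
integral lattice into the other, so the integral statement applies. -/

theorem completion_exists_approx (n : ℕ) (x : AdicCompletion (Ideal.span {t}) T) :
    ∃ (r : T) (y : AdicCompletion (Ideal.span {t}) T),
      x = algebraMap T (AdicCompletion (Ideal.span {t}) T) r +
        algebraMap T (AdicCompletion (Ideal.span {t}) T) t ^ n * y := by
  obtain ⟨r, hr⟩ := Ideal.Quotient.mk_surjective (AdicCompletion.evalₐ (Ideal.span {t}) n x)
  have hmem : x - algebraMap T (AdicCompletion (Ideal.span {t}) T) r ∈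
      (Ideal.span {t} ^ n • ⊤ : Submodule T (AdicCompletion (Ideal.span {t}) T)) := by
    rw [AdicCompletion.pow_smul_top_eq_ker_eval (Submodule.fg_span_singleton t), LinearMap.mem_ker]
    have h0 : AdicCompletion.evalₐ (Ideal.span {t}) n
        (x - algebraMap T (AdicCompletion (Ideal.span {t}) T) r) = 0 := by
      rw [map_sub, ← hr, AdicCompletion.algebraMap_apply]
      simp
    have h2 : (Ideal.span {t} ^ n • ⊤ : Ideal T) = Ideal.span {t} ^ n := by simp
    exact (Ideal.quotientEquivAlgOfEq T h2).injective (by rw [map_zero]; exact h0)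
  have hdvd : ∀ z ∈ (Ideal.span {t} ^ n • ⊤ : Submodule T (AdicCompletion (Ideal.span {t}) T)),
      algebraMap T (AdicCompletion (Ideal.span {t}) T) t ^ n ∣ z := by
    intro z hz
    refine Submodule.smul_induction_on hz ?_ fun a b ha hb => dvd_add ha hb
    intro a ha w _
    rw [Ideal.span_singleton_pow, Ideal.mem_span_singleton] at ha
    rw [Algebra.smul_def]
    refine dvd_mul_of_dvd_left ?_ _
    have := map_dvd (algebraMap T (AdicCompletion (Ideal.span {t}) T)) ha
    rwa [map_pow] at this
  obtain ⟨y, hy⟩ := hdvd _ hmem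
  exact ⟨r, y, by rw [← hy]; ring⟩

/-- The completion maps to `T/(t ^ n)`, where `t ^ n` dies and `r` goes to its own class. -/
theorem completion_pow_dvd {n : ℕ} {r : T}
    (h : algebraMap T (AdicCompletion (Ideal.span {t}) T) t ^ n ∣
      algebraMap T (AdicCompletion (Ideal.span {t}) T) r) : t ^ n ∣ r := by
  have h1 := map_dvd (AdicCompletion.evalₐ (Ideal.span {t}) n) h
  rw [← map_pow, AdicCompletion.algebraMap_apply, AdicCompletion.algebraMap_apply] at h1
  have h2 : Ideal.Quotient.mk (Ideal.span {t} ^ n) (t ^ n) ∣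
    Ideal.Quotient.mk (Ideal.span {t} ^ n) r := by simpa using h1
  have h3 : Ideal.Quotient.mk (Ideal.span {t} ^ n) (t ^ n) = 0 := by
    rw [Ideal.Quotient.eq_zero_iff_mem, Ideal.span_singleton_pow]
    exact Ideal.mem_span_singleton_self _
  rw [h3, zero_dvd_iff, Ideal.Quotient.eq_zero_iff_mem, Ideal.span_singleton_pow,
    Ideal.mem_span_singleton] at h2
  exact h2

/-- For `x = r + t ^ n y`, the equation `t x = 0` gives `t ^ (n + 1) ∣ t r`, already in `T`.
Cancelling `t` there shows that `x` is divisible by every `t ^ n`, hence zero by separatedness. -/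
theorem completion_mul_eq_zero (ht : ∀ r, t * r = 0 → r = 0)
    {x : AdicCompletion (Ideal.span {t}) T}
    (h : algebraMap T (AdicCompletion (Ideal.span {t}) T) t * x = 0) : x = 0 := by
  refine eq_of_forall_sub_mem
    (Ideal.span {algebraMap T (AdicCompletion (Ideal.span {t}) T) t}) fun n => ?_
  rw [sub_zero, Ideal.span_singleton_pow, Ideal.mem_span_singleton]
  obtain ⟨r, y, rfl⟩ := completion_exists_approx t n x
  have h1 : t ^ (n + 1) ∣ t * r := by
    refine completion_pow_dvd t ⟨-y, ?_⟩
    rw [map_mul]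
    linear_combination h
  obtain ⟨c, hc⟩ := h1
  have h2 : r = t ^ n * c := by
    rw [← sub_eq_zero]
    refine ht _ ?_
    rw [mul_sub, hc]; ring
  rw [h2, map_mul, map_pow]
  exact dvd_add (dvd_mul_right _ _) (dvd_mul_right _ _)

end PrincipalCompletion

/-! ### The discrete valuation ring `O_L` -/

section Base

variable (p : ℕ) [Fact p.Prime] (κ : Type u) [Field κ] [CharP κ p] [PerfectRing κ p] (d : ℕ)

theorem pIdeal_map_eq_maximalIdeal :
    IsLocalRing.maximalIdeal (OLsqLoc p κ d) = Ideal.span {(p : OLsqLoc p κ d)} := by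
  rw [← Localization.AtPrime.map_eq_maximalIdeal]
  refine (Ideal.map_span _ _).trans ?_
  rw [Set.image_singleton, map_natCast]

theorem OLsqLoc_p_ne_zero : (p : OLsqLoc p κ d) ≠ 0 := by
  have h : (p : MvPolynomial (Fin d) (WittVector p κ)) ≠ 0 := by
    have h : Prime (p : WittVector p κ) := (WittVector.irreducible p).prime
    have := (MvPolynomial.prime_C_iff (Fin d)).mpr h
    simpa using this.ne_zero
  intro h0
  apply h
  apply IsLocalization.injective (OLsqLoc p κ d) (pIdeal p κ d).primeCompl_le_nonZeroDivisors
  rw [map_natCast, map_zero, h0]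

theorem OLsq_p_mul_eq_zero {x : OLsq p κ d} (h : (p : OLsq p κ d) * x = 0) : x = 0 := by
  refine completion_mul_eq_zero (p : OLsqLoc p κ d) (fun r hr => ?_) (by rwa [map_natCast])
  exact (mul_eq_zero.mp hr).resolve_left (OLsqLoc_p_ne_zero p κ d)

/-- Modulo `p` an element of the completion comes from the local ring `OLsqLoc`, whose non-units are
exactly the multiples of `p`. -/
instance OLsq_span_p_isMaximal : (Ideal.span {(p : OLsq p κ d)}).IsMaximal := by
  rw [Ideal.isMaximal_iff]
  constructor
  · intro h
    rw [Ideal.mem_span_singleton] at h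
    have h1 := completion_pow_dvd (p : OLsqLoc p κ d) (n := 1) (r := 1) (by
      rwa [map_natCast, map_one, pow_one])
    rw [pow_one] at h1
    have h2 : (p : OLsqLoc p κ d) ∈ IsLocalRing.maximalIdeal (OLsqLoc p κ d) := by
      rw [pIdeal_map_eq_maximalIdeal]
      exact Ideal.mem_span_singleton_self _
    exact h2 (isUnit_of_dvd_one h1)
  · intro J x hJ hx hxJ
    obtain ⟨r, y, rfl⟩ := completion_exists_approx (p : OLsqLoc p κ d) 1 x
    rw [pow_one, map_natCast] at *
    have hr : IsUnit r := by
      by_contra hr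
      have h1 : r ∈ IsLocalRing.maximalIdeal (OLsqLoc p κ d) := hr
      rw [pIdeal_map_eq_maximalIdeal, Ideal.mem_span_singleton] at h1
      apply hx
      rw [Ideal.mem_span_singleton]
      refine dvd_add ?_ (dvd_mul_right _ _)
      have := map_dvd (algebraMap (OLsqLoc p κ d) (OLsq p κ d)) h1
      rwa [map_natCast] at this
    have h2 : algebraMap (OLsqLoc p κ d) (OLsq p κ d) r ∈ J :=
      (add_mem_cancel_right (Ideal.mul_mem_right _ _ (hJ (Ideal.mem_span_singleton_self _)))).mp hxJ
    rw [← Ideal.eq_top_iff_one]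
    exact J.eq_top_of_isUnit_mem h2 (hr.map _)

variable (OL : Type v) [CommRing OL] [Algebra (OLsq p κ d) OL] [Algebra.Etale (OLsq p κ d) OL]
  [Module.Finite (OLsq p κ d) OL]

include p κ d

set_option linter.unusedSectionVars false

/-- An étale algebra is flat, so the non-zero-divisor `p` of `O_{L^□}` acts injectively on `O_L`. -/
theorem OL_p_mul_eq_zero {x : OL} (h : (p : OL) * x = 0) : x = 0 := by
  have : Module.FinitePresentation (OLsq p κ d) OL :=
    Module.FinitePresentation.of_finite_of_finitePresentation _ _
  have : Module.Flat (OLsq p κ d) OL := inferInstance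
  have h1 : IsSMulRegular OL (p : OLsq p κ d) := by
    refine Module.Flat.isSMulRegular_of_nonZeroDivisors (R := OLsq p κ d) (M := OL) ?_
    rw [mem_nonZeroDivisors_iff_right]
    intro x hx
    exact OLsq_p_mul_eq_zero p κ d (by rwa [mul_comm])
  refine h1 ?_
  change (p : OLsq p κ d) • x = (p : OLsq p κ d) • (0 : OL)
  rw [smul_zero, Algebra.smul_def, map_natCast, h]

/-- In an unramified algebra the maximal ideal `(p)` generates a radical ideal. The reducedness of
`O_L/p` turns nilpotence modulo `p` into divisibility by `p`. -/
theorem span_p_isRadical : (Ideal.span {(p : OL)}).IsRadical := by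
  have := Algebra.FormallyUnramified.isRadical_map_isMaximal (A := OLsq p κ d) OL
    (Ideal.span {(p : OLsq p κ d)})
  rwa [Ideal.map_span, Set.image_singleton, map_natCast] at this

variable [IsDomain OL]

theorem OL_p_ne_zero : (p : OL) ≠ 0 := fun h =>
  one_ne_zero (OL_p_mul_eq_zero p κ d OL (x := 1) (by rw [h, zero_mul]))

/-- Every element of `O_L` is a unit or divisible by `p`. -/
theorem isUnit_or_p_dvd (a : OL) : IsUnit a ∨ (p : OL) ∣ a := by
  have := OL_isAdicComplete p κ d OL
  let I : Ideal OL := Ideal.span {(p : OL)}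
  let m : Ideal (OLsq p κ d) := Ideal.span {(p : OLsq p κ d)}
  let _ : Field (OLsq p κ d ⧸ m) := Ideal.Quotient.field m
  have hI : m.map (algebraMap (OLsq p κ d) OL) = I := by
    rw [Ideal.map_span, Set.image_singleton, map_natCast]
  have h1 : IsArtinianRing (OL ⧸ m.map (algebraMap (OLsq p κ d) OL)) := by
    have : Module.Finite (OLsq p κ d) (OL ⧸ m.map (algebraMap (OLsq p κ d) OL)) :=
      Module.Finite.of_surjective
        ((Ideal.Quotient.mkₐ (OLsq p κ d) (m.map (algebraMap (OLsq p κ d) OL))).toLinearMap)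
        Ideal.Quotient.mk_surjective
    have : Module.Finite (OLsq p κ d ⧸ m) (OL ⧸ m.map (algebraMap (OLsq p κ d) OL)) :=
      Module.Finite.of_restrictScalars_finite (OLsq p κ d) _ _
    exact IsArtinianRing.of_finite (OLsq p κ d ⧸ m) _
  rw [hI] at h1
  -- `O_L/p` is finite over a field, hence Artinian, so the chain of ideals `(a ^ n)` stabilises
  -- there: `a ^ n ≡ a ^ (n + 1) b`.
  obtain ⟨n, b, hb⟩ := IsArtinian.exists_pow_succ_smul_dvd (Ideal.Quotient.mk I a) (1 : OL ⧸ I)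
  obtain ⟨b, rfl⟩ := Ideal.Quotient.mk_surjective b
  have hb1 : ∀ k, Ideal.Quotient.mk I a ^ n = Ideal.Quotient.mk I a ^ (n + k) * Ideal.Quotient.mk I b ^ k := by
    intro k
    induction k with
    | zero => simp
    | succ k ih =>
      simp only [smul_eq_mul, mul_one, Nat.succ_eq_add_one] at hb
      rw [ih, pow_add, ← hb]
      ring
  have hb2 := hb1 n
  have hrad : a ^ n ∈ I → (p : OL) ∣ a := fun h =>
    Ideal.mem_span_singleton.mp (span_p_isRadical p κ d OL ⟨n, h⟩)
  -- From `a ^ n ≡ a ^ (2 n) b ^ n`, the element `(a b) ^ n` is idempotent modulo `p`. Hensel's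
  -- lemma lifts it to an idempotent `e` of the domain `O_L`, which can only be `0` or `1`.
  have he : (a * b) ^ n * (a * b) ^ n - (a * b) ^ n ∈ I := by
    rw [← Ideal.Quotient.eq, map_mul, map_pow, map_mul]
    linear_combination - Ideal.Quotient.mk I b ^ n * hb2
  obtain ⟨e, he1, he2⟩ := HenselianRing.is_henselian (I := I)
    (Polynomial.X ^ 2 - Polynomial.X : Polynomial OL) (by monicity!) ((a * b) ^ n)
    (by simpa [sq] using he) (by
      -- The derivative `2 e - 1` at an idempotent is its own inverse: `(2 e - 1) ^ 2 = 1 + 4 (e ^ 2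
      -- - e)`.
      have h3 : IsUnit (Ideal.Quotient.mk I (2 * (a * b) ^ n - 1)) := by
        refine IsUnit.of_mul_eq_one (Ideal.Quotient.mk I (2 * (a * b) ^ n - 1)) ?_
        rw [← map_mul, ← map_one (Ideal.Quotient.mk I), Ideal.Quotient.eq]
        have := I.mul_mem_left 4 he
        convert this using 1
        ring
      simpa [one_add_one_eq_two] using h3)
  have he3 : e * (e - 1) = 0 := by
    have : e ^ 2 - e = 0 := by simpa using he1
    linear_combination this
  -- If `e = 0`, then `a ^ n ≡ a ^ n (a b) ^ n ≡ 0` and reducedness gives `p ∣ a`. If `e = 1`, then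
  -- `(a b) ^ n` is a unit, which says something about `a` only for `n ≠ 0`; for `n = 0` the
  -- stabilisation itself reads `1 ≡ a b`.
  rcases mul_eq_zero.mp he3 with h0 | h0
  · right
    refine hrad ?_
    rw [h0, zero_sub, neg_mem_iff] at he2
    rw [← Ideal.Quotient.eq_zero_iff_mem, map_pow, map_mul] at he2
    rw [← Ideal.Quotient.eq_zero_iff_mem, map_pow]
    linear_combination hb2 + Ideal.Quotient.mk I a ^ n * he2
  · by_cases hn : n = 0
    · subst hn
      left
      simp at hb
      rw [← map_mul, ← map_one (Ideal.Quotient.mk I), Ideal.Quotient.eq] at hb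
      exact isUnit_of_mul_isUnit_left (isUnit_of_sub_mem I isUnit_one hb)
    left
    rw [sub_eq_zero.mp h0] at he2
    have h4 := isUnit_of_sub_mem I isUnit_one (neg_mem he2 |> fun h => by simpa using h)
    exact isUnit_of_mul_isUnit_left ((isUnit_pow_iff hn).mp h4)

theorem OL_prime_p : Prime (p : OL) := by
  refine ⟨OL_p_ne_zero p κ d OL, p_mem_nonunits p κ d OL, fun a b hab => ?_⟩
  rcases isUnit_or_p_dvd p κ d OL a with h | h
  · exact Or.inr ((h.dvd_mul_left).mp hab)
  · exact Or.inl h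

/-- Separatedness bounds the power of `p` dividing a nonzero element, and the cofactor left after
extracting it is a unit because every non-unit is divisible by `p`. -/
theorem OL_isDiscreteValuationRing : IsDiscreteValuationRing OL := by
  have := OL_isAdicComplete p κ d OL
  refine IsDiscreteValuationRing.ofHasUnitMulPowIrreducibleFactorization
    ⟨p, (OL_prime_p p κ d OL).irreducible, fun {x} hx => ?_⟩
  have h1 : ∃ n, ¬ (p : OL) ^ n ∣ x := by
    by_contra! h
    refine hx (eq_of_forall_sub_mem (Ideal.span {(p : OL)}) fun n => ?_)
    rw [sub_zero, Ideal.span_singleton_pow, Ideal.mem_span_singleton]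
    exact h n
  have h2 : FiniteMultiplicity (p : OL) x := by
    obtain ⟨n, hn⟩ := h1
    exact ⟨n, fun h => hn ((pow_dvd_pow _ n.le_succ).trans h)⟩
  obtain ⟨y, hy, hxy⟩ := h2.exists_eq_pow_mul_and_not_dvd
  exact ⟨_, ((isUnit_or_p_dvd p κ d OL _).resolve_right hxy).unit, hy.symm⟩

end Base

end

end Wach

namespace Wach

noncomputable section

/-! ### The cyclotomic character -/

section Cyclotomic

open Polynomial

variable (p : ℕ) [Fact p.Prime] (κ : Type u) [Field κ] [CharP κ p] [PerfectRing κ p] (d : ℕ)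
variable (OL : Type v) [CommRing OL] [Algebra (OLsq p κ d) OL] [Algebra.Etale (OLsq p κ d) OL]
  [Module.Finite (OLsq p κ d) OL] [IsDomain OL]

include κ d

set_option linter.unusedSectionVars false

/-- After cancelling powers of `p`, a cofactor prime to `p` would, by a Bézout relation over `ℤ`,
make the non-unit `p` invertible. So the `p`-adic valuation of a natural number can be read off in
`O_L`. -/
theorem dvd_of_natCast_pow_dvd {k m : ℕ} (h : (p : OL) ^ k ∣ (m : OL)) : p ^ k ∣ m := by
  induction k with
  | zero => simp
  | succ k ih =>
    obtain ⟨l, rfl⟩ := ih ((pow_dvd_pow _ k.le_succ).trans h)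
    rw [pow_succ] at h ⊢
    rw [Nat.cast_mul, Nat.cast_pow,
      mul_dvd_mul_iff_left (pow_ne_zero k (OL_p_ne_zero p κ d OL))] at h
    refine mul_dvd_mul_left _ ?_
    by_contra hl
    have hc : IsCoprime (p : ℤ) (l : ℤ) :=
      (((Nat.Prime.coprime_iff_not_dvd Fact.out).mpr hl).isCoprime)
    have h1 := hc.map (Int.castRingHom OL)
    simp only [map_natCast] at h1
    exact p_mem_nonunits p κ d OL (h1.isUnit_of_dvd' dvd_rfl h)

/-- The polynomial `Φ(X + 1)` is Eisenstein over `ℤ` at `p`, and it stays so over `O_L` because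
`(p)` is prime there and the constant term `p` is not divisible by `p ^ 2`. Gauss's lemma passes to
the fraction field. -/
theorem cyclotomic_irreducible (n : ℕ) :
    Irreducible (cyclotomic (p ^ (n + 1)) (FractionRing OL)) := by
  have := OL_isDiscreteValuationRing p κ d OL
  have hE := cyclotomic_prime_pow_comp_X_add_one_isEisensteinAt p n
  have hmon : (cyclotomic (p ^ (n + 1)) OL).Monic := cyclotomic.monic _ _
  rw [← map_cyclotomic (p ^ (n + 1)) (algebraMap OL (FractionRing OL)),
    ← hmon.irreducible_iff_irreducible_map_fraction_map]
  -- The translation `X ↦ X + 1` is an automorphism of `O_L[X]`, so it preserves irreducibility.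
  rw [← MulEquiv.irreducible_iff (algEquivAevalXAddC (1 : OL))]
  have h1 : algEquivAevalXAddC (1 : OL) (cyclotomic (p ^ (n + 1)) OL) =
      ((cyclotomic (p ^ (n + 1)) ℤ).comp (X + 1)).map (Int.castRingHom OL) := by
    rw [map_comp, map_cyclotomic, algEquivAevalXAddC_apply]
    simp [aeval_def, comp, eval₂_eq_eval_map]
  rw [h1]
  set f := (cyclotomic (p ^ (n + 1)) ℤ).comp (X + 1) with hf
  have hfm : f.Monic := (cyclotomic.monic _ ℤ).comp (monic_X_add_C 1) (by
    rw [← C_1, natDegree_X_add_C]; exact one_ne_zero)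
  have hdeg : (f.map (Int.castRingHom OL)).natDegree = f.natDegree := hfm.natDegree_map _
  have hprime : (Ideal.span {(p : OL)}).IsPrime :=
    (Ideal.span_singleton_prime (OL_p_ne_zero p κ d OL)).mpr (OL_prime_p p κ d OL)
  refine IsEisensteinAt.irreducible (𝓟 := Ideal.span {(p : OL)}) ?_ hprime
    (hfm.map _).isPrimitive ?_
  · refine (hfm.map _).isEisensteinAt_of_mem_of_notMem hprime.ne_top ?_ ?_
    · intro i hi
      rw [hdeg] at hi
      have := hE.mem hi
      rw [Ideal.submodule_span_eq, Ideal.mem_span_singleton] at this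
      rw [coeff_map, Ideal.mem_span_singleton]
      have := map_dvd (Int.castRingHom OL) this
      rwa [map_natCast] at this
    · rw [coeff_zero_eq_eval_zero, hf, Polynomial.map_comp, eval_comp, map_cyclotomic,
        Ideal.span_singleton_pow, Ideal.mem_span_singleton]
      simp only [Polynomial.map_add, map_X, Polynomial.map_one, eval_add, eval_X, eval_one, zero_add,
        eval_one_cyclotomic_prime_pow]
      intro h
      rw [← Nat.cast_pow] at h
      have h2 := dvd_of_natCast_pow_dvd p κ d OL (k := 2) (m := p) (by simpa using h)
      have hp : 1 < p := (Fact.out : p.Prime).one_lt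
      have := Nat.le_of_dvd (by omega) h2
      nlinarith
  · rw [hdeg, hf, natDegree_comp, natDegree_cyclotomic, ← C_1, natDegree_X_add_C, mul_one]
    exact Nat.totient_pos.mpr (pow_pos (Fact.out : p.Prime).pos _)

/-- The generators are cut out by equations over `L`, so every `L`-embedding into the algebraic
closure permutes them. Normality is what lets a conjugation of roots of unity extend to an element
of `Γ_L`. -/
instance Linfty_normal : Normal (FractionRing OL) (Linfty p κ d OL) := by
  have : Algebra.IsAlgebraic (FractionRing OL) (Linfty p κ d OL) := inferInstance
  rw [IntermediateField.normal_iff_forall_map_le]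
  intro σ
  rw [Linfty, IntermediateField.adjoin_map]
  refine IntermediateField.adjoin.mono _ _ _ ?_
  rintro _ ⟨z, ⟨n, h⟩, rfl⟩
  refine ⟨n, ?_⟩
  rcases h with h | ⟨i, h⟩
  · exact Or.inl (by rw [← map_pow, h, map_one])
  · exact Or.inr ⟨i, by rw [← map_pow, h, AlgHom.commutes]⟩

variable {p κ d OL}

/-- For `m` prime to `p` the power `ε ^ m` is again a primitive root, hence a root of the
irreducible cyclotomic polynomial, which is the minimal polynomial of `ε`. -/
theorem RootData.exists_gal (D : RootData p κ d OL) (n m : ℕ) (hm : m.Coprime p) :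
    ∃ γ : GammaL p κ d OL, γ (D.ε (n + 1)) = D.ε (n + 1) ^ m := by
  have h1 := D.isRootSystem.isPrimitiveRoot (n + 1)
  have h2 := h1.pow_of_coprime m (Nat.Coprime.pow_right _ hm)
  have : NeZero ((p ^ (n + 1) : ℕ) : FractionRing OL) := ⟨by
    rw [← map_natCast (algebraMap OL (FractionRing OL)), Nat.cast_pow]
    intro h
    rw [← map_zero (algebraMap OL (FractionRing OL))] at h
    exact pow_ne_zero _ (OL_p_ne_zero p κ d OL) (IsFractionRing.injective OL (FractionRing OL) h)⟩
  have h3 := h1.minpoly_eq_cyclotomic_of_irreducible (cyclotomic_irreducible p κ d OL n)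
  have : NeZero ((p ^ (n + 1) : ℕ) : Linfty p κ d OL) := NeZero.nat_of_injective
    (algebraMap (FractionRing OL) (Linfty p κ d OL)).injective
  refine minpoly.exists_algEquiv_of_root' (Algebra.IsAlgebraic.isAlgebraic _) ?_
  rw [← h3, aeval_def, eval₂_eq_eval_map, map_cyclotomic]
  exact isRoot_cyclotomic_iff.mpr h2

open PowerSeries in
-- The linear coefficient of `(1 + μ) ^ m` is `m`. The exponent `n - 1` appears because an element
-- of `(p, μ) ^ n` may spend one of its `n` factors on `μ`. This is how `χ(γ)` becomes visible in
-- `O_L`.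
theorem coeff_one_qPow (a : ℤ_[p]) {n m : ℕ} (h : (p : ℤ_[p]) ^ n ∣ a - m) :
    (p : OL) ^ (n - 1) ∣ PowerSeries.coeff 1 (qPow p κ d OL a) - (m : OL) := by
  have := ALplus_isAdicComplete p κ d OL
  have h1 : qPow p κ d OL a - (1 + PowerSeries.X) ^ m ∈ pmuIdeal p OL ^ n :=
    padicPow_spec _ (p_mem_pmuIdeal p OL) (q_sub_one_mem p OL) a h
  have h2 : pmuIdeal p OL = idealCX (p : OL) := by rw [idealCX, map_natCast, pmuIdeal]
  rw [h2] at h1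
  have h3 := coeff_mem_of_mem_pow (p : OL) n _ h1 1
  rw [map_sub] at h3
  have h4 : ((1 + PowerSeries.X : PowerSeries OL) ^ m) = ((1 + Polynomial.X : OL[X]) ^ m : OL[X]) := by
    simp
  rw [h4, Polynomial.coeff_coe, Polynomial.coeff_one_add_X_pow, Nat.choose_one_right] at h3
  exact h3

/-- The cyclotomic character does not have finite image. -/
theorem RootData.exists_chi_pow_ne_one (D : RootData p κ d OL) (k : ℕ) (hk : k ≠ 0) :
    ∃ γ : GammaL p κ d OL, PowerSeries.coeff 1 (qPow p κ d OL (D.chi γ)) ^ k ≠ 1 := by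
  have hp : p.Prime := Fact.out
  -- Take `χ(γ) ≡ 1 + p` to precision growing with `n = (1 + p) ^ k`. If the `k`-th power were `1`,
  -- then `p ^ n` would divide `n - 1`, which is impossible since `0 < n - 1 < p ^ n`.
  obtain ⟨γ, hγ⟩ := D.exists_gal ((1 + p) ^ k) (1 + p) (by simp)
  refine ⟨γ, fun h => ?_⟩
  set n := (1 + p) ^ k with hn
  obtain ⟨m, hm⟩ := exists_nat_approx (D.chi γ) (n + 1)
  have h1 : (p : ℤ_[p]) ^ (n + 1) ∣ D.chi γ - ((1 + p : ℕ) : ℤ_[p]) := by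
    have h2 := D.isRootSystem.dvd_of_pow_eq ((D.chi_spec γ hm).symm.trans hγ)
    have h3 := dvd_add hm h2
    simpa using h3
  have h2 := coeff_one_qPow (OL := OL) (κ := κ) (d := d) (D.chi γ) h1
  rw [Nat.add_sub_cancel] at h2
  have h3 := h2.trans (sub_dvd_pow_sub_pow _ _ k)
  rw [h, ← Nat.cast_pow (1 + p) k, ← hn, ← dvd_neg, neg_sub] at h3
  have h4 : 1 ≤ n := Nat.one_le_iff_ne_zero.mpr (by positivity)
  have h5 : (p : OL) ^ n ∣ ((n - 1 : ℕ) : OL) := by rwa [Nat.cast_sub h4, Nat.cast_one]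
  have h6 := dvd_of_natCast_pow_dvd p κ d OL h5
  have h7 : n - 1 ≠ 0 := by
    have : 1 < (1 + p) ^ k := Nat.one_lt_pow hk (by have := hp.pos; omega)
    omega
  have h8 := Nat.le_of_dvd (by omega) h6
  have h9 : n < p ^ n := Nat.lt_pow_self hp.one_lt
  omega

end Cyclotomic

end

end Wach

namespace Wach

noncomputable section

/-! ### The map `A_L⁺ → A_L` -/

section ALfacts

open PowerSeries

theorem natCast_dvd_iff_coeff {R : Type*} [CommRing R] (m : ℕ) (f : R⟦X⟧) :
    (m : R⟦X⟧) ∣ f ↔ ∀ i, (m : R) ∣ coeff i f := by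
  constructor
  · rintro ⟨g, rfl⟩ i
    rw [← map_natCast (C (R := R)), coeff_C_mul]
    exact dvd_mul_right _ _
  · intro h
    choose g hg using h
    refine ⟨mk g, ?_⟩
    ext i
    rw [← map_natCast (C (R := R)), coeff_C_mul, coeff_mk, hg]

theorem dvd_X_pow_mul {R : Type*} [CommRing R] {m k : ℕ} {f : R⟦X⟧}
    (h : (m : R⟦X⟧) ∣ X ^ k * f) : (m : R⟦X⟧) ∣ f := by
  rw [natCast_dvd_iff_coeff] at h ⊢
  intro i
  simpa [coeff_X_pow_mul] using h (i + k)

theorem mem_pmuIdeal_iff (p : ℕ) (OL : Type v) [CommRing OL] (a : ALplus OL) :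
    a ∈ pmuIdeal p OL ↔ (p : OL) ∣ constantCoeff a := by
  constructor
  · intro h
    obtain ⟨b, c, rfl⟩ := Ideal.mem_span_pair.mp h
    simp
  · rintro ⟨c, hc⟩
    have h1 : (X : ALplus OL) ∣ a - C (constantCoeff a) := by simp [X_dvd_iff]
    obtain ⟨b, hb⟩ := h1
    rw [sub_eq_iff_eq_add] at hb
    rw [hb, hc, map_mul, map_natCast]
    exact add_mem (Ideal.mul_mem_right _ _ (X_mem_pmuIdeal p OL))
      (Ideal.mul_mem_right _ _ (p_mem_pmuIdeal p OL))

theorem exists_of_mem_pmuIdeal {p : ℕ} {OL : Type v} [CommRing OL] {a : ALplus OL}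
    (h : a ∈ pmuIdeal p OL) : ∃ b c : ALplus OL, a = X * b + (p : ALplus OL) * c := by
  obtain ⟨b, c, rfl⟩ := Ideal.mem_span_pair.mp h
  exact ⟨c, b, by ring⟩

/-- The constant term of `[p]_q` is `p`. This is the source of the gain in the descent on
denominators of `exists_sub_mem_p_of_frob`. -/
theorem pq_mem_pmuIdeal (p : ℕ) (OL : Type v) [CommRing OL] : pq p OL ∈ pmuIdeal p OL := by
  rw [mem_pmuIdeal_iff, pq]
  simp

/-- Modulo `p ^ n` the ring `A_L` is a quotient of `A_L⁺[1/μ]`, so a power of `μ` clears the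
denominator. -/
theorem AL_exists_approx (p : ℕ) (OL : Type v) [CommRing OL] (n : ℕ) (x : AL p OL) :
    ∃ (k : ℕ) (a : ALplus OL) (y : AL p OL),
      algebraMap (ALplus OL) (AL p OL) X ^ k * x =
        algebraMap (ALplus OL) (AL p OL) a + (p : AL p OL) ^ n * y := by
  obtain ⟨r, y, rfl⟩ := completion_exists_approx (p : Localization.Away (X : ALplus OL)) n x
  obtain ⟨k, a, h1⟩ := IsLocalization.Away.surj (X : ALplus OL) r
  refine ⟨k, a, algebraMap (ALplus OL) (AL p OL) X ^ k * y, ?_⟩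
  rw [algebraMap_AL_apply p OL a, ← h1, map_mul, map_natCast, map_pow, ← algebraMap_AL_apply]
  ring

variable (p : ℕ) [Fact p.Prime] (κ : Type u) [Field κ] [CharP κ p] [PerfectRing κ p] (d : ℕ)
variable (OL : Type v) [CommRing OL] [Algebra (OLsq p κ d) OL] [Algebra.Etale (OLsq p κ d) OL]
  [Module.Finite (OLsq p κ d) OL] [IsDomain OL]

set_option linter.unusedSectionVars false

/-- Divisibility by `p ^ n` descends from the completion to `A_L⁺[1/μ]`. From there it descends to
`A_L⁺` because it is tested on coefficients, which multiplication by `μ` merely shifts. -/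
theorem algebraMap_AL_pow_dvd {n : ℕ} {a : ALplus OL}
    (h : (p : AL p OL) ^ n ∣ algebraMap (ALplus OL) (AL p OL) a) : (p : ALplus OL) ^ n ∣ a := by
  rw [algebraMap_AL_apply] at h
  obtain ⟨r, hr⟩ := completion_pow_dvd (p : Localization.Away (X : ALplus OL)) (n := n)
    (r := algebraMap (ALplus OL) (Localization.Away (X : ALplus OL)) a) (by rwa [map_natCast])
  obtain ⟨k, b, h1⟩ := IsLocalization.Away.surj (X : ALplus OL) r
  have h2 : X ^ k * a = (p : ALplus OL) ^ n * b := by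
    apply IsLocalization.injective (Localization.Away (X : ALplus OL))
      (powers_le_nonZeroDivisors_of_noZeroDivisors (X_ne_zero (R := OL)))
    rw [map_mul, map_mul, ← h1, hr, map_pow (algebraMap _ _) (p : ALplus OL), map_natCast, map_pow]
    ring
  rw [← Nat.cast_pow]
  refine dvd_X_pow_mul (k := k) ?_
  rw [h2, Nat.cast_pow]
  exact dvd_mul_right _ _

include κ d

theorem algebraMap_AL_injective : Function.Injective (algebraMap (ALplus OL) (AL p OL)) := by
  have := ALplus_isAdicComplete p κ d OL
  rw [injective_iff_map_eq_zero]
  intro a ha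
  refine eq_of_forall_sub_mem (pmuIdeal p OL) fun n => ?_
  rw [sub_zero]
  have h : (p : ALplus OL) ^ n ∣ a := algebraMap_AL_pow_dvd p OL (by rw [ha]; exact dvd_zero _)
  exact Ideal.mem_of_dvd _ h (Ideal.pow_mem_pow (p_mem_pmuIdeal p OL) n)

theorem ALplus_p_ne_zero : (p : ALplus OL) ≠ 0 := by
  intro h
  have := congr(constantCoeff $h)
  rw [map_natCast, map_zero] at this
  exact OL_p_ne_zero p κ d OL this

theorem AL_p_mul_eq_zero {x : AL p OL} (h : (p : AL p OL) * x = 0) : x = 0 := by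
  have hX := powers_le_nonZeroDivisors_of_noZeroDivisors (X_ne_zero (R := OL))
  have : IsDomain (Localization.Away (X : ALplus OL)) := IsLocalization.isDomain_localization hX
  refine completion_mul_eq_zero (p : Localization.Away (X : ALplus OL)) (fun r hr => ?_)
    (by rwa [map_natCast])
  refine (mul_eq_zero.mp hr).resolve_left fun h => ?_
  apply ALplus_p_ne_zero p κ d OL
  apply IsLocalization.injective (Localization.Away (X : ALplus OL)) hX
  rw [map_natCast, map_zero, h]

theorem AL_p_pow_mul_eq_zero {n : ℕ} {x : AL p OL} (h : (p : AL p OL) ^ n * x = 0) : x = 0 := by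
  induction n with
  | zero => simpa using h
  | succ n ih => exact ih (AL_p_mul_eq_zero p κ d OL (by rw [← h]; ring))

/-- `A_L⁺` is `p`-adically closed in `A_L`: by `algebraMap_AL_pow_dvd` the approximations form a
Cauchy sequence in `A_L⁺` itself, and their coefficients converge in the complete ring `O_L`. -/
theorem mem_range_of_approx (x : AL p OL) (h : ∀ n : ℕ, ∃ (a : ALplus OL) (y : AL p OL),
    x = algebraMap (ALplus OL) (AL p OL) a + (p : AL p OL) ^ n * y) :
    ∃ a, x = algebraMap (ALplus OL) (AL p OL) a := by
  have := OL_isAdicComplete p κ d OL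
  choose a y ha using h
  have h1 : ∀ m n, m ≤ n → (p : ALplus OL) ^ m ∣ a m - a n := by
    intro m n hmn
    refine algebraMap_AL_pow_dvd p OL ⟨p ^ (n - m) * y n - y m, ?_⟩
    have h2 : (p : AL p OL) ^ n = p ^ m * p ^ (n - m) := by
      rw [← pow_add, Nat.add_sub_cancel' hmn]
    have h3 := (ha m).symm.trans (ha n)
    rw [h2] at h3
    rw [map_sub]
    linear_combination h3
  have h2 : ∀ i, ∃ L : OL, ∀ n, coeff i (a n) - L ∈ Ideal.span {(p : OL)} ^ n := fun i => by
    refine exists_limit _ (fun n => coeff i (a n)) fun m n hmn => ?_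
    have := h1 m n hmn
    rw [← Nat.cast_pow, natCast_dvd_iff_coeff, Nat.cast_pow] at this
    rw [Ideal.span_singleton_pow, Ideal.mem_span_singleton, ← map_sub]
    exact this i
  choose L hL using h2
  refine ⟨mk L, eq_of_forall_sub_mem (Ideal.span {(p : AL p OL)}) fun n => ?_⟩
  have h3 : (p : ALplus OL) ^ n ∣ a n - mk L := by
    rw [← Nat.cast_pow, natCast_dvd_iff_coeff, Nat.cast_pow]
    intro i
    have := hL i n
    rw [Ideal.span_singleton_pow, Ideal.mem_span_singleton] at this
    simpa using this
  obtain ⟨c, hc⟩ := h3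
  rw [Ideal.span_singleton_pow, Ideal.mem_span_singleton]
  refine ⟨algebraMap (ALplus OL) (AL p OL) c + y n, ?_⟩
  have h4 := congr(algebraMap (ALplus OL) (AL p OL) $hc)
  rw [map_sub, map_mul, map_pow, map_natCast] at h4
  linear_combination ha n + h4

theorem frobAL_algebraMap (a : ALplus OL) :
    frobAL p κ d OL (algebraMap (ALplus OL) (AL p OL) a) =
      algebraMap (ALplus OL) (AL p OL) (frobALplus p κ d OL a) :=
  extendAL_algebraMap _ _ _ _ _

theorem frobALplus_map_le : (pmuIdeal p OL).map (frobALplus p κ d OL) ≤ pmuIdeal p OL := by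
  rw [pmuIdeal, Ideal.map_span, Ideal.span_le]
  rintro _ ⟨y, hy | hy, rfl⟩
  · rw [hy, map_natCast]
    exact p_mem_pmuIdeal p OL
  · rw [hy, ← pq_mul_X]
    exact Ideal.mul_mem_left _ _ (X_mem_pmuIdeal p OL)

/-- Modulo `(p, μ)` Frobenius is the `p`-power map of `O_L/p`, which is injective because `p` is
prime in `O_L`. -/
theorem mem_pmuIdeal_of_frob {a : ALplus OL} (h : frobALplus p κ d OL a ∈ pmuIdeal p OL) :
    a ∈ pmuIdeal p OL := by
  have h1 : a - C (constantCoeff a) ∈ pmuIdeal p OL := by simp [mem_pmuIdeal_iff]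
  have h2 := frobALplus_map_le p κ d OL (Ideal.mem_map_of_mem (frobALplus p κ d OL) h1)
  have h3 := (frobALplus_spec p κ d OL).lift (constantCoeff a)
  rw [map_sub] at h2
  have h4 : C (constantCoeff a) ^ p ∈ pmuIdeal p OL := by
    have := sub_mem (sub_mem h h2) h3
    simpa using this
  rw [mem_pmuIdeal_iff, map_pow, constantCoeff_C] at h4
  rw [mem_pmuIdeal_iff]
  exact (OL_prime_p p κ d OL).dvd_of_dvd_pow h4

variable {p κ d OL}

/-- Let `a ≡ μ ^ m g` modulo `p` with `m > 0`. Then `φ(a) ≡ [p]_q ^ m μ ^ m φ(g) ≡ [p]_q ^ m (c a +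
μ ^ m b)`, which lies in `(p, μ)` together with `[p]_q`. Hence `a ∈ (p, μ)`, so modulo `p` a factor
`μ` can be cancelled. Descending to `m = 0` shows that `g` is integral modulo `p`. -/
theorem exists_sub_mem_p_of_frob {ι : Type*} [Fintype ι] (c : ι → ι → ALplus OL) (b : ι → ALplus OL)
    (g : ι → AL p OL)
    (h : ∀ s, frobAL p κ d OL (g s) = ∑ t, algebraMap (ALplus OL) (AL p OL) (c s t) * g t +
      algebraMap (ALplus OL) (AL p OL) (b s)) :
    ∃ (u : ι → ALplus OL) (y : ι → AL p OL),
      ∀ s, g s = algebraMap (ALplus OL) (AL p OL) (u s) + p * y s := by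
  set j := algebraMap (ALplus OL) (AL p OL) with hj
  have key : ∀ (m : ℕ) (a : ι → ALplus OL) (y : ι → AL p OL),
      (∀ s, j X ^ m * g s = j (a s) + p * y s) →
      ∃ (u : ι → ALplus OL) (y : ι → AL p OL), ∀ s, g s = j (u s) + p * y s := by
    intro m
    induction m with
    | zero => exact fun a y h => ⟨a, y, by simpa using h⟩
    | succ m ih =>
      intro a y hy
      have h1 : ∀ s, a s ∈ pmuIdeal p OL := by
        intro s
        refine mem_pmuIdeal_of_frob p κ d OL ?_
        have e1 := congr(frobAL p κ d OL $(hy s))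
        rw [map_mul, map_pow, map_add, map_mul, map_natCast, hj, frobAL_algebraMap,
          frobAL_algebraMap, ← pq_mul_X, map_mul, ← hj, h] at e1
        have e2 : (p : AL p OL) ^ 1 ∣ j (frobALplus p κ d OL (a s) -
            pq p OL ^ (m + 1) * (∑ t, c s t * a t + X ^ (m + 1) * b s)) := by
          refine ⟨j (pq p OL) ^ (m + 1) * ∑ t, j (c s t) * y t - frobAL p κ d OL (y s), ?_⟩
          have e3 : ∑ t, j (c s t) * (j X ^ (m + 1) * g t) =
              ∑ t, j (c s t) * j (a t) + p * ∑ t, j (c s t) * y t := by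
            rw [Finset.mul_sum, ← Finset.sum_add_distrib]
            refine Finset.sum_congr rfl fun t _ => ?_
            rw [hy]; ring
          have e4 : ∑ t, j (c s t) * (j X ^ (m + 1) * g t) = j X ^ (m + 1) * ∑ t, j (c s t) * g t := by
            rw [Finset.mul_sum]
            exact Finset.sum_congr rfl fun t _ => by ring
          rw [e4] at e3
          simp only [map_sub, map_mul, map_pow, map_add, map_sum]
          linear_combination -e1 + j (pq p OL) ^ (m + 1) * e3
        have e5 := algebraMap_AL_pow_dvd p OL e2
        rw [pow_one] at e5
        have e6 := Ideal.mem_of_dvd _ e5 (p_mem_pmuIdeal p OL)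
        have e7 : pq p OL ^ (m + 1) * (∑ t, c s t * a t + X ^ (m + 1) * b s) ∈ pmuIdeal p OL :=
          Ideal.mul_mem_right _ _ (Ideal.pow_mem_of_mem _ (pq_mem_pmuIdeal p OL) _ (by omega))
        have := add_mem e6 e7
        simpa using this
      choose a' a'' ha using fun s => exists_of_mem_pmuIdeal (h1 s)
      obtain ⟨v, hv⟩ := isUnit_X_AL p OL
      rw [← hj] at hv
      refine ih a' (fun s => (↑v⁻¹ : AL p OL) * (y s + j (a'' s))) fun s => ?_
      have e1 := hy s
      rw [ha, map_add, map_mul, map_mul, map_natCast, ← hv] at e1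
      have e2 : (↑v⁻¹ : AL p OL) * v = 1 := v.inv_mul
      rw [← hv]
      linear_combination (↑v⁻¹ : AL p OL) * e1 + (j (a' s) - v ^ m * g s) * e2
  choose k a y hk using fun s => AL_exists_approx p OL 1 (g s)
  -- The sum of the individual exponents serves as a common denominator.
  refine key (∑ s, k s) (fun s => X ^ (∑ t, k t - k s) * a s)
    (fun s => j X ^ (∑ t, k t - k s) * y s) fun s => ?_
  have h1 : k s ≤ ∑ t, k t := Finset.single_le_sum (fun _ _ => Nat.zero_le _) (Finset.mem_univ s)
  have h2 : j X ^ (∑ t, k t) = j X ^ (∑ t, k t - k s) * j X ^ k s := by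
    rw [← pow_add, Nat.sub_add_cancel h1]
  have h3 := hk s
  rw [← hj] at h3
  rw [h2, mul_assoc, h3, map_mul, map_pow]
  ring

/-- A vector with entries in `A_L` whose Frobenius is an `A_L⁺`-linear expression in it has entries
in `A_L⁺`. -/
theorem exists_eq_algebraMap_of_frob {ι : Type*} [Fintype ι] (c : ι → ι → ALplus OL)
    (b : ι → ALplus OL) (g : ι → AL p OL)
    (h : ∀ s, frobAL p κ d OL (g s) = ∑ t, algebraMap (ALplus OL) (AL p OL) (c s t) * g t +
      algebraMap (ALplus OL) (AL p OL) (b s)) (s : ι) :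
    ∃ a, g s = algebraMap (ALplus OL) (AL p OL) a := by
  -- The induction leaves `b` and `g` free: if `g = u + p y`, then `y` solves the same equation with
  -- `b` replaced by `(c u + b - φ(u)) / p`. This quotient lies in `A_L⁺` by
  -- `algebraMap_AL_pow_dvd`, and `p` may be cancelled since `A_L` has no `p`-torsion.
  have key : ∀ (n : ℕ) (b : ι → ALplus OL) (g : ι → AL p OL),
      (∀ s, frobAL p κ d OL (g s) = ∑ t, algebraMap (ALplus OL) (AL p OL) (c s t) * g t +
        algebraMap (ALplus OL) (AL p OL) (b s)) →
      ∃ (u : ι → ALplus OL) (y : ι → AL p OL),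
        ∀ s, g s = algebraMap (ALplus OL) (AL p OL) (u s) + (p : AL p OL) ^ n * y s := by
    intro n
    induction n with
    | zero => exact fun b g h => ⟨0, g, by simp⟩
    | succ n ih =>
      intro b g h
      obtain ⟨u, y, hu⟩ := exists_sub_mem_p_of_frob c b g h
      set j := algebraMap (ALplus OL) (AL p OL) with hj
      have h1 : ∀ s, ∃ b', ∑ t, c s t * u t + b s - frobALplus p κ d OL (u s) = p * b' := by
        intro s
        have e1 := h s
        simp only [hu, map_add, map_mul, map_natCast, mul_add, Finset.sum_add_distrib] at e1
        rw [hj, frobAL_algebraMap, ← hj] at e1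
        have e2 : (p : AL p OL) ^ 1 ∣ j (∑ t, c s t * u t + b s - frobALplus p κ d OL (u s)) := by
          refine ⟨frobAL p κ d OL (y s) - ∑ t, j (c s t) * y t, ?_⟩
          have e3 : ∑ t, j (c s t) * (p * y t) = p * ∑ t, j (c s t) * y t := by
            rw [Finset.mul_sum]
            exact Finset.sum_congr rfl fun t _ => by ring
          rw [e3] at e1
          simp only [map_sub, map_mul, map_add, map_sum]
          linear_combination -e1
        have e5 := algebraMap_AL_pow_dvd p OL e2
        rwa [pow_one] at e5
      choose b' hb' using h1
      obtain ⟨u', y', hu'⟩ := ih b' y fun s => by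
        have e1 := h s
        simp only [hu, map_add, map_mul, map_natCast, mul_add, Finset.sum_add_distrib] at e1
        rw [hj, frobAL_algebraMap, ← hj] at e1
        have e3 : ∑ t, j (c s t) * (p * y t) = p * ∑ t, j (c s t) * y t := by
          rw [Finset.mul_sum]
          exact Finset.sum_congr rfl fun t _ => by ring
        rw [e3] at e1
        have e4 := congr(j $(hb' s))
        simp only [map_sub, map_mul, map_add, map_sum, map_natCast] at e4
        rw [← sub_eq_zero]
        refine AL_p_mul_eq_zero p κ d OL ?_
        linear_combination e1 + e4
      refine ⟨fun s => u s + p * u' s, y', fun s => ?_⟩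
      rw [hu, hu', map_add, map_mul, map_natCast]
      ring
  refine mem_range_of_approx p κ d OL _ fun n => ?_
  obtain ⟨u, y, hu⟩ := key n b g h
  exact ⟨u s, y s, hu s⟩

end ALfacts

end

end Wach

namespace Wach

noncomputable section

/-! ### Continuity of the actions of `Γ_L` -/

section SubgroupTopology

open Filter Topology

variable {G : Type*} [AddCommGroup G] {W : ℕ → AddSubgroup G} {hW : Antitone W}

theorem subgroupTopology_mem_nhds {x : G} {U : Set G} :
    (U ∈ @nhds G (subgroupTopology W hW) x) ↔ ∃ n, ∀ w ∈ W n, x + w ∈ U := by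
  let _ := subgroupTopology W hW
  constructor
  · intro h
    obtain ⟨V, hVU, hV, hx⟩ := mem_nhds_iff.mp h
    obtain ⟨n, hn⟩ := hV x hx
    exact ⟨n, fun w hw => hVU (hn w hw)⟩
  · rintro ⟨n, hn⟩
    refine mem_nhds_iff.mpr ⟨{y | y - x ∈ W n}, fun y hy => ?_, ?_, ?_⟩
    · have := hn _ hy
      rwa [add_sub_cancel] at this
    · intro y hy
      refine ⟨n, fun w hw => ?_⟩
      change y + w - x ∈ W n
      rw [add_sub_right_comm]
      exact add_mem hy hw
    · change x - x ∈ W n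
      rw [sub_self]
      exact zero_mem _

theorem tendsto_subgroupTopology {α : Type*} {l : Filter α} {f : α → G} {x : G} :
    Tendsto f l (@nhds G (subgroupTopology W hW) x) ↔ ∀ n, ∀ᶠ y in l, f y - x ∈ W n := by
  let _ := subgroupTopology W hW
  constructor
  · intro h n
    refine h.eventually_mem (s := {y | y - x ∈ W n})
      (subgroupTopology_mem_nhds.mpr ⟨n, fun w hw => ?_⟩)
    change x + w - x ∈ W n
    rwa [add_sub_cancel_left]
  · intro h U hU
    obtain ⟨n, hn⟩ := subgroupTopology_mem_nhds.mp hU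
    refine (h n).mono fun y hy => ?_
    have := hn _ hy
    rwa [add_sub_cancel] at this

end SubgroupTopology

/-! ### The weak topology is a ring topology -/

section WeakTopology

open PowerSeries Filter Topology

theorem mem_weakNhd {p : ℕ} {OL : Type v} [CommRing OL] {n : ℕ} {x : AL p OL} :
    x ∈ weakNhd p OL n ↔ ∃ (a : ALplus OL) (y : AL p OL),
      x = algebraMap (ALplus OL) (AL p OL) X ^ n * algebraMap (ALplus OL) (AL p OL) a +
        (p : AL p OL) ^ n * y := by
  rw [weakNhd, AddSubgroup.mem_sup]
  constructor
  · rintro ⟨_, ⟨b, hb, rfl⟩, z, hz, rfl⟩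
    obtain ⟨a, rfl⟩ := Ideal.mem_span_singleton'.mp hb
    obtain ⟨y, rfl⟩ := Ideal.mem_span_singleton'.mp hz
    refine ⟨a, y, ?_⟩
    change algebraMap (ALplus OL) (AL p OL) (a * X ^ n) + _ = _
    rw [map_mul, map_pow]
    ring
  · rintro ⟨a, y, rfl⟩
    refine ⟨_, ⟨X ^ n * a, Ideal.mem_span_singleton.mpr (dvd_mul_right _ _), rfl⟩,
      (p : AL p OL) ^ n * y, Ideal.mem_span_singleton.mpr (dvd_mul_right _ _), ?_⟩
    change algebraMap (ALplus OL) (AL p OL) (X ^ n * a) + _ = _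
    rw [map_mul, map_pow]

theorem mul_mem_weakNhd {p : ℕ} {OL : Type v} [CommRing OL] {n : ℕ} {x y : AL p OL}
    (hx : x ∈ weakNhd p OL n) (hy : y ∈ weakNhd p OL n) : x * y ∈ weakNhd p OL n := by
  obtain ⟨a, x', rfl⟩ := mem_weakNhd.mp hx
  obtain ⟨b, y', rfl⟩ := mem_weakNhd.mp hy
  set j := algebraMap (ALplus OL) (AL p OL)
  refine mem_weakNhd.mpr ⟨X ^ n * a * b, x' * (j X ^ n * j b + (p : AL p OL) ^ n * y') +
    j X ^ n * j a * y', ?_⟩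
  rw [map_mul, map_mul, map_pow]
  ring

/-- Modulo `p ^ n` a fixed `x` has a bounded denominator `μ ^ k`, so the index `n + k` compensates
for it. -/
theorem exists_mul_mem_weakNhd {p : ℕ} {OL : Type v} [CommRing OL] (x : AL p OL) (n : ℕ) :
    ∃ m, ∀ w ∈ weakNhd p OL m, x * w ∈ weakNhd p OL n := by
  obtain ⟨k, a, y, h⟩ := AL_exists_approx p OL n x
  refine ⟨n + k, fun w hw => ?_⟩
  obtain ⟨b, z, rfl⟩ := mem_weakNhd.mp hw
  set j := algebraMap (ALplus OL) (AL p OL)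
  refine mem_weakNhd.mpr ⟨a * b, j X ^ n * j b * y + x * p ^ k * z, ?_⟩
  rw [map_mul, pow_add, pow_add]
  linear_combination j X ^ n * j b * h

theorem weakTopology_isTopologicalRing (p : ℕ) (OL : Type v) [CommRing OL] :
    letI := weakTopology p OL
    IsTopologicalRing (AL p OL) := by
  let _ := weakTopology p OL
  have ht : ∀ (x : AL p OL) n, ∀ᶠ y in 𝓝 x, y - x ∈ weakNhd p OL n := fun x =>
    tendsto_subgroupTopology.mp (tendsto_id (x := 𝓝 x))
  have hadd : ContinuousAdd (AL p OL) := ⟨continuous_iff_continuousAt.mpr fun ⟨x, y⟩ => by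
    refine tendsto_subgroupTopology.mpr fun n => ?_
    filter_upwards [prod_mem_nhds (ht x n) (ht y n)] with ⟨a, b⟩ ⟨ha, hb⟩
    have h1 : a - x + (b - y) ∈ weakNhd p OL n := add_mem ha hb
    rwa [sub_add_sub_comm] at h1⟩
  have hmul : ContinuousMul (AL p OL) := ⟨continuous_iff_continuousAt.mpr fun ⟨x, y⟩ => by
    refine tendsto_subgroupTopology.mpr fun n => ?_
    obtain ⟨m, hm⟩ := exists_mul_mem_weakNhd x n
    obtain ⟨l, hl⟩ := exists_mul_mem_weakNhd y n
    filter_upwards [prod_mem_nhds (inter_mem (ht x n) (ht x l)) (inter_mem (ht y n) (ht y m))]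
      with ⟨a, b⟩ ⟨⟨ha, ha'⟩, hb, hb'⟩
    have h1 := mul_mem_weakNhd ha hb
    have h2 := hl _ ha'
    have h3 := hm _ hb'
    have h4 := add_mem (add_mem h1 h2) h3
    convert h4 using 1
    ring⟩
  have hneg : ContinuousNeg (AL p OL) := ⟨continuous_iff_continuousAt.mpr fun x => by
    refine tendsto_subgroupTopology.mpr fun n => ?_
    filter_upwards [ht x n] with a ha
    have := neg_mem ha
    convert this using 1
    ring⟩
  exact { }

/-- A product of `m + n` factors from `{p, μ}` contains `p` at least `m` times or `μ` at least `n`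
times. This compares the `(p, μ)`-adic topology with the weak one. -/
theorem pmuIdeal_pow_add_le (p : ℕ) (OL : Type v) [CommRing OL] (m n : ℕ) :
    pmuIdeal p OL ^ (m + n) ≤ Ideal.span {(p : ALplus OL) ^ m} ⊔ Ideal.span {(X : ALplus OL) ^ n} := by
  rw [pmuIdeal, Ideal.span_insert, ← Ideal.span_singleton_pow, ← Ideal.span_singleton_pow]
  exact Ideal.sup_pow_add_le_pow_sup_pow

theorem exists_of_mem_pmuIdeal_pow {p : ℕ} {OL : Type v} [CommRing OL] {m n : ℕ} {a : ALplus OL}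
    (h : a ∈ pmuIdeal p OL ^ (m + n)) :
    ∃ b c : ALplus OL, a = (p : ALplus OL) ^ m * b + X ^ n * c := by
  obtain ⟨y, hy, z, hz, rfl⟩ := Submodule.mem_sup.mp (pmuIdeal_pow_add_le p OL m n h)
  obtain ⟨b, rfl⟩ := Ideal.mem_span_singleton.mp hy
  obtain ⟨c, rfl⟩ := Ideal.mem_span_singleton.mp hz
  exact ⟨b, c, rfl⟩

theorem continuous_algebraMap_AL (p : ℕ) (OL : Type v) [CommRing OL] :
    letI := ALplusTopology p OL
    letI := weakTopology p OL
    Continuous (algebraMap (ALplus OL) (AL p OL)) := by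
  let _ := ALplusTopology p OL
  let _ := weakTopology p OL
  refine continuous_iff_continuousAt.mpr fun x => tendsto_subgroupTopology.mpr fun n => ?_
  refine (Ideal.hasBasis_nhds_adic (pmuIdeal p OL) x).eventually_iff.mpr ⟨n + n, trivial, ?_⟩
  rintro _ ⟨a, ha, rfl⟩
  obtain ⟨b, c, rfl⟩ := exists_of_mem_pmuIdeal_pow ha
  rw [mem_weakNhd]
  refine ⟨c, algebraMap (ALplus OL) (AL p OL) b, ?_⟩
  simp only [map_add, map_mul, map_pow, map_natCast]
  ring

end WeakTopology

/-! ### Continuity of the action on `A_L`, and its commutation with Frobenius -/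

section Galois

open PowerSeries Filter Topology

variable {p : ℕ} [Fact p.Prime] {κ : Type u} [Field κ] [CharP κ p] [PerfectRing κ p] {d : ℕ}
variable {OL : Type v} [CommRing OL] [Algebra (OLsq p κ d) OL] [Algebra.Etale (OLsq p κ d) OL]
  [Module.Finite (OLsq p κ d) OL] [IsDomain OL]

set_option linter.unusedSectionVars false

/-- The element `z` generates a finite extension of `L`, whose fixing subgroup is open in the Krull
topology. -/
theorem eventually_gal_eq (z : Linfty p κ d OL) (γ₀ : GammaL p κ d OL) :
    ∀ᶠ γ in 𝓝 γ₀, γ z = γ₀ z := by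
  have hz : IsIntegral (FractionRing OL) z := Algebra.IsIntegral.isIntegral z
  have := IntermediateField.adjoin.finiteDimensional hz
  have h1 := IntermediateField.fixingSubgroup_isOpen
    (IntermediateField.adjoin (FractionRing OL) {z})
  have h2 : Continuous fun γ : GammaL p κ d OL => γ₀⁻¹ * γ := continuous_const_mul _
  filter_upwards [(h1.preimage h2).mem_nhds (x := γ₀) (by simp [one_mem])] with γ hγ
  have h3 := (IntermediateField.mem_fixingSubgroup_iff _ _).mp hγ z
    (IntermediateField.mem_adjoin_simple_self _ z)
  have h4 := congr(γ₀ $h3)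
  rwa [← AlgEquiv.mul_apply, mul_inv_cancel_left] at h4

variable (D : RootData p κ d OL)

namespace RootData

/-- Modulo `p ^ n` the character depends only on `γ(ε_n)`, a locally constant function of `γ`. -/
theorem eventually_chi (γ₀ : GammaL p κ d OL) (n : ℕ) :
    ∀ᶠ γ in 𝓝 γ₀, (p : ℤ_[p]) ^ n ∣ D.chi γ - D.chi γ₀ := by
  filter_upwards [eventually_gal_eq (D.ε n) γ₀] with γ hγ
  obtain ⟨m, hm⟩ := exists_nat_approx (D.chi γ) n
  obtain ⟨l, hl⟩ := exists_nat_approx (D.chi γ₀) n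
  have h1 := D.isRootSystem.dvd_of_pow_eq ((D.chi_spec γ hm).symm.trans (hγ.trans (D.chi_spec γ₀ hl)))
  have h2 := dvd_sub (dvd_add hm h1) hl
  convert h2 using 1
  ring

theorem eventually_cocycle (i : Fin d) (γ₀ : GammaL p κ d OL) (n : ℕ) :
    ∀ᶠ γ in 𝓝 γ₀, (p : ℤ_[p]) ^ n ∣ D.cocycle i γ - D.cocycle i γ₀ := by
  filter_upwards [eventually_gal_eq (D.xroot i n) γ₀] with γ hγ
  obtain ⟨m, hm⟩ := exists_nat_approx (D.cocycle i γ) n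
  obtain ⟨l, hl⟩ := exists_nat_approx (D.cocycle i γ₀) n
  have h0 := (D.cocycle_spec i γ hm).symm.trans (hγ.trans (D.cocycle_spec i γ₀ hl))
  have h1 := D.isRootSystem.dvd_of_pow_eq (mul_right_cancel₀ (D.xroot_ne_zero i n) h0)
  have h2 := dvd_sub (dvd_add hm h1) hl
  convert h2 using 1
  ring

theorem qPow_sub_mem {a b : ℤ_[p]} {n : ℕ} (h : (p : ℤ_[p]) ^ n ∣ a - b) :
    qPow p κ d OL a - qPow p κ d OL b ∈ pmuIdeal p OL ^ n := by
  have := ALplus_isAdicComplete p κ d OL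
  obtain ⟨m, hm⟩ := exists_nat_approx b n
  have h1 : qPow p κ d OL a - (1 + X) ^ m ∈ pmuIdeal p OL ^ n :=
    padicPow_spec _ (p_mem_pmuIdeal p OL) (q_sub_one_mem p OL) a (by
      have := dvd_add h hm
      simpa using this)
  have h2 : qPow p κ d OL b - (1 + X) ^ m ∈ pmuIdeal p OL ^ n :=
    padicPow_spec _ (p_mem_pmuIdeal p OL) (q_sub_one_mem p OL) b hm
  have := sub_mem h1 h2
  simpa using this

/-- Modulo `(p, μ) ^ n` the two actions agree on `O_F`, on the `X_i` and on `μ`, and both induce the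
identity on `O_L` modulo `(p, μ)`. That ideal is nilpotent in the quotient, which is therefore
separated, and the uniqueness statement `ALplus_hom_ext` applies. The bound is uniform in `a`. -/
theorem galALplus_sub_mem {γ γ₀ : GammaL p κ d OL} {n : ℕ}
    (hχ : (p : ℤ_[p]) ^ n ∣ D.chi γ - D.chi γ₀)
    (hc : ∀ i, (p : ℤ_[p]) ^ n ∣ D.cocycle i γ - D.cocycle i γ₀) (a : ALplus OL) :
    D.galALplus γ a - D.galALplus γ₀ a ∈ pmuIdeal p OL ^ n := by
  have h := D.galALplus_spec γ
  have h₀ := D.galALplus_spec γ₀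
  let π : ALplus OL →+* ALplus OL ⧸ pmuIdeal p OL ^ n := Ideal.Quotient.mk _
  let J : Ideal (ALplus OL ⧸ pmuIdeal p OL ^ n) := (pmuIdeal p OL).map π
  have hJ : J ^ n = ⊥ := by
    rw [← Ideal.map_pow]
    exact Ideal.map_quotient_self _
  have : IsHausdorff J (ALplus OL ⧸ pmuIdeal p OL ^ n) := ⟨fun x hx => by
    have := hx n
    rwa [hJ, Submodule.bot_smul, SModEq.bot] at this⟩
  have hπ : ∀ {x}, x ∈ pmuIdeal p OL → π x ∈ J := fun hx => Ideal.mem_map_of_mem π hx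
  have key : π.comp (D.galALplus γ) = π.comp (D.galALplus γ₀) := by
    refine ALplus_hom_ext p κ d OL J ?_ _ _ ?_ ?_ ?_ ?_ ?_
    · have := hπ (p_mem_pmuIdeal p OL)
      rwa [map_natCast] at this
    · intro w
      rw [RingHom.comp_apply, RingHom.comp_apply, h.witt, h₀.witt]
    · intro i
      rw [RingHom.comp_apply, RingHom.comp_apply, h.x, h₀.x, Ideal.Quotient.eq, ← sub_mul]
      exact Ideal.mul_mem_right _ _ (qPow_sub_mem (hc i))
    · rw [RingHom.comp_apply, RingHom.comp_apply, h.mu, h₀.mu, Ideal.Quotient.eq,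
        sub_sub_sub_cancel_right]
      exact qPow_sub_mem hχ
    · rw [RingHom.comp_apply, h.mu]
      exact hπ (qPow_sub_one_mem p κ d OL _)
    · intro y
      rw [Ideal.Quotient.eq, RingHom.comp_apply, RingHom.comp_apply, ← map_sub]
      refine hπ ?_
      have := sub_mem (h.lift y) (h₀.lift y)
      simpa using this
  exact Ideal.Quotient.eq.mp congr($key a)

theorem eventually_galALplus_sub_mem (γ₀ : GammaL p κ d OL) (n : ℕ) :
    ∀ᶠ γ in 𝓝 γ₀, ∀ a, D.galALplus γ a - D.galALplus γ₀ a ∈ pmuIdeal p OL ^ n := by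
  filter_upwards [D.eventually_chi γ₀ n,
    Filter.eventually_all.mpr fun i => D.eventually_cocycle i γ₀ n] with γ hχ hc a
  exact D.galALplus_sub_mem hχ hc a

theorem galAL_algebraMap (γ : GammaL p κ d OL) (a : ALplus OL) :
    D.galAL γ (algebraMap (ALplus OL) (AL p OL) a) =
      algebraMap (ALplus OL) (AL p OL) (D.galALplus γ a) :=
  extendAL_algebraMap p OL (D.galALplus γ) (D.isUnit_gal_X γ) a

theorem X_dvd_gal_X (γ : GammaL p κ d OL) : (X : ALplus OL) ∣ D.galALplus γ X := by
  rw [(D.galALplus_spec γ).mu]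
  exact X_dvd_qPow_sub_one p κ d OL _

/-- Apply `γ` to the divisibility of `γ⁻¹(μ)` by `μ`. With `X_dvd_gal_X` it shows that `γ(μ)` is a
unit multiple of `μ`. -/
theorem gal_X_dvd_X (γ : GammaL p κ d OL) : D.galALplus γ X ∣ X := by
  have h2 := map_dvd (D.galALplus γ) (D.X_dvd_gal_X γ⁻¹)
  have h3 : D.galALplus γ (D.galALplus γ⁻¹ X) = X := by
    have : D.galALplus γ * D.galALplus γ⁻¹ = 1 := by rw [← map_mul, mul_inv_cancel, map_one]
    exact congr($this X)
  rwa [h3] at h2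

theorem galAL_mem_weakNhd (γ : GammaL p κ d OL) {n : ℕ} {x : AL p OL} (hx : x ∈ weakNhd p OL n) :
    D.galAL γ x ∈ weakNhd p OL n := by
  obtain ⟨a, y, rfl⟩ := mem_weakNhd.mp hx
  obtain ⟨e, he⟩ := D.X_dvd_gal_X γ
  refine mem_weakNhd.mpr ⟨e ^ n * D.galALplus γ a, D.galAL γ y, ?_⟩
  simp only [map_add, map_mul, map_pow, galAL_algebraMap, he, map_natCast]
  ring

theorem eventually_galAL_sub_mem (γ₀ : GammaL p κ d OL) (x : AL p OL) (n : ℕ) :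
    ∀ᶠ γ in 𝓝 γ₀, D.galAL γ x - D.galAL γ₀ x ∈ weakNhd p OL n := by
  obtain ⟨k, a, y, h⟩ := AL_exists_approx p OL n x
  -- Up to `p ^ n`, the difference `γ(x) - γ₀(x)` is a cross difference of numerators over `(γ(μ)
  -- γ₀(μ)) ^ k`. In the precision `n + (n + 2 k)` the first `n` provides `p ^ n`, and `n + 2 k`
  -- provides `μ ^ (n + 2 k)`, of which `μ ^ (2 k)` is lost to the two denominators.
  filter_upwards [D.eventually_galALplus_sub_mem γ₀ (n + (n + 2 * k))] with γ hγ
  have h1 := congr(D.galAL γ $h)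
  have h2 := congr(D.galAL γ₀ $h)
  simp only [map_mul, map_add, map_pow, map_natCast, galAL_algebraMap] at h1 h2
  obtain ⟨e, he⟩ := D.gal_X_dvd_X γ
  obtain ⟨e₀, he₀⟩ := D.gal_X_dvd_X γ₀
  have h3 : D.galALplus γ₀ X ^ k * D.galALplus γ a - D.galALplus γ X ^ k * D.galALplus γ₀ a ∈
      pmuIdeal p OL ^ (n + (n + 2 * k)) := by
    have h4 := Ideal.mul_mem_left _ (D.galALplus γ₀ X ^ k) (hγ a)
    have h5 := Ideal.mul_mem_left _ (D.galALplus γ₀ a) (hγ (X ^ k))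
    rw [map_pow, map_pow] at h5
    have := sub_mem h4 h5
    convert this using 1
    ring
  obtain ⟨b, c, hbc⟩ := exists_of_mem_pmuIdeal_pow h3
  set j := algebraMap (ALplus OL) (AL p OL) with hj
  have hbc' := congr(j $hbc)
  have he' := congr(j $he)
  have he₀' := congr(j $he₀)
  simp only [map_mul, map_add, map_sub, map_pow, map_natCast] at hbc' he' he₀'
  obtain ⟨v, hv⟩ := isUnit_X_AL p OL
  rw [← hj] at hv
  have hvv : (v : AL p OL) * (↑v⁻¹ : AL p OL) = 1 := v.mul_inv
  set w : AL p OL := (↑v⁻¹ : AL p OL) with hw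
  set g := j (D.galALplus γ X)
  set g₀ := j (D.galALplus γ₀ X)
  rw [← hv] at he' he₀' hbc'
  -- With `w = μ⁻¹` and `μ = γ(μ) e`, the element `w e` is the inverse of `γ(μ)`; likewise for `γ₀`.
  have hg : g ^ k * (w * j e) ^ k = 1 := by
    rw [← mul_pow]
    have : g * (w * j e) = 1 := by linear_combination hvv - w * he'
    rw [this, one_pow]
  have hg₀ : g₀ ^ k * (w * j e₀) ^ k = 1 := by
    rw [← mul_pow]
    have : g₀ * (w * j e₀) = 1 := by linear_combination hvv - w * he₀'
    rw [this, one_pow]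
  have hvw : (v : AL p OL) ^ (2 * k) * w ^ k * w ^ k = 1 := by
    rw [mul_assoc, ← pow_add, ← two_mul, ← mul_pow, hvv, one_pow]
  refine mem_weakNhd.mpr ⟨c * e ^ k * e₀ ^ k, (w * j e) ^ k * D.galAL γ y -
    (w * j e₀) ^ k * D.galAL γ₀ y + (w * j e) ^ k * (w * j e₀) ^ k * j b, ?_⟩
  rw [← hj, ← hv, map_mul, map_mul, map_pow, map_pow]
  have e1 : D.galAL γ x = (w * j e) ^ k * (j (D.galALplus γ a) + (p : AL p OL) ^ n * D.galAL γ y) := by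
    linear_combination (w * j e) ^ k * h1 - D.galAL γ x * hg
  have e2 : D.galAL γ₀ x = (w * j e₀) ^ k * (j (D.galALplus γ₀ a) + (p : AL p OL) ^ n * D.galAL γ₀ y) := by
    linear_combination (w * j e₀) ^ k * h2 - D.galAL γ₀ x * hg₀
  have e3 : (w * j e) ^ k * j (D.galALplus γ a) - (w * j e₀) ^ k * j (D.galALplus γ₀ a) =
      (w * j e) ^ k * (w * j e₀) ^ k * (g₀ ^ k * j (D.galALplus γ a) - g ^ k * j (D.galALplus γ₀ a)) := by
    linear_combination -(w * j e) ^ k * j (D.galALplus γ a) * hg₀ + (w * j e₀) ^ k * j (D.galALplus γ₀ a) * hg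
  have e4 : (w * j e) ^ k * (w * j e₀) ^ k * ((v : AL p OL) ^ (n + 2 * k) * j c) =
      v ^ n * (j c * j e ^ k * j e₀ ^ k) := by
    rw [pow_add, mul_pow, mul_pow]
    linear_combination (v : AL p OL) ^ n * j c * j e ^ k * j e₀ ^ k * hvw
  rw [e1, e2]
  linear_combination e3 + (w * j e) ^ k * (w * j e₀) ^ k * hbc' + e4

/-- The action of `Γ_L` on `A_L` is continuous for the weak topology. -/
theorem continuous_galAL :
    letI := weakTopology p OL
    Continuous fun x : GammaL p κ d OL × AL p OL => D.galAL x.1 x.2 := by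
  let _ := weakTopology p OL
  refine continuous_iff_continuousAt.mpr fun ⟨γ₀, x⟩ => tendsto_subgroupTopology.mpr fun n => ?_
  have h1 : ∀ᶠ y in 𝓝 x, y - x ∈ weakNhd p OL n :=
    tendsto_subgroupTopology.mp (tendsto_id (x := 𝓝 x)) n
  filter_upwards [prod_mem_nhds (D.eventually_galAL_sub_mem γ₀ x n) h1] with ⟨γ, y⟩ ⟨hγ, hy⟩
  have := add_mem (D.galAL_mem_weakNhd γ hy) hγ
  rw [map_sub, sub_add_sub_cancel] at this
  exact this

theorem frobALplus_qPow (a : ℤ_[p]) :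
    frobALplus p κ d OL (qPow p κ d OL a) = qPow p κ d OL a ^ p := by
  have := ALplus_isAdicComplete p κ d OL
  have h1 : frobALplus p κ d OL (1 + X) = (1 + X) ^ p := by
    rw [map_add, map_one, (frobALplus_spec p κ d OL).mu]; ring
  have hq : frobALplus p κ d OL (1 + X) - 1 ∈ pmuIdeal p OL := by
    have := frobALplus_map_le p κ d OL
      (Ideal.mem_map_of_mem (frobALplus p κ d OL) (q_sub_one_mem p OL))
    rwa [map_sub, map_one] at this
  have h2 := map_padicPow (pmuIdeal p OL) (p_mem_pmuIdeal p OL) (q_sub_one_mem p OL)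
    (pmuIdeal p OL) (p_mem_pmuIdeal p OL) (frobALplus p κ d OL) (frobALplus_map_le p κ d OL) hq a
  refine h2.trans ?_
  refine (padicPow_unique _ _ _ _ _ fun n => ?_).symm
  obtain ⟨m, hm⟩ := exists_nat_approx a n
  refine ⟨m, hm, ?_⟩
  have h3 : qPow p κ d OL a - (1 + X) ^ m ∈ pmuIdeal p OL ^ n :=
    padicPow_spec _ (p_mem_pmuIdeal p OL) (q_sub_one_mem p OL) a hm
  rw [h1, ← pow_mul, mul_comm p m, pow_mul]
  exact Ideal.mem_of_dvd _ (sub_dvd_pow_sub_pow _ _ p) h3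

/-- The two composites agree on `O_F`, the `X_i` and `μ` by the explicit formulas, since `φ(q ^ a) =
(q ^ a) ^ p`. Modulo `(p, μ)` both are `y ↦ y ^ p` on `O_L`, so uniqueness applies. -/
theorem frobALplus_galALplus (γ : GammaL p κ d OL) (a : ALplus OL) :
    frobALplus p κ d OL (D.galALplus γ a) = D.galALplus γ (frobALplus p κ d OL a) := by
  have := ALplus_isAdicComplete p κ d OL
  have h := D.galALplus_spec γ
  have hφ := frobALplus_spec p κ d OL
  have hle := frobALplus_map_le p κ d OL
  have key : (frobALplus p κ d OL).comp (D.galALplus γ) =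
      (D.galALplus γ).comp (frobALplus p κ d OL) := by
    refine ALplus_hom_ext p κ d OL (pmuIdeal p OL) (p_mem_pmuIdeal p OL) _ _ ?_ ?_ ?_ ?_ ?_
    · intro w
      rw [RingHom.comp_apply, RingHom.comp_apply, h.witt, hφ.witt, h.witt]
    · intro i
      rw [RingHom.comp_apply, RingHom.comp_apply, h.x, hφ.x, map_pow, h.x, map_mul, hφ.x,
        frobALplus_qPow, mul_pow]
    · rw [RingHom.comp_apply, RingHom.comp_apply, h.mu, hφ.mu, map_sub, map_sub, map_one, map_one,
        map_pow, map_add, map_one, h.mu, frobALplus_qPow, add_sub_cancel]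
    · rw [RingHom.comp_apply, h.mu]
      exact hle (Ideal.mem_map_of_mem _ (qPow_sub_one_mem p κ d OL _))
    · intro y
      rw [Ideal.Quotient.eq, RingHom.comp_apply, RingHom.comp_apply]
      have h1 := hle (Ideal.mem_map_of_mem _ (h.lift y))
      have h2 := h.map_le (Ideal.mem_map_of_mem _ (hφ.lift y))
      have h3 := hφ.lift y
      have h4 := Ideal.mem_of_dvd _ (sub_dvd_pow_sub_pow _ _ p) (h.lift y)
      rw [map_sub] at h1 h2
      rw [map_pow] at h2
      have := sub_mem (sub_mem (add_mem h1 h3) h2) h4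
      convert this using 1
      ring
  exact congr($key a)

theorem frobAL_galAL (γ : GammaL p κ d OL) (x : AL p OL) :
    frobAL p κ d OL (D.galAL γ x) = D.galAL γ (frobAL p κ d OL x) := by
  have key : (frobAL p κ d OL).comp (D.galAL γ) = (D.galAL γ).comp (frobAL p κ d OL) := by
    refine AL_hom_ext p OL (Ideal.span {(p : AL p OL)}) (Ideal.mem_span_singleton_self _) _ _
      fun a => ?_
    rw [RingHom.comp_apply, RingHom.comp_apply, galAL_algebraMap, frobAL_algebraMap,
      frobAL_algebraMap, galAL_algebraMap, frobALplus_galALplus]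
  exact congr($key x)

end RootData

end Galois

end

end Wach

namespace Wach

noncomputable section

/-! ### Extension of scalars from `A_L⁺` to `A_L` -/

section BaseChange

open PowerSeries

variable {p : ℕ} [Fact p.Prime] {κ : Type u} [Field κ] [CharP κ p] [PerfectRing κ p] {d : ℕ}
variable {OL : Type v} [CommRing OL] [Algebra (OLsq p κ d) OL] [Algebra.Etale (OLsq p κ d) OL]
  [Module.Finite (OLsq p κ d) OL] [IsDomain OL] {D : RootData p κ d OL}

set_option linter.unusedSectionVars false

theorem isUnit_algebraMap_end {R A M : Type*} [CommRing R] [CommRing A] [Algebra R A] [AddCommGroup M]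
    [Module R M] [Module A M] [IsScalarTower R A M] {s : R} (hs : IsUnit (algebraMap R A s)) :
    IsUnit (algebraMap R (Module.End R M) s) := by
  have h := hs.map (Algebra.lsmul R R M : A →ₐ[R] Module.End R M)
  rwa [AlgHom.commutes] at h

/-- The map `N[1/s] → A_L ⊗ N`, for `s` invertible in `A_L`. -/
def locToAL (p : ℕ) {s : ALplus OL} (hs : IsUnit (algebraMap (ALplus OL) (AL p OL) s))
    (N : Type v) [AddCommGroup N] [Module (ALplus OL) N] :
    LocalizedModule (Submonoid.powers s) N →ₗ[ALplus OL] AL p OL ⊗[ALplus OL] N :=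
  IsLocalizedModule.lift (Submonoid.powers s) (LocalizedModule.mkLinearMap (Submonoid.powers s) N)
    (TensorProduct.mk (ALplus OL) (AL p OL) N 1) (by
      rintro ⟨_, k, rfl⟩
      refine isUnit_algebraMap_end (A := AL p OL) ?_
      simpa using hs.pow k)

section locToAL

variable {s : ALplus OL} (hs : IsUnit (algebraMap (ALplus OL) (AL p OL) s))
  (N : Type v) [AddCommGroup N] [Module (ALplus OL) N]

theorem locToAL_mk (x : N) :
    locToAL p hs N (LocalizedModule.mkLinearMap (Submonoid.powers s) N x) = 1 ⊗ₜ x := by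
  rw [locToAL, IsLocalizedModule.lift_apply, TensorProduct.mk_apply]

theorem exists_pow_smul_eq_mk (y : LocalizedModule (Submonoid.powers s) N) :
    ∃ (k : ℕ) (x : N), s ^ k • y = LocalizedModule.mkLinearMap (Submonoid.powers s) N x := by
  obtain ⟨⟨x, ⟨_, k, rfl⟩⟩, h⟩ :=
    IsLocalizedModule.surj (Submonoid.powers s) (LocalizedModule.mkLinearMap _ N) y
  exact ⟨k, x, h⟩

theorem pow_smul_cancel {M : Type*} [AddCommGroup M] [Module (ALplus OL) M] [Module (AL p OL) M]
    [IsScalarTower (ALplus OL) (AL p OL) M] {s : ALplus OL}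
    (hs : IsUnit (algebraMap (ALplus OL) (AL p OL) s)) (k : ℕ) {x y : M}
    (h : s ^ k • x = s ^ k • y) : x = y := by
  rw [← algebraMap_smul (AL p OL) (s ^ k) x, ← algebraMap_smul (AL p OL) (s ^ k) y, map_pow] at h
  exact ((hs.pow k).smul_left_cancel).mp h

theorem locToAL_injective (h : Function.Injective fun x : N => (1 : AL p OL) ⊗ₜ[ALplus OL] x) :
    Function.Injective (locToAL p hs N) := by
  rw [injective_iff_map_eq_zero]
  intro y hy
  obtain ⟨k, x, hx⟩ := exists_pow_smul_eq_mk N y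
  have h1 := congr(locToAL p hs N $hx)
  rw [map_smul, hy, smul_zero, locToAL_mk] at h1
  have h2 : x = 0 := h (by simpa using h1.symm)
  rw [h2, map_zero] at hx
  have h3 := IsLocalizedModule.smul_injective (LocalizedModule.mkLinearMap (Submonoid.powers s) N)
    (⟨s ^ k, k, rfl⟩ : Submonoid.powers s)
  exact h3 (hx.trans (smul_zero _).symm)

variable {N} in
theorem locToAL_locMap {N' : Type v} [AddCommGroup N'] [Module (ALplus OL) N']
    (f : AL p OL ⊗[ALplus OL] N →ₗ[AL p OL] AL p OL ⊗[ALplus OL] N') (g : N →ₗ[ALplus OL] N')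
    (h : ∀ x, f (1 ⊗ₜ x) = 1 ⊗ₜ g x) (y : LocalizedModule (Submonoid.powers s) N) :
    locToAL p hs N' (locMap s g y) = f (locToAL p hs N y) := by
  obtain ⟨k, x, hx⟩ := exists_pow_smul_eq_mk N y
  refine pow_smul_cancel hs k ?_
  rw [← LinearMap.map_smul_of_tower f, ← map_smul, ← map_smul, ← map_smul, hx, locToAL_mk, h, locMap,
    IsLocalizedModule.map_apply, locToAL_mk]

end locToAL

namespace PhiGammaPlus

variable (N : PhiGammaPlus D)

/-- The additive map underlying the Frobenius of `A_L ⊗ N`. -/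
def phiALHom : (AL p OL ⊗[ALplus OL] N) →+ (AL p OL ⊗[ALplus OL] N) :=
  TensorProduct.liftAddHom
    (AddMonoidHom.mk' (fun a : AL p OL => AddMonoidHom.mk'
      (fun x : N => frobAL p κ d OL a •
        locToAL p (isUnit_frob_X p κ d OL) N (N.phi (LocalizedModule.mkLinearMap _ N x)))
      (fun x y => by simp only [map_add, smul_add]))
      (fun a b => by
        ext x
        simp only [AddMonoidHom.mk'_apply, map_add, add_smul, AddMonoidHom.add_apply]))
    (fun r a x => by
      simp only [AddMonoidHom.mk'_apply]
      rw [Algebra.smul_def, map_mul, frobAL_algebraMap, map_smul, map_smulₛₗ, map_smul,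
        ← algebraMap_smul (AL p OL) (frobALplus p κ d OL r), smul_smul, mul_comm])

theorem phiALHom_tmul (a : AL p OL) (x : N) : N.phiALHom (a ⊗ₜ x) = frobAL p κ d OL a •
    locToAL p (isUnit_frob_X p κ d OL) N (N.phi (LocalizedModule.mkLinearMap _ N x)) := rfl

theorem phiALHom_smul (a : AL p OL) (z : AL p OL ⊗[ALplus OL] N) :
    N.phiALHom (a • z) = frobAL p κ d OL a • N.phiALHom z := by
  induction z using TensorProduct.induction_on with
  | zero => rw [smul_zero, map_zero, smul_zero]
  | tmul b x =>
    rw [TensorProduct.smul_tmul', phiALHom_tmul, phiALHom_tmul, smul_eq_mul, map_mul, mul_smul]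
  | add x y hx hy => rw [smul_add, map_add, hx, hy, map_add, smul_add]

/-- The Frobenius of `A_L ⊗ N`. -/
def phiAL : (AL p OL ⊗[ALplus OL] N) →ₛₗ[frobAL p κ d OL] (AL p OL ⊗[ALplus OL] N) where
  toFun := N.phiALHom
  map_add' := map_add _
  map_smul' := N.phiALHom_smul

theorem phiAL_tmul (a : AL p OL) (x : N) : N.phiAL (a ⊗ₜ x) = frobAL p κ d OL a •
    locToAL p (isUnit_frob_X p κ d OL) N (N.phi (LocalizedModule.mkLinearMap _ N x)) := rfl

theorem phiAL_smul (r : ALplus OL) (z : AL p OL ⊗[ALplus OL] N) :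
    N.phiAL (r • z) = frobALplus p κ d OL r • N.phiAL z := by
  rw [← algebraMap_smul (AL p OL) r, map_smulₛₗ, frobAL_algebraMap, algebraMap_smul]

/-- Clear the denominator `μ ^ k`: Frobenius turns it into `φ(μ) ^ k`, which is invertible in `A_L`.
This lets the conditions on `μ ^ b N` inside `N[1/μ]` be read in `A_L ⊗ N`. -/
theorem phiAL_locToAL (y : LocalizedModule (Submonoid.powers (X : ALplus OL)) N) :
    N.phiAL (locToAL p (isUnit_X_AL p OL) N y) =
      locToAL p (isUnit_frob_X p κ d OL) N (N.phi y) := by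
  obtain ⟨k, x, hx⟩ := exists_pow_smul_eq_mk _ y
  refine pow_smul_cancel (isUnit_frob_X p κ d OL) k ?_
  have h1 : N.phiAL (locToAL p (isUnit_X_AL p OL) N ((X : ALplus OL) ^ k • y)) =
      locToAL p (isUnit_frob_X p κ d OL) N (N.phi ((X : ALplus OL) ^ k • y)) := by
    rw [hx, locToAL_mk, phiAL_tmul, map_one, one_smul]
  rwa [map_smul, phiAL_smul, map_smulₛₗ, map_smul, map_pow] at h1

/-- The action of `Γ_L` on `A_L ⊗ N`. -/
def galALHom (γ : GammaL p κ d OL) : (AL p OL ⊗[ALplus OL] N) →+ (AL p OL ⊗[ALplus OL] N) :=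
  TensorProduct.liftAddHom
    (AddMonoidHom.mk' (fun a : AL p OL => AddMonoidHom.mk'
      (fun x : N => D.galAL γ a ⊗ₜ[ALplus OL] N.gal γ x)
      (fun x y => by rw [map_add, TensorProduct.tmul_add]))
      (fun a b => by
        ext x
        simp only [AddMonoidHom.mk'_apply, map_add, TensorProduct.add_tmul, AddMonoidHom.add_apply]))
    (fun r a x => by
      simp only [AddMonoidHom.mk'_apply]
      rw [Algebra.smul_def, map_mul, D.galAL_algebraMap, ← Algebra.smul_def, gal_smul,
        TensorProduct.smul_tmul])

theorem galALHom_tmul (γ : GammaL p κ d OL) (a : AL p OL) (x : N) :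
    N.galALHom γ (a ⊗ₜ x) = D.galAL γ a ⊗ₜ N.gal γ x := rfl

theorem galALHom_smul (γ : GammaL p κ d OL) (a : AL p OL) (z : AL p OL ⊗[ALplus OL] N) :
    N.galALHom γ (a • z) = D.galAL γ a • N.galALHom γ z := by
  induction z using TensorProduct.induction_on with
  | zero => simp
  | tmul b x =>
    rw [TensorProduct.smul_tmul', galALHom_tmul, galALHom_tmul, smul_eq_mul, map_mul,
      TensorProduct.smul_tmul', smul_eq_mul]
  | add x y hx hy => rw [smul_add, map_add, hx, hy, map_add, smul_add]

theorem phiAL_galALHom (γ : GammaL p κ d OL) (z : AL p OL ⊗[ALplus OL] N) :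
    N.phiAL (N.galALHom γ z) = N.galALHom γ (N.phiAL z) := by
  induction z using TensorProduct.induction_on with
  | zero => simp
  | add x y hx hy => rw [map_add, map_add, hx, hy, map_add, map_add]
  | tmul a x =>
    rw [galALHom_tmul, phiAL_tmul, phiAL_tmul, galALHom_smul, D.frobAL_galAL]
    congr 1
    -- Commutation on `N` is only given with denominators cleared. Writing `φ(x) = y / φ(μ) ^ k`,
    -- both sides become `1 ⊗ γ(y)` after multiplication by the unit `γ(φ(μ)) ^ k`.
    obtain ⟨k, y, hy⟩ := exists_pow_smul_eq_mk _ (N.phi (LocalizedModule.mkLinearMap _ N x))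
    have h1 := congr(locToAL p (isUnit_frob_X p κ d OL) N $(N.phi_gal γ x y k hy))
    have h2 := congr(N.galALHom γ (locToAL p (isUnit_frob_X p κ d OL) N $hy))
    rw [map_smul, locToAL_mk] at h1 h2
    rw [← algebraMap_smul (AL p OL) (frobALplus p κ d OL X ^ k), galALHom_smul, D.galAL_algebraMap, algebraMap_smul,
      galALHom_tmul, map_one, map_pow] at h2
    have hu : IsUnit (algebraMap (ALplus OL) (AL p OL)
        (D.galALplus γ (frobALplus p κ d OL X))) := by
      rw [← D.galAL_algebraMap]
      exact (isUnit_frob_X p κ d OL).map _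
    exact pow_smul_cancel hu k (h1.trans h2.symm)

theorem galALHom_one : N.galALHom 1 = AddMonoidHom.id _ := by
  ext z
  induction z using TensorProduct.induction_on with
  | zero => rw [map_zero, map_zero]
  | add x y hx hy => rw [map_add, hx, hy, map_add]
  | tmul a x => rw [galALHom_tmul, map_one, map_one]; rfl

theorem galALHom_mul (γ δ : GammaL p κ d OL) :
    N.galALHom (γ * δ) = (N.galALHom γ).comp (N.galALHom δ) := by
  ext z
  induction z using TensorProduct.induction_on with
  | zero => rw [map_zero, map_zero]
  | add x y hx hy => rw [map_add, hx, hy, map_add]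
  | tmul a x => rw [galALHom_tmul, map_mul, map_mul]; rfl

/-- The `(φ, Γ_L)`-module `A_L ⊗ N`. -/
def baseChange : PhiGamma D where
  carrier := AL p OL ⊗[ALplus OL] N
  gal :=
    { toFun := N.galALHom
      map_one' := N.galALHom_one
      map_mul' := N.galALHom_mul }
  gal_smul := N.galALHom_smul
  phi := N.phiAL
  phi_gal := N.phiAL_galALHom

theorem baseChange_isCompatible :
    IsCompatible N N.baseChange fun x => ((1 : AL p OL) ⊗ₜ[ALplus OL] x : AL p OL ⊗[ALplus OL] N) where
  gal γ x := by
    change _ = N.galALHom γ _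
    rw [galALHom_tmul, map_one]
  phi x y k h := by
    have h1 := congr(locToAL p (isUnit_frob_X p κ d OL) N $h)
    rw [map_smul, locToAL_mk, ← algebraMap_smul (AL p OL) (frobALplus p κ d OL X ^ k), map_pow] at h1
    have h2 : N.phiAL (1 ⊗ₜ x) =
        locToAL p (isUnit_frob_X p κ d OL) N (N.phi (LocalizedModule.mkLinearMap _ N x)) := by
      rw [phiAL_tmul, map_one, one_smul]
    exact (congrArg _ h2).trans h1

/-- The base change of an equivariant map is equivariant. -/
theorem IsEquivariant.baseChange {N N' : PhiGammaPlus D} {f : N →ₗ[ALplus OL] N'}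
    (hf : IsEquivariant f) : PhiGamma.IsEquivariant (E := N.baseChange) (E' := N'.baseChange)
      (f.baseChange (AL p OL)) where
  gal γ z := by
    change f.baseChange (AL p OL) (N.galALHom γ z) = N'.galALHom γ (f.baseChange (AL p OL) z)
    induction z using TensorProduct.induction_on with
    | zero => simp
    | add x y hx hy => rw [map_add, map_add, hx, hy, map_add, map_add]
    | tmul a x =>
      rw [galALHom_tmul, LinearMap.baseChange_tmul, LinearMap.baseChange_tmul, galALHom_tmul, hf.gal]
  phi z := by
    change f.baseChange (AL p OL) (N.phiAL z) = N'.phiAL (f.baseChange (AL p OL) z)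
    induction z using TensorProduct.induction_on with
    | zero => simp
    | add x y hx hy => rw [map_add, map_add, hx, hy, map_add, map_add]
    | tmul a x =>
      rw [phiAL_tmul, LinearMap.baseChange_tmul, phiAL_tmul, map_smul]
      congr 1
      rw [← locToAL_locMap _ (f.baseChange (AL p OL)) f (fun x => LinearMap.baseChange_tmul _ _ _),
        ← hf.phi]
      congr 2
      rw [locMap, IsLocalizedModule.map_apply]

/-- An equivariant map between base changes which carries `N` to `N'` comes from an equivariant map
`N → N'`. -/
theorem exists_isEquivariant {N N' : PhiGammaPlus D}
    (hN' : Function.Injective fun x : N' => (1 : AL p OL) ⊗ₜ[ALplus OL] x)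
    (f : AL p OL ⊗[ALplus OL] N →ₗ[AL p OL] AL p OL ⊗[ALplus OL] N')
    (hf : PhiGamma.IsEquivariant (E := N.baseChange) (E' := N'.baseChange) f)
    (h : ∀ x : N, ∃ x' : N', f (1 ⊗ₜ x) = 1 ⊗ₜ x') :
    ∃ g : N →ₗ[ALplus OL] N', IsEquivariant g ∧ ∀ x, f (1 ⊗ₜ x) = 1 ⊗ₜ g x := by
  choose g hg using h
  let g' : N →ₗ[ALplus OL] N' :=
    { toFun := g
      map_add' := fun x y => hN' (by
        change (1 : AL p OL) ⊗ₜ[ALplus OL] _ = (1 : AL p OL) ⊗ₜ[ALplus OL] _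
        rw [TensorProduct.tmul_add, ← hg, ← hg, ← hg, TensorProduct.tmul_add, map_add])
      map_smul' := fun a x => hN' (by
        change (1 : AL p OL) ⊗ₜ[ALplus OL] _ = (1 : AL p OL) ⊗ₜ[ALplus OL] _
        rw [TensorProduct.tmul_smul, ← hg, RingHom.id_apply, ← hg, TensorProduct.tmul_smul,
          LinearMap.map_smul_of_tower]) }
  refine ⟨g', ⟨fun γ x => hN' ?_, fun y => ?_⟩, hg⟩
  · have h1 : f (N.galALHom γ (1 ⊗ₜ x)) = N'.galALHom γ (f (1 ⊗ₜ x)) := hf.gal γ _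
    rw [galALHom_tmul, map_one, hg, hg, galALHom_tmul, map_one] at h1
    exact h1
  · apply locToAL_injective (isUnit_frob_X p κ d OL) N' hN'
    have h1 : f (N.phiAL (locToAL p (isUnit_X_AL p OL) N y)) =
        N'.phiAL (f (locToAL p (isUnit_X_AL p OL) N y)) := hf.phi _
    rw [phiAL_locToAL, ← locToAL_locMap _ f g' hg, ← locToAL_locMap _ f g' hg, phiAL_locToAL] at h1
    exact h1.symm

end PhiGammaPlus

end BaseChange

end

end Wach

namespace Wach

noncomputable section

/-! ### Extensions of scalars of Wach modules are étale -/

section Linearization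

variable {A M : Type*} [CommRing A] {φ : A →+* A} [AddCommGroup M] [Module A M]
  {ι : Type*} [Fintype ι] (m : Module.Basis ι A M) (f : M →ₛₗ[φ] M)

/-- If the images of a basis generate, the linear endomorphism sending the basis to them is
surjective, and a surjective endomorphism of a finite module is injective. -/
theorem constr_injective_of_span (h : ⊤ ≤ Submodule.span A (Set.range (f ∘ m))) :
    Function.Injective (m.constr A (f ∘ m)) := by
  have : Module.Finite A M := Module.Finite.of_basis m
  refine OrzechProperty.injective_of_surjective_endomorphism _ ?_
  rw [← LinearMap.range_eq_top, m.constr_range]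
  exact top_le_iff.mp h

theorem linearIndependent_of_span (h : ⊤ ≤ Submodule.span A (Set.range (f ∘ m))) :
    LinearIndependent A (f ∘ m) := by
  have h1 := m.linearIndependent.map' (m.constr A (f ∘ m))
    (LinearMap.ker_eq_bot.mpr (constr_injective_of_span m f h))
  have h2 : ⇑(m.constr A (f ∘ m)) ∘ ⇑m = f ∘ m := funext fun i => m.constr_basis A _ i
  rwa [h2] at h1

theorem exists_sum_tmul (t : FrobPullback φ M) :
    ∃ c : ι → A, t = ∑ i, (show FrobTwist φ from c i) ⊗ₜ[A] m i := by
  induction t using TensorProduct.induction_on with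
  | zero =>
    refine ⟨0, (Finset.sum_eq_zero fun i _ => ?_).symm⟩
    exact TensorProduct.zero_tmul _ _
  | tmul a x =>
    refine ⟨fun i => φ (m.repr x i) * (show A from a), ?_⟩
    conv_lhs => rw [← m.sum_repr x, TensorProduct.tmul_sum]
    refine Finset.sum_congr rfl fun i _ => ?_
    rw [← TensorProduct.smul_tmul]
    rfl
  | add x y hx hy =>
    obtain ⟨c, rfl⟩ := hx
    obtain ⟨c', rfl⟩ := hy
    refine ⟨c + c', ?_⟩
    rw [← Finset.sum_add_distrib]
    exact Finset.sum_congr rfl fun i _ => (TensorProduct.add_tmul _ _ _).symm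

/-- Every element of `φ^* M` has the form `∑ c i ⊗ m i`, and on such sums the linearisation is the
linear endomorphism with `m i ↦ f (m i)`. -/
theorem linearization_bijective (h : ⊤ ≤ Submodule.span A (Set.range (f ∘ m))) :
    Function.Bijective (linearization f) := by
  have key : ∀ c : ι → A, linearization f (∑ i, (show FrobTwist φ from c i) ⊗ₜ[A] m i) =
      m.constr A (f ∘ m) (∑ i, c i • m i) := by
    intro c
    rw [map_sum, map_sum]
    refine Finset.sum_congr rfl fun i _ => ?_
    rw [map_smul, Module.Basis.constr_basis]
    exact linearization_tmul f (c i) (m i)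
  constructor
  · rw [injective_iff_map_eq_zero]
    intro t ht
    obtain ⟨c, rfl⟩ := exists_sum_tmul m t
    rw [key] at ht
    have h1 := constr_injective_of_span m f h (ht.trans (map_zero _).symm)
    have h2 := Fintype.linearIndependent_iff.mp m.linearIndependent c h1
    refine Finset.sum_eq_zero fun i _ => ?_
    rw [h2 i]
    exact TensorProduct.zero_tmul _ _
  · intro z
    have h1 : z ∈ LinearMap.range (m.constr A (f ∘ m)) := by
      rw [m.constr_range]
      exact h trivial
    obtain ⟨w, rfl⟩ := h1
    exact ⟨_, (key (m.repr w)).trans (by rw [m.sum_repr])⟩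

theorem map_linearization_mem {M' P : Type*} [AddCommGroup M'] [Module A M'] [AddCommGroup P]
    [Module A P] (f : M →ₛₗ[φ] M') (g : M' →ₗ[A] P) (S : Submodule A P) (h : ∀ x, g (f x) ∈ S)
    (t : FrobPullback φ M) : g (linearization f t) ∈ S := by
  induction t using TensorProduct.induction_on with
  | zero => rw [map_zero, map_zero]; exact S.zero_mem
  | add x y hx hy => rw [map_add, map_add]; exact S.add_mem hx hy
  | tmul c x =>
    have h1 := linearization_tmul f (show A from c) x
    have h2 : g (linearization f (c ⊗ₜ[A] x)) = (show A from c) • g (f x) := by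
      rw [← map_smul, ← h1]
    rw [h2]
    exact S.smul_mem _ (h x)

theorem continuous_sum_sum_smul {X : Type*} [TopologicalSpace X] [TopologicalSpace A]
    [TopologicalSpace M] [ContinuousAdd M] [ContinuousSMul A M] (F : ι → ι → X → A)
    (hF : ∀ i j, Continuous (F i j)) (v : ι → M) : Continuous fun x => ∑ i, ∑ j, F i j x • v j :=
  continuous_finsetSum _ fun i _ => continuous_finsetSum _ fun j _ =>
    (hF i j).smul continuous_const

end Linearization

/-! ### Étaleness and continuity of `A_L ⊗ N` -/

section Etale

open PowerSeries

variable {p : ℕ} [Fact p.Prime] {κ : Type u} [Field κ] [CharP κ p] [PerfectRing κ p] {d : ℕ}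
variable {OL : Type v} [CommRing OL] [Algebra (OLsq p κ d) OL] [Algebra.Etale (OLsq p κ d) OL]
  [Module.Finite (OLsq p κ d) OL] [IsDomain OL] {D : RootData p κ d OL}

set_option linter.unusedSectionVars false

/-- The unit `μ` of `A_L`. -/
def muUnit (p : ℕ) (OL : Type v) [CommRing OL] : (AL p OL)ˣ := (isUnit_X_AL p OL).unit

theorem muUnit_coe (p : ℕ) (OL : Type v) [CommRing OL] :
    (muUnit p OL : AL p OL) = algebraMap (ALplus OL) (AL p OL) X := rfl

variable (p κ d OL) in
include κ d in
-- It is a factor of `φ(μ)`, which is a unit of `A_L`. This turns a bound on the cokernel of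
-- Frobenius into étaleness.
theorem isUnit_pq : IsUnit (algebraMap (ALplus OL) (AL p OL) (pq p OL)) := by
  have h := isUnit_frob_X p κ d OL
  rw [← pq_mul_X, map_mul] at h
  exact isUnit_of_mul_isUnit_left h

section PowTwist

variable {s : ALplus OL} (hs : IsUnit (algebraMap (ALplus OL) (AL p OL) s))
  {N : Type v} [AddCommGroup N] [Module (ALplus OL) N]

/-- The two truncated exponents in `powTwist` encode `y = μ ^ b x` for `b` of either sign; in `A_L`
they recombine into one integer power of the unit `μ`. -/
theorem locToAL_of_powTwist (b : ℤ) {y : LocalizedModule (Submonoid.powers s) N} {x : N}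
    (h : (X : ALplus OL) ^ (-b).toNat • y =
      (X : ALplus OL) ^ b.toNat • LocalizedModule.mkLinearMap (Submonoid.powers s) N x) :
    locToAL p hs N y = (↑(muUnit p OL ^ b) : AL p OL) • (1 : AL p OL) ⊗ₜ[ALplus OL] x := by
  have h1 := congr(locToAL p hs N $h)
  rw [map_smul, map_smul, locToAL_mk] at h1
  refine pow_smul_cancel (isUnit_X_AL p OL) (-b).toNat (h1.trans ?_)
  rw [← algebraMap_smul (AL p OL) ((X : ALplus OL) ^ b.toNat),
    ← algebraMap_smul (AL p OL) ((X : ALplus OL) ^ (-b).toNat), smul_smul, map_pow, map_pow,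
    ← muUnit_coe, ← Units.val_pow_eq_pow_val, ← Units.val_pow_eq_pow_val, ← Units.val_mul,
    ← zpow_natCast, ← zpow_natCast, ← zpow_add]
  congr 4
  omega

theorem exists_powTwist (hXs : X ∣ s) (b : ℤ) (x : N) : ∃ y ∈ powTwist X s b N,
    locToAL p hs N y = (↑(muUnit p OL ^ b) : AL p OL) • (1 : AL p OL) ⊗ₜ[ALplus OL] x := by
  obtain ⟨c, rfl⟩ := hXs
  set m := (-b).toNat with hm
  let f := LocalizedModule.mkLinearMap (Submonoid.powers (X * c : ALplus OL)) N
  -- Only `s = μ c` is inverted by construction, so `μ ^ (-m) x` is represented by the fraction `c ^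
  -- m x / s ^ m`.
  let w := IsLocalizedModule.mk' f (c ^ m • x) (⟨(X * c) ^ m, m, rfl⟩ : Submonoid.powers (X * c : ALplus OL))
  have hw : (X * c : ALplus OL) ^ m • w = f (c ^ m • x) :=
    IsLocalizedModule.mk'_cancel' f (c ^ m • x) (⟨(X * c) ^ m, m, rfl⟩ : Submonoid.powers (X * c : ALplus OL))
  have hw' : (X : ALplus OL) ^ m • w = f x := by
    apply IsLocalizedModule.smul_injective f (⟨(X * c) ^ m, m, rfl⟩ : Submonoid.powers (X * c : ALplus OL))
    change (X * c : ALplus OL) ^ m • (X : ALplus OL) ^ m • w = (X * c : ALplus OL) ^ m • f x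
    rw [smul_comm, hw, map_smul, smul_smul, mul_pow]
  have h : (X : ALplus OL) ^ (-b).toNat • ((X : ALplus OL) ^ b.toNat • w) =
      (X : ALplus OL) ^ b.toNat • f x := by
    rw [smul_comm, ← hm, hw']
  exact ⟨_, ⟨x, h⟩, locToAL_of_powTwist hs b h⟩

end PowTwist

namespace PhiGammaPlus

variable (N : PhiGammaPlus D)

theorem HasWeights.exists_phi {N : PhiGammaPlus D} {a b : ℤ} (h : N.HasWeights a b) (x : N) :
    ∃ x' : N, N.phiAL ((↑(muUnit p OL ^ b) : AL p OL) • (1 : AL p OL) ⊗ₜ[ALplus OL] x) =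
      (↑(muUnit p OL ^ b) : AL p OL) • (1 : AL p OL) ⊗ₜ[ALplus OL] x' := by
  obtain ⟨h, -, -⟩ := h
  obtain ⟨y, hy, hyx⟩ := exists_powTwist (p := p) (isUnit_X_AL p OL) dvd_rfl b x
  obtain ⟨x', hx'⟩ := h y hy
  refine ⟨x', ?_⟩
  rw [← hyx, phiAL_locToAL]
  exact locToAL_of_powTwist _ b hx'

set_option maxHeartbeats 1000000 in
-- This is the cokernel condition transported to `A_L ⊗ N`. The span is over `A_L⁺`, because the
-- bound on denominators needs integral coefficients.
theorem HasWeights.smul_mem_span {N : PhiGammaPlus D} {a b : ℤ} (h : N.HasWeights a b) (x : N) :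
    pq p OL ^ (b - a).toNat • (↑(muUnit p OL ^ b) : AL p OL) • (1 : AL p OL) ⊗ₜ[ALplus OL] x ∈
      Submodule.span (ALplus OL) (Set.range fun x' : N =>
        N.phiAL ((↑(muUnit p OL ^ b) : AL p OL) • (1 : AL p OL) ⊗ₜ[ALplus OL] x')) := by
  obtain ⟨h, -, h'⟩ := h
  obtain ⟨z, hz, hzx⟩ := exists_powTwist (p := p) (isUnit_frob_X p κ d OL)
    (pq_mul_X p κ d OL ▸ dvd_mul_left _ _) b x
  obtain ⟨t, ht⟩ := h' ⟨z, hz⟩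
  have ht' := congr(($ht : LocalizedModule (Submonoid.powers (frobALplus p κ d OL X)) N))
  rw [← hzx, ← map_smul]
  change _ = pq p OL ^ (b - a).toNat • z at ht'
  rw [← ht']
  clear ht ht'
  refine map_linearization_mem _ ((locToAL p (isUnit_frob_X p κ d OL) N).comp
    (powTwist X (frobALplus p κ d OL X) b N).subtype) _ ?_ t
  rintro ⟨y, x', hx'⟩
  refine Submodule.subset_span ⟨x', ?_⟩
  change N.phiAL _ = locToAL p (isUnit_frob_X p κ d OL) N (N.phi y)
  rw [← phiAL_locToAL, locToAL_of_powTwist _ b hx']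

variable {ι : Type*} [Fintype ι] (e : Module.Basis ι (ALplus OL) N)

/-- The basis `μ^b ⊗ e` of `A_L ⊗ N`. -/
def twistBasis (b : ℤ) : Module.Basis ι (AL p OL) (AL p OL ⊗[ALplus OL] N) :=
  (e.baseChange (AL p OL)).unitsSMul fun _ => muUnit p OL ^ b

variable {N}

theorem twistBasis_apply (b : ℤ) (i : ι) : N.twistBasis e b i =
    (↑(muUnit p OL ^ b) : AL p OL) • (1 : AL p OL) ⊗ₜ[ALplus OL] e i := by
  rw [twistBasis, Module.Basis.unitsSMul_apply, Module.Basis.baseChange_apply]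
  rfl

theorem sum_smul_twistBasis (b : ℤ) (r : ι → ALplus OL) : ∑ i, r i • N.twistBasis e b i =
    (↑(muUnit p OL ^ b) : AL p OL) • (1 : AL p OL) ⊗ₜ[ALplus OL] (∑ i, r i • e i) := by
  rw [TensorProduct.tmul_sum, Finset.smul_sum]
  refine Finset.sum_congr rfl fun i _ => ?_
  rw [twistBasis_apply, TensorProduct.tmul_smul, smul_comm]

theorem HasWeights.exists_matrix {a b : ℤ} (h : N.HasWeights a b) : ∃ P : ι → ι → ALplus OL,
    ∀ i, N.phiAL (N.twistBasis e b i) = ∑ l, P i l • N.twistBasis e b l := by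
  choose x' hx' using h.exists_phi
  refine ⟨fun i => e.repr (x' (e i)), fun i => ?_⟩
  rw [twistBasis_apply, hx', sum_smul_twistBasis, e.sum_repr]

/-- Writing `E` for the basis `μ ^ b ⊗ e`, there are relations `φ(E) = P E` and `[p]_q ^ (b - a) E =
Q φ(E)` with `P` and `Q` over `A_L⁺`. For the bound on denominators, the source contributes `P` and
the target contributes `Q`. -/
theorem HasWeights.exists_matrix_inv {a b : ℤ} (h : N.HasWeights a b) : ∃ Q : ι → ι → ALplus OL,
    ∀ j, pq p OL ^ (b - a).toNat • N.twistBasis e b j =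
      ∑ l, Q j l • N.phiAL (N.twistBasis e b l) := by
  have key : ∀ j, pq p OL ^ (b - a).toNat • N.twistBasis e b j ∈
      Submodule.span (ALplus OL) (Set.range fun l => N.phiAL (N.twistBasis e b l)) := by
    intro j
    rw [twistBasis_apply]
    refine (Submodule.span_le.mpr ?_) (h.smul_mem_span (e j))
    rintro _ ⟨x', rfl⟩
    change N.phiAL _ ∈ _
    rw [← e.sum_repr x', ← sum_smul_twistBasis, map_sum]
    refine sum_mem fun l _ => ?_
    rw [phiAL_smul]
    exact Submodule.smul_mem _ _ (Submodule.subset_span ⟨l, rfl⟩)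
  simp_rw [Submodule.mem_span_range_iff_exists_fun] at key
  choose Q hQ using key
  exact ⟨Q, fun j => (hQ j).symm⟩

theorem HasWeights.span_phi {a b : ℤ} (h : N.HasWeights a b) :
    ⊤ ≤ Submodule.span (AL p OL) (Set.range (N.phiAL ∘ N.twistBasis e b)) := by
  obtain ⟨Q, hQ⟩ := h.exists_matrix_inv e
  rw [← (N.twistBasis e b).span_eq, Submodule.span_le]
  rintro _ ⟨j, rfl⟩
  obtain ⟨u, hu⟩ := (isUnit_pq p κ d OL).pow (b - a).toNat
  have h1 : N.twistBasis e b j = (↑u⁻¹ : AL p OL) •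
      ∑ l, Q j l • N.phiAL (N.twistBasis e b l) := by
    rw [← hQ, ← algebraMap_smul (AL p OL) (pq p OL ^ (b - a).toNat), map_pow, ← hu, smul_smul,
      Units.inv_mul, one_smul]
  rw [SetLike.mem_coe, h1]
  refine Submodule.smul_mem _ _ (sum_mem fun l _ => ?_)
  rw [← algebraMap_smul (AL p OL)]
  exact Submodule.smul_mem _ _ (Submodule.subset_span ⟨l, rfl⟩)

theorem galALHom_eq_sum (γ : GammaL p κ d OL) (z : AL p OL ⊗[ALplus OL] N) :
    N.galALHom γ z = ∑ i, ∑ j, (D.galAL γ ((e.baseChange (AL p OL)).repr z i) *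
      algebraMap (ALplus OL) (AL p OL) (e.repr (N.gal γ (e i)) j)) • e.baseChange (AL p OL) j := by
  conv_lhs => rw [← (e.baseChange (AL p OL)).sum_repr z, map_sum]
  refine Finset.sum_congr rfl fun i _ => ?_
  rw [galALHom_smul, Module.Basis.baseChange_apply, galALHom_tmul, map_one]
  conv_lhs => rw [← e.sum_repr (N.gal γ (e i)), TensorProduct.tmul_sum, Finset.smul_sum]
  refine Finset.sum_congr rfl fun j _ => ?_
  rw [TensorProduct.tmul_smul, mul_smul, algebraMap_smul, Module.Basis.baseChange_apply]

set_option maxHeartbeats 1000000 in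
include e in
-- In coordinates `γ(z)` is a sum of products of two kinds of functions: `γ` applied to the
-- coordinates of `z`, continuous by `continuous_galAL`, and the matrix entries of `γ` on `N`,
-- continuous in `A_L⁺` and hence in `A_L`.
theorem continuous_galALHom (h : letI := ALplusTopology p OL
    IsContinuousAction (R := ALplus OL) N.gal) :
    letI := weakTopology p OL
    letI : TopologicalSpace (AL p OL ⊗[ALplus OL] N) := moduleTopology (AL p OL) _
    Continuous fun x : GammaL p κ d OL × (AL p OL ⊗[ALplus OL] N) => N.galALHom x.1 x.2 := by
  let _ := ALplusTopology p OL
  let _ := weakTopology p OL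
  let _ : TopologicalSpace N := moduleTopology (ALplus OL) N
  let _ : TopologicalSpace (AL p OL ⊗[ALplus OL] N) := moduleTopology (AL p OL) _
  have h : Continuous fun x : GammaL p κ d OL × N => N.gal x.1 x.2 := h
  have : IsModuleTopology (ALplus OL) N := ⟨rfl⟩
  have : IsModuleTopology (AL p OL) (AL p OL ⊗[ALplus OL] N) := ⟨rfl⟩
  have := weakTopology_isTopologicalRing p OL
  have : IsTopologicalRing (ALplus OL) := (Ideal.nonarchimedean (pmuIdeal p OL)).toIsTopologicalRing
  have : ContinuousAdd (AL p OL ⊗[ALplus OL] N) := IsModuleTopology.toContinuousAdd (AL p OL) _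
  have h1 : ∀ i j, Continuous fun γ : GammaL p κ d OL =>
      algebraMap (ALplus OL) (AL p OL) (e.repr (N.gal γ (e i)) j) := by
    intro i j
    have h2 : Continuous (e.coord j) := IsModuleTopology.continuous_of_linearMap _
    exact (continuous_algebraMap_AL p OL).comp (h2.comp (h.comp (Continuous.prodMk_left (e i))))
  have h3 : ∀ i, Continuous fun x : GammaL p κ d OL × (AL p OL ⊗[ALplus OL] N) =>
      D.galAL x.1 ((e.baseChange (AL p OL)).repr x.2 i) := by
    intro i
    have h2 : Continuous ((e.baseChange (AL p OL)).coord i) :=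
      IsModuleTopology.continuous_of_linearMap _
    have h4 : Continuous fun x : GammaL p κ d OL × AL p OL => D.galAL x.1 x.2 := D.continuous_galAL
    exact h4.comp (continuous_fst.prodMk (h2.comp continuous_snd))
  simp_rw [galALHom_eq_sum e]
  exact continuous_sum_sum_smul (fun i j (x : GammaL p κ d OL × (AL p OL ⊗[ALplus OL] N)) =>
    D.galAL x.1 ((e.baseChange (AL p OL)).repr x.2 i) *
      algebraMap (ALplus OL) (AL p OL) (e.repr (N.gal x.1 (e i)) j))
    (fun i j => (h3 i).mul ((h1 i j).comp continuous_fst)) _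

/-- The extension of scalars of a Wach module is an étale `(φ, Γ_L)`-module. -/
theorem IsWach.isEtale (h : N.IsWach) : N.baseChange.IsEtale where
  free := by
    have := h.free
    exact inferInstanceAs (Module.Free (AL p OL) (AL p OL ⊗[ALplus OL] N))
  finite := by
    have := h.finite
    exact inferInstanceAs (Module.Finite (AL p OL) (AL p OL ⊗[ALplus OL] N))
  continuous := by
    have := h.free
    have := h.finite
    exact continuous_galALHom (Module.Free.chooseBasis (ALplus OL) N) h.continuous
  bijective := by
    have := h.free
    have := h.finite
    obtain ⟨a, b, -, hab⟩ := h.weights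
    exact linearization_bijective
      (N.twistBasis (Module.Free.chooseBasis (ALplus OL) N) b) N.phiAL (hab.span_phi _)

end PhiGammaPlus

end Etale

end

end Wach

namespace Wach

noncomputable section

/-! ### Full faithfulness for Wach modules over `A_L⁺` -/

section FullyFaithful

open PowerSeries

variable {p : ℕ} [Fact p.Prime] {κ : Type u} [Field κ] [CharP κ p] [PerfectRing κ p] {d : ℕ}
variable {OL : Type v} [CommRing OL] [Algebra (OLsq p κ d) OL] [Algebra.Etale (OLsq p κ d) OL]
  [Module.Finite (OLsq p κ d) OL] [IsDomain OL] {D : RootData p κ d OL}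

set_option linter.unusedSectionVars false

variable (p κ d) in
include κ d in
theorem one_tmul_injective (N : Type v) [AddCommGroup N] [Module (ALplus OL) N]
    [Module.Free (ALplus OL) N] :
    Function.Injective fun x : N => (1 : AL p OL) ⊗ₜ[ALplus OL] x := by
  let e := Module.Free.chooseBasis (ALplus OL) N
  intro x y h
  refine e.repr.injective (Finsupp.ext fun i => algebraMap_AL_injective p κ d OL ?_)
  have h1 := congr((e.baseChange (AL p OL)).repr $h i)
  rwa [Module.Basis.baseChange_repr_tmul, Module.Basis.baseChange_repr_tmul,
    ← Algebra.algebraMap_eq_smul_one, ← Algebra.algebraMap_eq_smul_one] at h1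

variable (κ d) in
theorem frobAL_muUnit : frobAL p κ d OL (muUnit p OL : AL p OL) =
    algebraMap (ALplus OL) (AL p OL) (pq p OL) * (muUnit p OL : AL p OL) := by
  rw [muUnit_coe, frobAL_algebraMap, ← map_mul, pq_mul_X p κ d]

/-- The constant term of `γ(μ)/μ` is the linear coefficient of `(1 + μ) ^ χ(γ)`, that is, `χ(γ)`
seen in `O_L`. -/
theorem exists_gal_X (D : RootData p κ d OL) (k : ℕ) (hk : k ≠ 0) : ∃ (γ : GammaL p κ d OL)
    (v : ALplus OL), D.galALplus γ X = X * v ∧ constantCoeff v ^ k ≠ 1 := by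
  obtain ⟨γ, hγ⟩ := D.exists_chi_pow_ne_one k hk
  obtain ⟨v, hv⟩ := D.X_dvd_gal_X γ
  refine ⟨γ, v, hv, ?_⟩
  have h1 := congr(coeff 1 $hv)
  rw [(D.galALplus_spec γ).mu, map_sub, coeff_one, if_neg one_ne_zero, sub_zero,
    show (1 : ℕ) = 0 + 1 from rfl, coeff_succ_X_mul, coeff_zero_eq_constantCoeff_apply] at h1
  rwa [← h1]

theorem X_dvd_of_mul {v c : ALplus OL} (hv : constantCoeff v ≠ 0) (h : X ∣ v * c) : X ∣ c := by
  rw [X_dvd_iff, map_mul] at h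
  exact X_dvd_iff.mpr ((mul_eq_zero.mp h).resolve_left hv)

namespace PhiGammaPlus

variable {N N' : PhiGammaPlus D}

/-- Let `μ ^ (k + 1) f(x) = x'`, `γ(x) = x + μ y` and `γ(x') = x' + μ z`, and let `y'` be the image
of `y` under `μ ^ (k + 1) f`. Applying `γ`, with `γ(μ) = μ v`, gives `v ^ (k + 1) (x' + μ y') = x' +
μ z`, so `(v ^ (k + 1) - 1) x'` lies in `μ N'`. The constant term of `v ^ (k + 1) - 1` is nonzero
and `O_L` is a domain, so `x' ∈ μ N'` and one factor `μ` cancels. -/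
theorem IsWach.exists_pow_smul_of_succ (hN : N.IsWach) (hN' : N'.IsWach)
    (f : AL p OL ⊗[ALplus OL] N →ₗ[AL p OL] AL p OL ⊗[ALplus OL] N')
    (hf : PhiGamma.IsEquivariant (E := N.baseChange) (E' := N'.baseChange) f) (k : ℕ)
    (h : ∀ x : N, ∃ x' : N', (X : ALplus OL) ^ (k + 1) • f (1 ⊗ₜ x) = 1 ⊗ₜ x') (x : N) :
    ∃ x' : N', (X : ALplus OL) ^ k • f (1 ⊗ₜ x) = 1 ⊗ₜ x' := by
  have := hN'.free
  obtain ⟨γ, v, hv, hvk⟩ := exists_gal_X D (k + 1) k.succ_ne_zero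
  obtain ⟨x', hx'⟩ := h x
  obtain ⟨y, hy⟩ := hN.trivial_mod_mu γ x
  obtain ⟨y', hy'⟩ := h y
  obtain ⟨z, hz⟩ := hN'.trivial_mod_mu γ x'
  have h1 : f (N.galALHom γ (1 ⊗ₜ x)) = N'.galALHom γ (f (1 ⊗ₜ x)) := hf.gal γ _
  have h2 := congr(N'.galALHom γ $hx')
  rw [← algebraMap_smul (AL p OL) ((X : ALplus OL) ^ (k + 1)), galALHom_smul, D.galAL_algebraMap,
    ← h1, galALHom_tmul, galALHom_tmul, map_one, algebraMap_smul, map_pow, hv,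
    eq_add_of_sub_eq' hy, TensorProduct.tmul_add, map_add, TensorProduct.tmul_smul,
    LinearMap.map_smul_of_tower, mul_pow, mul_comm, mul_smul, smul_add, hx',
    smul_comm _ (X : ALplus OL), hy', eq_add_of_sub_eq' hz, ← TensorProduct.tmul_smul,
    ← TensorProduct.tmul_add, ← TensorProduct.tmul_smul] at h2
  have h3 := one_tmul_injective p κ d N' h2
  have h4 : (v ^ (k + 1) - 1) • x' = (X : ALplus OL) • (z - v ^ (k + 1) • y') := by
    rw [smul_add, smul_comm] at h3
    rw [sub_smul, one_smul, smul_sub, sub_eq_sub_iff_add_eq_add, h3, add_comm]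
  let e := Module.Free.chooseBasis (ALplus OL) N'
  -- Freeness of `N'` reduces divisibility by `μ` to coordinates, where only constant terms matter.
  have h5 : ∀ i, X ∣ e.repr x' i := by
    intro i
    refine X_dvd_of_mul (v := v ^ (k + 1) - 1) ?_ ?_
    · rwa [map_sub, map_pow, map_one, sub_ne_zero]
    · have h6 := congr(e.repr $h4 i)
      rw [map_smul, map_smul] at h6
      exact ⟨_, h6⟩
  choose w hw using h5
  have := hN'.finite
  refine ⟨∑ i, w i • e i, pow_smul_cancel (isUnit_X_AL p OL) 1 ?_⟩
  rw [pow_one, smul_smul, ← pow_succ', hx', ← TensorProduct.tmul_smul, Finset.smul_sum]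
  congr 1
  conv_lhs => rw [← e.sum_repr x']
  exact Finset.sum_congr rfl fun i _ => by rw [hw, mul_smul]

/-- With `φ(E) = P E` and `[p]_q ^ k E' = Q φ(E')`, comparing `f(φ(E))` and `φ(f(E))` gives `[p]_q ^
k φ(F) = P F Q` for the matrix `F` of `f`. Only the weights of the target enter `k`. -/
theorem HasWeights.exists_pow_smul {ι ι' : Type*} [Fintype ι] [Fintype ι']
    (e : Module.Basis ι (ALplus OL) N) (e' : Module.Basis ι' (ALplus OL) N') {a b a' b' : ℤ}
    (h : N.HasWeights a b) (h' : N'.HasWeights a' b')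
    (f : AL p OL ⊗[ALplus OL] N →ₗ[AL p OL] AL p OL ⊗[ALplus OL] N')
    (hf : PhiGamma.IsEquivariant (E := N.baseChange) (E' := N'.baseChange) f) :
    ∃ k : ℕ, ∀ i, ∃ w : ι' → ALplus OL,
      (X : ALplus OL) ^ k • f (N.twistBasis e b i) = ∑ j, w j • N'.twistBasis e' b' j := by
  obtain ⟨P, hP⟩ := h.exists_matrix e
  obtain ⟨Q, hQ⟩ := h'.exists_matrix_inv e'
  set k := (b' - a').toNat
  let F : ι → ι' → AL p OL := fun i j => (N'.twistBasis e' b').repr (f (N.twistBasis e b i)) j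
  have hF : ∀ i, f (N.twistBasis e b i) = ∑ j, F i j • N'.twistBasis e' b' j := fun i =>
    ((N'.twistBasis e' b').sum_repr _).symm
  have key : ∀ i j, algebraMap (ALplus OL) (AL p OL) (pq p OL) ^ k * frobAL p κ d OL (F i j) =
      ∑ l, ∑ m, algebraMap (ALplus OL) (AL p OL) (P i l * Q m j) * F l m := by
    intro i
    have h1 : f (N.phiAL (N.twistBasis e b i)) = N'.phiAL (f (N.twistBasis e b i)) := hf.phi _
    -- The coefficients are compared along `φ(E')`, which is linearly independent because it
    -- generates a free module of the same rank.
    have h2 := linearIndependent_of_span _ _ (h'.span_phi e')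
    rw [← funext_iff]
    refine h2.fintypeLinearCombination_injective ?_
    rw [Fintype.linearCombination_apply, Fintype.linearCombination_apply]
    have h3 := congr(pq p OL ^ k • $h1)
    rw [hP, map_sum, hF, map_sum, Finset.smul_sum, Finset.smul_sum] at h3
    refine Eq.trans ?_ (h3.symm.trans ?_)
    · refine Finset.sum_congr rfl fun j _ => ?_
      rw [map_smulₛₗ, mul_smul, ← map_pow, algebraMap_smul]
      rfl
    · simp_rw [Finset.sum_smul]
      rw [Finset.sum_comm]
      refine Finset.sum_congr rfl fun l _ => ?_
      rw [Finset.sum_comm, LinearMap.map_smul_of_tower, hF, Finset.smul_sum, Finset.smul_sum]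
      refine Finset.sum_congr rfl fun m _ => ?_
      rw [smul_comm (P i l), smul_comm _ (F l m), smul_comm _ (P i l), hQ, Finset.smul_sum,
        Finset.smul_sum]
      refine Finset.sum_congr rfl fun j _ => ?_
      rw [mul_comm, mul_smul, algebraMap_smul, mul_smul]
      rfl
  refine ⟨k, fun i => ?_⟩
  -- Since `φ(μ) = [p]_q μ`, passing to `G = μ ^ k F` absorbs exactly `[p]_q ^ k`, leaving `φ(G) = P
  -- G Q`. The matrix `G` is treated as a vector indexed by `ι × ι'`, with no inhomogeneous term.
  have h3 := exists_eq_algebraMap_of_frob (p := p) (κ := κ) (d := d) (OL := OL) (ι := ι × ι')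
    (fun s t => P s.1 t.1 * Q t.2 s.2) 0 (fun s => (muUnit p OL : AL p OL) ^ k * F s.1 s.2) (by
      rintro ⟨i, j⟩
      rw [map_mul, map_pow, frobAL_muUnit κ d, mul_pow, mul_right_comm, key, Fintype.sum_prod_type,
        Pi.zero_apply, map_zero, add_zero, Finset.sum_mul]
      refine Finset.sum_congr rfl fun l _ => ?_
      rw [Finset.sum_mul]
      exact Finset.sum_congr rfl fun m _ => by ring)
  choose w hw using fun j => h3 (i, j)
  refine ⟨w, ?_⟩
  rw [hF, Finset.smul_sum]
  refine Finset.sum_congr rfl fun j _ => ?_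
  rw [← algebraMap_smul (AL p OL) (w j), ← hw, mul_smul, ← algebraMap_smul (AL p OL) (X ^ k),
    map_pow, muUnit_coe]

theorem IsWach.exists_pow_smul (hN : N.IsWach) (hN' : N'.IsWach)
    (f : AL p OL ⊗[ALplus OL] N →ₗ[AL p OL] AL p OL ⊗[ALplus OL] N')
    (hf : PhiGamma.IsEquivariant (E := N.baseChange) (E' := N'.baseChange) f) :
    ∃ k : ℕ, ∀ x : N, ∃ x' : N', (X : ALplus OL) ^ k • f (1 ⊗ₜ x) = 1 ⊗ₜ x' := by
  have := hN.free
  have := hN.finite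
  have := hN'.free
  have := hN'.finite
  obtain ⟨a, b, -, h⟩ := hN.weights
  obtain ⟨a', b', -, h'⟩ := hN'.weights
  let e := Module.Free.chooseBasis (ALplus OL) N
  let e' := Module.Free.chooseBasis (ALplus OL) N'
  obtain ⟨k, hk⟩ := h.exists_pow_smul e e' h' f hf
  choose w hw using hk
  simp_rw [sum_smul_twistBasis, twistBasis_apply] at hw
  -- Returning from `μ ^ b e` and `μ ^ b' e'` to `e` and `e'` costs a factor `μ ^ (b' - b)`; the
  -- additional `(b - b').toNat` makes the exponent nonnegative.
  have key : ∀ i, (X : ALplus OL) ^ (k + (b - b').toNat) • f (1 ⊗ₜ e i) =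
      1 ⊗ₜ ((X : ALplus OL) ^ (b' - b).toNat • ∑ j, w i j • e' j) := by
    intro i
    have h1 := hw i
    rw [map_smul, smul_comm] at h1
    have h2 : (X : ALplus OL) ^ k • f (1 ⊗ₜ e i) = (↑(muUnit p OL ^ (b' - b)) : AL p OL) •
        (1 : AL p OL) ⊗ₜ[ALplus OL] (∑ j, w i j • e' j) := by
      refine ((muUnit p OL ^ b).isUnit.smul_left_cancel).mp (h1.trans ?_)
      rw [smul_smul, ← Units.val_mul, ← zpow_add, add_sub_cancel]
    rw [add_comm, pow_add, mul_smul, h2, TensorProduct.tmul_smul,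
      ← algebraMap_smul (AL p OL) (X ^ (b - b').toNat),
      ← algebraMap_smul (AL p OL) (X ^ (b' - b).toNat), map_pow, map_pow, ← muUnit_coe, smul_smul,
      ← Units.val_pow_eq_pow_val, ← Units.val_pow_eq_pow_val, ← Units.val_mul, ← zpow_natCast,
      ← zpow_natCast, ← zpow_add]
    congr 4
    omega
  refine ⟨k + (b - b').toNat, fun x => ⟨∑ i, e.repr x i • ((X : ALplus OL) ^ (b' - b).toNat • ∑ j, w i j • e' j), ?_⟩⟩
  conv_lhs => rw [← e.sum_repr x]
  rw [TensorProduct.tmul_sum, map_sum, Finset.smul_sum, TensorProduct.tmul_sum]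
  refine Finset.sum_congr rfl fun i _ => ?_
  rw [TensorProduct.tmul_smul, LinearMap.map_smul_of_tower, smul_comm, key, TensorProduct.tmul_smul,
    TensorProduct.tmul_smul, TensorProduct.tmul_smul]

/-- An equivariant map between extensions of scalars of Wach modules preserves the Wach modules. -/
theorem IsWach.exists_eq_tmul (hN : N.IsWach) (hN' : N'.IsWach)
    (f : AL p OL ⊗[ALplus OL] N →ₗ[AL p OL] AL p OL ⊗[ALplus OL] N')
    (hf : PhiGamma.IsEquivariant (E := N.baseChange) (E' := N'.baseChange) f) (x : N) :
    ∃ x' : N', f (1 ⊗ₜ x) = 1 ⊗ₜ x' := by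
  obtain ⟨k, hk⟩ := hN.exists_pow_smul hN' f hf
  have key : ∀ x : N, ∃ x' : N', (X : ALplus OL) ^ 0 • f (1 ⊗ₜ x) = 1 ⊗ₜ x' := by
    induction k with
    | zero => exact hk
    | succ k ih => exact ih (hN.exists_pow_smul_of_succ hN' f hf k hk)
  simpa using key x

end PhiGammaPlus

end FullyFaithful

/-! ### The functor over `A_L⁺` -/

section FunctorA

open CategoryTheory

variable {p : ℕ} [Fact p.Prime] {κ : Type u} [Field κ] [CharP κ p] [PerfectRing κ p] {d : ℕ}
variable {OL : Type v} [CommRing OL] [IsDomain OL] [Algebra (OLsq p κ d) OL]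
  [Algebra.Etale (OLsq p κ d) OL] [Module.Finite (OLsq p κ d) OL] (D : RootData p κ d OL)

/-- The functor `N ↦ A_L ⊗_{A_L⁺} N`. -/
def extensionOfScalars : WachModule D ⥤ EtaleModule D where
  obj N := ⟨N.toPhiGammaPlus.baseChange, N.isWach.isEtale⟩
  map f := ⟨f.map.baseChange (AL p OL), f.equivariant.baseChange⟩
  map_id _ := EtaleModule.Hom.ext (LinearMap.baseChange_id ..)
  map_comp _ _ := EtaleModule.Hom.ext (LinearMap.baseChange_comp ..)

theorem isExtensionOfScalars : IsExtensionOfScalars (extensionOfScalars D) :=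
  ⟨fun _ => LinearEquiv.refl _ _, fun N => N.toPhiGammaPlus.baseChange_isCompatible,
    fun _ _ _ _ _ => rfl⟩

instance : (extensionOfScalars D).Full where
  map_surjective {N N'} f := by
    have := N'.isWach.free
    obtain ⟨g, hg, hfg⟩ := PhiGammaPlus.exists_isEquivariant
      (one_tmul_injective p κ d N'.toPhiGammaPlus) f.map f.equivariant
      (N.isWach.exists_eq_tmul N'.isWach f.map f.equivariant)
    refine ⟨⟨g, hg⟩, EtaleModule.Hom.ext ?_⟩
    change g.baseChange (AL p OL) = f.map
    exact TensorProduct.AlgebraTensorModule.curry_injective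
      (LinearMap.ext_ring (LinearMap.ext fun x => (hfg x).symm))

instance : (extensionOfScalars D).Faithful where
  map_injective {N N'} f g h := by
    have := N'.isWach.free
    refine WachModule.Hom.ext (LinearMap.ext fun x => ?_)
    refine one_tmul_injective (OL := OL) p κ d N'.toPhiGammaPlus ?_
    exact congr(EtaleModule.Hom.map $h (1 ⊗ₜ x))

end FunctorA

end

end Wach

namespace Wach

noncomputable section

/-! ### Extension of scalars after inverting `p` -/

section Generic

variable {R A R' A' M : Type*} [CommRing R] [CommRing A] [CommRing R'] [CommRing A'] [Algebra R A]
  [Algebra R R'] [Algebra A A'] [Algebra R' A'] [Algebra R A'] [IsScalarTower R A A']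
  [IsScalarTower R R' A'] [AddCommGroup M] [Module R M] [Module R' M] [IsScalarTower R R' M]
  (S : Submonoid R) (T : Submonoid A) [IsLocalization S R'] [IsLocalization T A']
  [Module A' (A ⊗[R] M)] [IsScalarTower A A' (A ⊗[R] M)]

/-- If `R'` and `A'` are localizations of `R` and `A`, then `A' ⊗_{R'} M = A ⊗_R M` for an
`R'`-module `M` for which `A ⊗_R M` is an `A'`-module. -/
def localizationTensorEquiv : A' ⊗[R'] M ≃ₗ[A'] A ⊗[R] M :=
  let _ : Module R' (A ⊗[R] M) := Module.compHom _ (algebraMap R' A')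
  have : IsScalarTower R' A' (A ⊗[R] M) := IsScalarTower.of_compHom R' A' (A ⊗[R] M)
  have : IsScalarTower R R' (A ⊗[R] M) := IsScalarTower.of_algebraMap_smul fun r x => by
    change algebraMap R' A' (algebraMap R R' r) • x = r • x
    rw [← IsScalarTower.algebraMap_apply R R' A', IsScalarTower.algebraMap_apply R A A',
      algebraMap_smul, algebraMap_smul]
  let f : A' ⊗[R'] M →ₗ[A'] A ⊗[R] M := LinearMap.liftBaseChange A'
    (LinearMap.extendScalarsOfIsLocalization S R' (TensorProduct.mk R A M 1))
  let g : A ⊗[R] M →ₗ[A] A' ⊗[R'] M := LinearMap.liftBaseChange A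
    ((TensorProduct.mk R' A' M 1).restrictScalars R)
  have hf : ∀ x : M, f (1 ⊗ₜ x) = 1 ⊗ₜ x := fun x => by
    rw [LinearMap.liftBaseChange_tmul, one_smul]; rfl
  have hg : ∀ x : M, g (1 ⊗ₜ x) = 1 ⊗ₜ x := fun x => by
    rw [LinearMap.liftBaseChange_tmul, one_smul]; rfl
  have h1 : (LinearMap.extendScalarsOfIsLocalization T A' g).comp f = LinearMap.id := by
    refine TensorProduct.AlgebraTensorModule.curry_injective
      (LinearMap.ext_ring (LinearMap.ext fun x => ?_))
    change g (f (1 ⊗ₜ x)) = 1 ⊗ₜ x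
    rw [hf, hg]
  have h2 : f.comp (LinearMap.extendScalarsOfIsLocalization T A' g) = LinearMap.id := by
    have h3 : (f.restrictScalars A).comp g = LinearMap.id := by
      refine TensorProduct.AlgebraTensorModule.curry_injective
        (LinearMap.ext_ring (LinearMap.ext fun x => ?_))
      change f (g (1 ⊗ₜ x)) = 1 ⊗ₜ x
      rw [hg, hf]
    exact LinearMap.ext fun x => congr($h3 x)
  LinearEquiv.ofLinearMap f (LinearMap.extendScalarsOfIsLocalization T A' g) h2 h1

theorem localizationTensorEquiv_tmul (a : A') (x : M) :
    localizationTensorEquiv S T (a ⊗ₜ[R'] x) = a • (1 : A) ⊗ₜ[R] x :=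
  let _ : Module R' (A ⊗[R] M) := Module.compHom _ (algebraMap R' A')
  have : IsScalarTower R' A' (A ⊗[R] M) := IsScalarTower.of_compHom R' A' (A ⊗[R] M)
  LinearMap.liftBaseChange_tmul ..

end Generic

/-! ### Lattices and modules over `B_L⁺` after extension to `A_L` -/

section PhiGammaB

open PowerSeries

variable {p : ℕ} [Fact p.Prime] {κ : Type u} [Field κ] [CharP κ p] [PerfectRing κ p] {d : ℕ}
variable {OL : Type v} [CommRing OL] [IsDomain OL] [Algebra (OLsq p κ d) OL]
  [Algebra.Etale (OLsq p κ d) OL] [Module.Finite (OLsq p κ d) OL] {D : RootData p κ d OL}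

set_option linter.unusedSectionVars false

instance (p : ℕ) (OL : Type v) [CommRing OL] :
    IsScalarTower (ALplus OL) (BLplus p OL) (BL p OL) := .of_algebraMap_eq fun a => by
  rw [show algebraMap (BLplus p OL) (BL p OL) = BLplusToBL p OL from rfl, BLplusToBL,
    IsLocalization.Away.lift_eq]
  rfl

/-- Tensor products preserve localisations over `A_L⁺`, and the image in `A_L` of the powers of `p`
is again the powers of `p`. -/
theorem isLocalizedModule_baseChange (p : ℕ) {OL : Type v} [CommRing OL] {N M : Type v}
    [AddCommGroup N] [Module (ALplus OL) N] [AddCommGroup M] [Module (ALplus OL) M]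
    (i : N →ₗ[ALplus OL] M) [IsLocalizedModule (Submonoid.powers (p : ALplus OL)) i] :
    IsLocalizedModule (Submonoid.powers (p : AL p OL)) (i.baseChange (AL p OL)) := by
  have h : IsLocalizedModule (Submonoid.powers (p : ALplus OL))
      ((i.baseChange (AL p OL)).restrictScalars (ALplus OL)) := by
    have h1 := IsLocalizedModule.of_linearEquiv_right (Submonoid.powers (p : ALplus OL))
      (TensorProduct.AlgebraTensorModule.rTensor (ALplus OL) (AL p OL) i)
      (TensorProduct.comm (ALplus OL) (AL p OL) N)
    have h2 := IsLocalizedModule.of_linearEquiv (Submonoid.powers (p : ALplus OL))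
      (TensorProduct.AlgebraTensorModule.rTensor (ALplus OL) (AL p OL) i ∘ₗ
        (TensorProduct.comm (ALplus OL) (AL p OL) N).toLinearMap)
      (TensorProduct.comm (ALplus OL) M (AL p OL))
    convert h2
    exact TensorProduct.ext' fun _ _ => rfl
  have h3 := IsLocalizedModule.of_restrictScalars (Submonoid.powers (p : ALplus OL))
    (i.baseChange (AL p OL))
  rwa [Algebra.algebraMapSubmonoid_powers, map_natCast] at h3

/-- Since `p` is already invertible on `M`, it is so on `A_L ⊗ M`, which is therefore its own
localisation. This is the source of its `B_L`-module structure. -/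
theorem isLocalizedModule_id_tensor (p : ℕ) (OL : Type v) [CommRing OL] (M : Type v)
    [AddCommGroup M] [Module (ALplus OL) M] [Module (BLplus p OL) M]
    [IsScalarTower (ALplus OL) (BLplus p OL) M] :
    IsLocalizedModule (Submonoid.powers (p : AL p OL))
      (LinearMap.id : AL p OL ⊗[ALplus OL] M →ₗ[AL p OL] AL p OL ⊗[ALplus OL] M) := by
  have := _root_.isLocalizedModule_id (Submonoid.powers (p : ALplus OL)) M (BLplus p OL)
  have h := isLocalizedModule_baseChange p (LinearMap.id : M →ₗ[ALplus OL] M)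
  rwa [LinearMap.baseChange_id] at h

/-- The structure of a `B_L`-module on `A_L ⊗ M`, for a module `M` over `B_L⁺`. -/
@[reducible] def moduleBL (p : ℕ) (OL : Type v) [CommRing OL] (M : Type v)
    [AddCommGroup M] [Module (ALplus OL) M] [Module (BLplus p OL) M]
    [IsScalarTower (ALplus OL) (BLplus p OL) M] : Module (BL p OL) (AL p OL ⊗[ALplus OL] M) :=
  have := isLocalizedModule_id_tensor p OL M
  IsLocalizedModule.module (Submonoid.powers (p : AL p OL))
    (LinearMap.id : AL p OL ⊗[ALplus OL] M →ₗ[AL p OL] AL p OL ⊗[ALplus OL] M)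

theorem isScalarTower_moduleBL (p : ℕ) (OL : Type v) [CommRing OL] (M : Type v)
    [AddCommGroup M] [Module (ALplus OL) M] [Module (BLplus p OL) M]
    [IsScalarTower (ALplus OL) (BLplus p OL) M] :
    letI := moduleBL p OL M
    IsScalarTower (AL p OL) (BL p OL) (AL p OL ⊗[ALplus OL] M) :=
  have := isLocalizedModule_id_tensor p OL M
  IsLocalizedModule.isScalarTower_module (Submonoid.powers (p : AL p OL))
    (LinearMap.id : AL p OL ⊗[ALplus OL] M →ₗ[AL p OL] AL p OL ⊗[ALplus OL] M)

variable (p κ d) in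
include κ d in
-- The kernel consists of `p`-power torsion, and the free module `A_L ⊗ N` has none.
theorem injective_baseChange {N M : Type v} [AddCommGroup N] [Module (ALplus OL) N]
    [Module.Free (ALplus OL) N] [AddCommGroup M] [Module (ALplus OL) M] (i : N →ₗ[ALplus OL] M)
    [IsLocalizedModule (Submonoid.powers (p : ALplus OL)) i] :
    Function.Injective (i.baseChange (AL p OL)) := by
  have := isLocalizedModule_baseChange p i
  intro x y h
  obtain ⟨⟨_, k, rfl⟩, hk⟩ :=
    IsLocalizedModule.exists_of_eq (S := Submonoid.powers (p : AL p OL)) h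
  let e := Module.Free.chooseBasis (AL p OL) (AL p OL ⊗[ALplus OL] N)
  refine e.repr.injective (Finsupp.ext fun j => sub_eq_zero.mp ?_)
  have h1 : (p : AL p OL) ^ k • x = (p : AL p OL) ^ k • y := hk
  have h2 := congr(e.repr $h1 j)
  rw [map_smul, map_smul] at h2
  refine AL_p_pow_mul_eq_zero p κ d OL (n := k) ?_
  rw [mul_sub]
  exact sub_eq_zero.mpr h2

end PhiGammaB

end

end Wach

namespace Wach

noncomputable section

/-! ### Full faithfulness for Wach modules over `B_L⁺` -/

section FullyFaithfulB

open PowerSeries CategoryTheory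

variable {p : ℕ} [Fact p.Prime] {κ : Type u} [Field κ] [CharP κ p] [PerfectRing κ p] {d : ℕ}
variable {OL : Type v} [CommRing OL] [IsDomain OL] [Algebra (OLsq p κ d) OL]
  [Algebra.Etale (OLsq p κ d) OL] [Module.Finite (OLsq p κ d) OL] {D : RootData p κ d OL}

namespace WachModuleB

variable (M M' : WachModuleB D)

instance : Module (BL p OL) (AL p OL ⊗[ALplus OL] M.toPhiGammaPlus) :=
  moduleBL p OL M.toPhiGammaPlus

instance : IsScalarTower (AL p OL) (BL p OL) (AL p OL ⊗[ALplus OL] M.toPhiGammaPlus) :=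
  isScalarTower_moduleBL p OL M.toPhiGammaPlus

/-- The isomorphism `B_L ⊗_{B_L⁺} M = A_L ⊗_{A_L⁺} M`. -/
def tensorEquiv : (BL p OL ⊗[BLplus p OL] M.toPhiGammaPlus) ≃ₗ[BL p OL]
    (AL p OL ⊗[ALplus OL] M.toPhiGammaPlus) :=
  localizationTensorEquiv (Submonoid.powers (p : ALplus OL)) (Submonoid.powers (p : AL p OL))

theorem tensorEquiv_tmul (b : BL p OL) (x : M.toPhiGammaPlus) :
    M.tensorEquiv (b ⊗ₜ x) = b • (1 : AL p OL) ⊗ₜ[ALplus OL] x :=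
  localizationTensorEquiv_tmul (Submonoid.powers (p : ALplus OL)) (Submonoid.powers (p : AL p OL))
    b x

theorem finite_tensor : Module.Finite (BL p OL) (AL p OL ⊗[ALplus OL] M.toPhiGammaPlus) :=
  have := M.finite
  Module.Finite.equiv M.tensorEquiv

theorem p_pow_smul_cancel (k : ℕ) {x y : M.toPhiGammaPlus}
    (h : (p : ALplus OL) ^ k • x = (p : ALplus OL) ^ k • y) : x = y := by
  have h1 := _root_.isLocalizedModule_id (Submonoid.powers (p : ALplus OL)) M.toPhiGammaPlus
    (BLplus p OL)
  exact IsLocalizedModule.smul_injective (LinearMap.id : M.toPhiGammaPlus →ₗ[ALplus OL] _)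
    (⟨(p : ALplus OL) ^ k, k, rfl⟩ : Submonoid.powers (p : ALplus OL)) h

theorem exists_p_pow_smul (k : ℕ) (x : M.toPhiGammaPlus) : ∃ y, (p : ALplus OL) ^ k • y = x := by
  have h1 := _root_.isLocalizedModule_id (Submonoid.powers (p : ALplus OL)) M.toPhiGammaPlus
    (BLplus p OL)
  exact ((Module.End.isUnit_iff _).mp (IsLocalizedModule.map_units
    (LinearMap.id : M.toPhiGammaPlus →ₗ[ALplus OL] _)
    (⟨(p : ALplus OL) ^ k, k, rfl⟩ : Submonoid.powers (p : ALplus OL)))).2 x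

theorem p_pow_smul_tensor_cancel (k : ℕ) {x y : AL p OL ⊗[ALplus OL] M.toPhiGammaPlus}
    (h : (p : ALplus OL) ^ k • x = (p : ALplus OL) ^ k • y) : x = y := by
  have h1 := isLocalizedModule_id_tensor p OL M.toPhiGammaPlus
  refine IsLocalizedModule.smul_injective
    (LinearMap.id : AL p OL ⊗[ALplus OL] M.toPhiGammaPlus →ₗ[AL p OL] _)
    (⟨(p : AL p OL) ^ k, k, rfl⟩ : Submonoid.powers (p : AL p OL)) ?_
  rw [← algebraMap_smul (AL p OL) ((p : ALplus OL) ^ k) x,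
    ← algebraMap_smul (AL p OL) ((p : ALplus OL) ^ k) y, map_pow, map_natCast] at h
  exact h

/-- A power of `p` moves `x` into the lattice `N`, and `N → A_L ⊗ N → A_L ⊗ M` is injective at both
stages. -/
theorem one_tmul_injective :
    Function.Injective fun x : M.toPhiGammaPlus => (1 : AL p OL) ⊗ₜ[ALplus OL] x := by
  obtain ⟨N, i, -, -, hi⟩ := M.exists_lattice
  have := N.isWach.free
  have h0 : ∀ x : M.toPhiGammaPlus, (1 : AL p OL) ⊗ₜ[ALplus OL] x = 0 → x = 0 := by
    intro x hx
    obtain ⟨⟨n, ⟨_, k, rfl⟩⟩, hn⟩ := IsLocalizedModule.surj (Submonoid.powers (p : ALplus OL)) i x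
    have hn : (p : ALplus OL) ^ k • x = i n := hn
    have h1 : i.baseChange (AL p OL) (1 ⊗ₜ n) = 0 := by
      rw [LinearMap.baseChange_tmul, ← hn, TensorProduct.tmul_smul, hx, smul_zero]
    have h2 : n = 0 := Wach.one_tmul_injective p κ d N.toPhiGammaPlus
      (((injective_iff_map_eq_zero _).mp (injective_baseChange p κ d i) _ h1).trans
        (TensorProduct.tmul_zero _ _).symm)
    refine M.p_pow_smul_cancel k ?_
    rw [hn, h2, map_zero, smul_zero]
  intro x y h
  refine sub_eq_zero.mp (h0 _ ?_)
  rw [TensorProduct.tmul_sub]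
  exact sub_eq_zero.mpr h

variable {M M'}

/-- A multiple `p ^ k f` maps the lattice `A_L ⊗ N` to `A_L ⊗ N'`, and it is still equivariant
because `φ` and `Γ_L` fix `p`. The integral result applies to it, and powers of `p` can be divided
out in `M'`. -/
theorem exists_eq_tmul
    (f : AL p OL ⊗[ALplus OL] M.toPhiGammaPlus →ₗ[AL p OL] AL p OL ⊗[ALplus OL] M'.toPhiGammaPlus)
    (hf : PhiGamma.IsEquivariant (E := M.toPhiGammaPlus.baseChange)
      (E' := M'.toPhiGammaPlus.baseChange) f) (x : M.toPhiGammaPlus) :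
    ∃ x' : M'.toPhiGammaPlus, f (1 ⊗ₜ x) = 1 ⊗ₜ x' := by
  obtain ⟨N, i, hi, -, hiM⟩ := M.exists_lattice
  obtain ⟨N', i', hi', -, hiM'⟩ := M'.exists_lattice
  have := N.isWach.free
  have := N.isWach.finite
  have := N'.isWach.free
  have := isLocalizedModule_baseChange p i'
  have hinj := injective_baseChange p κ d i'
  have : Module.FinitePresentation (AL p OL) (AL p OL ⊗[ALplus OL] N.toPhiGammaPlus) :=
    Module.finitePresentation_of_projective _ _
  -- Finite presentation of `A_L ⊗ N` provides one denominator `p ^ k` for the whole lattice.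
  obtain ⟨h, ⟨_, k, rfl⟩, hh⟩ := Module.FinitePresentation.exists_lift_of_isLocalizedModule
    (Submonoid.powers (p : AL p OL)) (i'.baseChange (AL p OL))
    (f.comp (i.baseChange (AL p OL)))
  have hh : ∀ z, i'.baseChange (AL p OL) (h z) =
    (p : AL p OL) ^ k • f (i.baseChange (AL p OL) z) := fun z => congr($hh z)
  have he : PhiGamma.IsEquivariant (E := N.toPhiGammaPlus.baseChange)
      (E' := N'.toPhiGammaPlus.baseChange) h := by
    have hfi := PhiGamma.IsEquivariant.comp hi.baseChange hf
    constructor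
    · intro γ (z : AL p OL ⊗[ALplus OL] N.toPhiGammaPlus)
      apply hinj
      have h1 : i'.baseChange (AL p OL) (N'.galALHom γ (h z)) =
          M'.galALHom γ (i'.baseChange (AL p OL) (h z)) := hi'.baseChange.gal γ _
      have h2 : f (i.baseChange (AL p OL) (N.galALHom γ z)) =
          M'.galALHom γ (f (i.baseChange (AL p OL) z)) := hfi.gal γ z
      change i'.baseChange (AL p OL) (h (N.galALHom γ z)) =
        i'.baseChange (AL p OL) (N'.galALHom γ (h z))
      rw [h1, hh, hh, h2, PhiGammaPlus.galALHom_smul, map_pow, map_natCast]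
    · intro (z : AL p OL ⊗[ALplus OL] N.toPhiGammaPlus)
      apply hinj
      have h1 : i'.baseChange (AL p OL) (N'.phiAL (h z)) =
          M'.phiAL (i'.baseChange (AL p OL) (h z)) := hi'.baseChange.phi _
      have h2 : f (i.baseChange (AL p OL) (N.phiAL z)) =
          M'.phiAL (f (i.baseChange (AL p OL) z)) := hfi.phi z
      change i'.baseChange (AL p OL) (h (N.phiAL z)) =
        i'.baseChange (AL p OL) (N'.phiAL (h z))
      rw [h1, hh, hh, h2, map_smulₛₗ, map_pow, map_natCast]
  obtain ⟨⟨n, ⟨_, l, rfl⟩⟩, hn⟩ := IsLocalizedModule.surj (Submonoid.powers (p : ALplus OL)) i x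
  have hn : (p : ALplus OL) ^ l • x = i n := hn
  obtain ⟨n', hn'⟩ := N.isWach.exists_eq_tmul N'.isWach h he n
  -- One power `p ^ k` comes from replacing `f` by `h`, the other, `p ^ l`, from moving `x` into
  -- `N`.
  obtain ⟨x', hx'⟩ := M'.exists_p_pow_smul (k + l) (i' n')
  refine ⟨x', M'.p_pow_smul_tensor_cancel (k + l) ?_⟩
  have h1 := hh (1 ⊗ₜ n)
  rw [hn', LinearMap.baseChange_tmul, LinearMap.baseChange_tmul, ← hn, ← hx',
    TensorProduct.tmul_smul, TensorProduct.tmul_smul, LinearMap.map_smul_of_tower,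
    ← map_natCast (algebraMap (ALplus OL) (AL p OL)), ← map_pow, algebraMap_smul, smul_smul,
    ← pow_add] at h1
  exact h1.symm

variable (M)

/-- The étale `(φ, Γ_L)`-module `B_L ⊗_{B_L⁺} M = A_L ⊗_{A_L⁺} M`. -/
def toEtaleModuleB : EtaleModuleB D where
  toPhiGamma := M.toPhiGammaPlus.baseChange
  moduleB := moduleBL p OL M.toPhiGammaPlus
  isScalarTower := isScalarTower_moduleBL p OL M.toPhiGammaPlus
  finite := M.finite_tensor
  exists_lattice := by
    obtain ⟨N, i, hi, -, hiM⟩ := M.exists_lattice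
    have := N.isWach.free
    exact ⟨⟨N.toPhiGammaPlus.baseChange, N.isWach.isEtale⟩, i.baseChange (AL p OL), hi.baseChange,
      injective_baseChange p κ d i, isLocalizedModule_baseChange p i⟩

variable {M}

/-- The map `B_L ⊗ f`. -/
def baseChangeMap (f : M.toPhiGammaPlus →ₗ[ALplus OL] M'.toPhiGammaPlus) :
    (AL p OL ⊗[ALplus OL] M.toPhiGammaPlus) →ₗ[BL p OL] (AL p OL ⊗[ALplus OL] M'.toPhiGammaPlus) :=
  LinearMap.extendScalarsOfIsLocalization (Submonoid.powers (p : AL p OL)) (BL p OL)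
    (f.baseChange (AL p OL))

theorem baseChangeMap_tmul (f : M.toPhiGammaPlus →ₗ[ALplus OL] M'.toPhiGammaPlus) (b : BL p OL)
    (x : M.toPhiGammaPlus) :
    baseChangeMap f (M.tensorEquiv (b ⊗ₜ x)) = M'.tensorEquiv (b ⊗ₜ f x) := by
  rw [tensorEquiv_tmul, tensorEquiv_tmul, map_smul]
  rfl

end WachModuleB

variable (D)

/-- The functor `M ↦ B_L ⊗_{B_L⁺} M`. -/
def extensionOfScalarsB : WachModuleB D ⥤ EtaleModuleB D where
  obj M := M.toEtaleModuleB
  map f := ⟨WachModuleB.baseChangeMap (f.map.restrictScalars (ALplus OL)),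
    f.equivariant.baseChange⟩
  map_id M := EtaleModuleB.Hom.ext (LinearMap.ext fun x =>
    congr($(LinearMap.baseChange_id (R := ALplus OL) (A := AL p OL) (M := M.toPhiGammaPlus)) x))
  map_comp f g := EtaleModuleB.Hom.ext (LinearMap.ext fun x =>
    congr($(LinearMap.baseChange_comp (A := AL p OL) (f.map.restrictScalars (ALplus OL))
      (g.map.restrictScalars (ALplus OL))) x))

theorem isExtensionOfScalarsB : IsExtensionOfScalarsB (extensionOfScalarsB D) := by
  refine ⟨fun M => M.tensorEquiv, fun M => ?_, fun M M' f b x => ?_⟩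
  · have h : ∀ x, M.tensorEquiv (1 ⊗ₜ x) = 1 ⊗ₜ x := fun x => by
      rw [WachModuleB.tensorEquiv_tmul, one_smul]
    have h1 : (fun x => M.tensorEquiv (1 ⊗ₜ x)) = fun x => 1 ⊗ₜ x := funext h
    exact h1 ▸ M.toPhiGammaPlus.baseChange_isCompatible
  · exact WachModuleB.baseChangeMap_tmul (f.map.restrictScalars (ALplus OL)) b x

instance : (extensionOfScalarsB D).Full where
  map_surjective {M M'} f := by
    let f' : AL p OL ⊗[ALplus OL] M.toPhiGammaPlus →ₗ[AL p OL]
      AL p OL ⊗[ALplus OL] M'.toPhiGammaPlus := f.map.restrictScalars (AL p OL)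
    obtain ⟨g, hg, hfg⟩ := PhiGammaPlus.exists_isEquivariant M'.one_tmul_injective f' f.equivariant
      (WachModuleB.exists_eq_tmul f' f.equivariant)
    -- An `A_L⁺`-linear map between modules over the localisation `B_L⁺` is automatically
    -- `B_L⁺`-linear.
    refine ⟨⟨LinearMap.extendScalarsOfIsLocalization (Submonoid.powers (p : ALplus OL))
      (BLplus p OL) g, hg⟩, EtaleModuleB.Hom.ext ?_⟩
    have h1 : g.baseChange (AL p OL) = f' :=
      TensorProduct.AlgebraTensorModule.curry_injective
        (LinearMap.ext_ring (LinearMap.ext fun x => (hfg x).symm))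
    exact LinearMap.ext fun z => LinearMap.congr_fun h1 z

instance : (extensionOfScalarsB D).Faithful where
  map_injective {M M'} f g h := by
    refine WachModuleB.Hom.ext (LinearMap.ext fun x => M'.one_tmul_injective ?_)
    have h1 : EtaleModuleB.Hom.map ((extensionOfScalarsB D).map f) =
      EtaleModuleB.Hom.map ((extensionOfScalarsB D).map g) := congrArg EtaleModuleB.Hom.map h
    exact LinearMap.congr_fun h1 ((1 : AL p OL) ⊗ₜ[ALplus OL] x)

end FullyFaithfulB

end

end Wach

theorem mainTheorem6 (p : ℕ) [Fact p.Prime] (κ : Type u) [Field κ] [CharP κ p] [PerfectRing κ p]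
    (d : ℕ) (OL : Type v) [CommRing OL] [IsDomain OL] [Algebra (Wach.OLsq p κ d) OL]
    [Algebra.Etale (Wach.OLsq p κ d) OL] [Module.Finite (Wach.OLsq p κ d) OL]
    (D : Wach.RootData p κ d OL) :
    (∃ F : CategoryTheory.Functor (Wach.WachModule D) (Wach.EtaleModule D),
      Wach.IsExtensionOfScalars F ∧ F.Full ∧ F.Faithful) ∧
    (∃ F : CategoryTheory.Functor (Wach.WachModuleB D) (Wach.EtaleModuleB D),
      Wach.IsExtensionOfScalarsB F ∧ F.Full ∧ F.Faithful) :=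
  ⟨⟨Wach.extensionOfScalars D, Wach.isExtensionOfScalars D, inferInstance, inferInstance⟩,
    ⟨Wach.extensionOfScalarsB D, Wach.isExtensionOfScalarsB D, inferInstance, inferInstance⟩⟩
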